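/- Notation. Let $\Omega=\{0,1\}^\infty$, let $S$ be the set of finite binary strings, and for $s\in S$ let $\Delta(s)\subseteq\Omega$ be the set of sequences with prefix $s$. Let $X=Y=\Omega$. A probability $P$ on $X\times Y$ is computable if some computable $A:S\times S\times\mathbb N\to\mathbb Q$ satisfies $|P(\Delta(x)\times\Delta(y))-A(x,y,k)|<\frac1k$ for all $x,y\in S$, $k\ge 1$; computability of a probability on $\Omega$, also with an oracle, is defined in the same way. A test with respect to a probability $Q$ on $\Omega$ is a recursively enumerable $U\subseteq S\times\mathbb N$ such that the sets $\tilde U_n=\bigcup\{\Delta(x):(x,n)\in U\}$ satisfy $\tilde U_n\supseteq\tilde U_{n+1}$ and $Q(\tilde U_n)<2^{-n}$ for all $n$. The ML-random set is $\mathcal R^Q=\bigl(\bigcup_{U\text{ test}}\bigcap_n\tilde U_n\bigr)^c$ (no computability of $Q$ is required), and $\mathcal R^{Q,y^\infty}$ is defined in the same way with the tests that are recursively enumerable with oracle $y^\infty$. For a probability $P$ on $X\times Y$, $\mathcal R^P$ is defined likewise with $\Delta(x)\times\Delta(y)$ in place of $\Delta(x)$, and $\mathcal R^P_{y^\infty}=\{x^\infty:(x^\infty,y^\infty)\in\mathcal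 R^P\}$. Let $P_X,P_Y$ be the marginals. For $y\in S$ with $P_Y(\Delta(y))>0$ let $P(\cdot\mid y)$ be the probability on $X$ given by $P(A\mid y)=P(A\times\Delta(y))/P_Y(\Delta(y))$; for $y^\infty\in\Omega$ let $P(\cdot\mid y^\infty)$ be the probability on $X$ with $P(\Delta(x)\mid y^\infty)=\lim_{y\to y^\infty}P(\Delta(x)\mid y)$ for all $x\in S$, where $y\to y^\infty$ runs through the prefixes of $y^\infty$, provided that these limits exist and define a probability. The posterior distributions $P(\cdot\mid x)$ and $P(\cdot\mid x^\infty)$ on $Y$ are defined in the same way with the coordinates exchanged. $\bigcap_{y\to y^\infty}$ denotes the intersection over all prefixes $y$ of $y^\infty$. Theorem. Let $P$ be a computable probability on $X\times Y$. (a) For every $y^\infty\in\mathcal R^{P_Y}$ the conditional probability $P(\cdot\mid y^\infty)$ exists, and $$\bigcap_{y\to y^\infty}\mathcal R^{P(\cdot\mid y)}\supseteq\mathcal R^{P(\cdot\mid y^\infty)}\quad\text{and}\quad\bigcap_{y\to y^\infty}\mathcal R^{P(\cdot\mid y)}\supseteq\mathcal R^P_{y^\infty}.$$ Assume for (b) and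 (c) that the posterior is consistent, i.e. that at least one of the following (equivalent) conditions holds, where in (1) and (2) $y,z\in S$ have positive $P_Y$-probability: (1) $P(\cdot\mid y)\perp P(\cdot\mid z)$ whenever $\Delta(y)\cap\Delta(z)=\emptyset$; (2) $\mathcal R^{P(\cdot\mid y)}\cap\mathcal R^{P(\cdot\mid z)}=\emptyset$ whenever $\Delta(y)\cap\Delta(z)=\emptyset$; (3) for every $(x^\infty,y^\infty)\in\mathcal R^P$ the posterior distributions $P(\cdot\mid x)$ converge weakly to $P(\cdot\mid x^\infty)$ as $x\to x^\infty$, and $P(\{y^\infty\}\mid x^\infty)=1$; (4) $\mathcal R^P_{y^\infty}\cap\mathcal R^P_{z^\infty}=\emptyset$ whenever $y^\infty\ne z^\infty$; (5) for every $x^\infty\in\mathcal R^{P_X}$ there is a unique $y^\infty\in\mathcal R^{P_Y}$ with $x^\infty\in\mathcal R^P_{y^\infty}$; (6) there is a function $f:X\to Y$ with $f(x^\infty)=y^\infty$ for all $(x^\infty,y^\infty)\in\mathcal R^P$; (7) there are a measurable $f:X\to Y$ and a measurable $Y'\subseteq\mathcal R^{P_Y}$ with $P_Y(Y')=1$ such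 that for each $y^\infty\in Y'$, $f(x^\infty)=y^\infty$ for $P(\cdot\mid y^\infty)$-almost all $x^\infty$. (b) For every $y^\infty\in\mathcal R^{P_Y}$, $$\bigcap_{y\to y^\infty}\mathcal R^{P(\cdot\mid y)}=\mathcal R^P_{y^\infty}\supseteq\mathcal R^{P(\cdot\mid y^\infty)}\supseteq\mathcal R^{P(\cdot\mid y^\infty),y^\infty}.$$ (c) For every $y^\infty\in\mathcal R^{P_Y}$ such that $P(\cdot\mid y^\infty)$ is computable with oracle $y^\infty$, $$\bigcap_{y\to y^\infty}\mathcal R^{P(\cdot\mid y)}=\mathcal R^P_{y^\infty}=\mathcal R^{P(\cdot\mid y^\infty)}=\mathcal R^{P(\cdot\mid y^\infty),y^\infty}.$$ -/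

import Mathlib

open MeasureTheory Set Filter Topology
open scoped ENNReal BoundedContinuousFunction

namespace BayesML

/-- The space of infinite binary sequences, with its product topology and product (= Borel)
σ-algebra. -/
abbrev Cantor : Type := ℕ → Bool

/-- The finite binary strings. -/
abbrev Str : Type := List Bool

/-- The cylinder `Δ(s)` of all infinite sequences with prefix `s`. -/
def cyl (s : Str) : Set Cantor := {ω | ∀ (i : ℕ) (h : i < s.length), ω i = s[i]}

/-- The rectangle `Δ(s) × Δ(t)`. -/
def cyl₂ (p : Str × Str) : Set (Cantor × Cantor) := cyl p.1 ×ˢ cyl p.2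

/-- The prefix of length `n` of an infinite sequence. -/
def pre (ω : Cantor) (n : ℕ) : Str := List.ofFn fun i : Fin n => ω i

/-- An infinite binary sequence as a set of oracles with this sequence as its only element. -/
def oracle (ω : Cantor) : Set (ℕ →. ℕ) := {fun n => Part.some (ω n).toNat}

/-- `p` is recursively enumerable with oracle `O`: it is the domain of a partial function that is
recursive in `O`. Without oracle this is `REPred`, see `reIn_empty`. -/
def REIn {α : Type} [Primcodable α] (O : Set (ℕ →. ℕ)) (p : α → Prop) : Prop :=
  RecursiveIn O fun a => Part.assert (p a) fun _ => Part.some ()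

theorem reIn_empty {α : Type} [Primcodable α] (p : α → Prop) :
    REIn ∅ p ↔ REPred p := by
  unfold REIn REPred
  exact recursiveIn_empty_iff

/-! In the next definitions `B : ι → Set α` is the family of basic open sets, indexed by strings
(`B = cyl`) or by pairs of strings (`B = cyl₂`), and `O` is a set of oracles (`∅`: no oracle). -/

section Randomness

variable {ι α : Type} [Primcodable ι] [MeasurableSpace α]

/-- `μ` is computable with oracle `O`: some function `A : ι × ℕ → ℚ` that is computable with
oracle `O` (numerator and denominator are) approximates `μ` on the basic sets to any precision. -/
def ComputableMeasureIn (O : Set (ℕ →. ℕ)) (B : ι → Set α) (μ : Measure α) : Prop :=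
  ∃ A : ι × ℕ → ℚ,
    ComputableIn O (fun p => (A p).num) ∧ ComputableIn O (fun p => (A p).den) ∧
    ∀ (s : ι) (k : ℕ), |μ.real (B s) - (A (s, k) : ℝ)| < 1 / ((k : ℝ) + 1)

/-- The open set `Ũ_n`, the union of the basic sets with an index in `U_n = {s | (s, n) ∈ U}`. -/
def layer (B : ι → Set α) (U : Set (ι × ℕ)) (n : ℕ) : Set α :=
  ⋃ s ∈ {s : ι | (s, n) ∈ U}, B s

/-- `U` is a test with respect to `μ`, recursively enumerable with oracle `O`. -/
structure IsTest (O : Set (ℕ →. ℕ)) (B : ι → Set α) (μ : Measure α) (U : Set (ι × ℕ)) : Prop where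
  re : REIn O (fun p => p ∈ U)
  anti : ∀ n, layer B U (n + 1) ⊆ layer B U n
  small : ∀ n, μ (layer B U n) < (2 : ℝ≥0∞)⁻¹ ^ n

/-- The set of ML-random points with respect to `μ` with oracle `O`: the complement of the union of
the null sets `⋂ n, Ũ_n` of all tests `U`. -/
def MLRandomIn (O : Set (ℕ →. ℕ)) (B : ι → Set α) (μ : Measure α) : Set α :=
  (⋃ U ∈ {U : Set (ι × ℕ) | IsTest O B μ U}, ⋂ n, layer B U n)ᶜ

end Randomness

/-- The ML-random set `R^μ` of a probability on the space of sequences. -/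
def MLR (μ : Measure Cantor) : Set Cantor := MLRandomIn ∅ cyl μ

/-- The ML-random set `R^{μ,ω}` with oracle `ω`. -/
def MLROracle (μ : Measure Cantor) (ω : Cantor) : Set Cantor := MLRandomIn (oracle ω) cyl μ

/-- The ML-random set `R^P` of a probability on the product space. -/
def MLR₂ (P : Measure (Cantor × Cantor)) : Set (Cantor × Cantor) := MLRandomIn ∅ cyl₂ P

/-- The section `R^P_y` at the parameter `y`. -/
def mlrSection (P : Measure (Cantor × Cantor)) (y : Cantor) : Set Cantor :=
  {x | (x, y) ∈ MLR₂ P}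

/-- `P(· | y)` for a string `y`: the conditional distribution of the first coordinate, given that
the second one lies in `Δ(y)` (the zero measure if this event has probability zero). -/
noncomputable def condStr (P : Measure (Cantor × Cantor)) (y : Str) : Measure Cantor :=
  (ProbabilityTheory.cond P (Prod.snd ⁻¹' cyl y)).map Prod.fst

/-- `Q` is the conditional probability `P(· | y)` at the sequence `y`: it is a probability with
`Q(Δ(x)) = lim P(x | y₀…y_{n-1})` for all strings `x`. -/
def IsCondAt (P : Measure (Cantor × Cantor)) (y : Cantor) (Q : Measure Cantor) : Prop :=
  IsProbabilityMeasure Q ∧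
    ∀ x : Str, Tendsto (fun n => condStr P (pre y n) (cyl x)) atTop (𝓝 (Q (cyl x)))

open Classical in
/-- The conditional probability `P(· | y)` at the sequence `y`, defined by the limits of
`P(x | y₀…y_{n-1})`; the zero measure if these limits do not define a probability. -/
noncomputable def condAt (P : Measure (Cantor × Cantor)) (y : Cantor) : Measure Cantor :=
  if h : ∃ Q, IsCondAt P y Q then h.choose else 0

/-- The set `⋂_{y → y^∞} R^{P(· | y)}`, over all prefixes of the given sequence. -/
def prefixInter (P : Measure (Cantor × Cantor)) (y : Cantor) : Set Cantor :=
  ⋂ n : ℕ, MLR (condStr P (pre y n))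

/-! The equivalent forms of posterior consistency. The posterior distributions, i.e. the
conditional distributions of the second coordinate given the first one, are `condStr` and `condAt`
of the measure with swapped coordinates. -/

/-- Conditional probabilities on disjoint cylinders are mutually singular. -/
def ConsSingular (P : Measure (Cantor × Cantor)) : Prop :=
  ∀ y z : Str, P.snd (cyl y) ≠ 0 → P.snd (cyl z) ≠ 0 → Disjoint (cyl y) (cyl z) →
    (condStr P y).MutuallySingular (condStr P z)

/-- Conditional probabilities on disjoint cylinders have disjoint ML-random sets. -/
def ConsDisjointStr (P : Measure (Cantor × Cantor)) : Prop :=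
  ∀ y z : Str, P.snd (cyl y) ≠ 0 → P.snd (cyl z) ≠ 0 → Disjoint (cyl y) (cyl z) →
    MLR (condStr P y) ∩ MLR (condStr P z) = ∅

/-- For ML-random `(x, y)` the posterior distributions given the prefixes of `x` converge weakly to
the posterior distribution given `x`, which is concentrated on `y`. -/
def ConsPosterior (P : Measure (Cantor × Cantor)) : Prop :=
  ∀ x y : Cantor, (x, y) ∈ MLR₂ P →
    condAt (P.map Prod.swap) x {y} = 1 ∧
    ∀ g : Cantor →ᵇ ℝ,
      Tendsto (fun n => ∫ t, g t ∂(condStr (P.map Prod.swap) (pre x n))) atTop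
        (𝓝 (∫ t, g t ∂(condAt (P.map Prod.swap) x)))

/-- Different parameters have disjoint sections. -/
def ConsDisjointSection (P : Measure (Cantor × Cantor)) : Prop :=
  ∀ y z : Cantor, y ≠ z → mlrSection P y ∩ mlrSection P z = ∅

/-- Every ML-random sample determines its parameter. -/
def ConsUnique (P : Measure (Cantor × Cantor)) : Prop :=
  ∀ x ∈ MLR P.fst, ∃! y : Cantor, y ∈ MLR P.snd ∧ x ∈ mlrSection P y

/-- The ML-random set lies on the graph of a function of the sample. -/
def ConsGraph (P : Measure (Cantor × Cantor)) : Prop :=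
  ∃ f : Cantor → Cantor, ∀ x y : Cantor, (x, y) ∈ MLR₂ P → f x = y

/-- There is a (measurable) estimator that is almost surely right, for almost all parameters. -/
def ConsEstimator (P : Measure (Cantor × Cantor)) : Prop :=
  ∃ (f : Cantor → Cantor) (Y' : Set Cantor), Measurable f ∧ MeasurableSet Y' ∧
    Y' ⊆ MLR P.snd ∧ P.snd Y' = 1 ∧ ∀ y ∈ Y', ∀ᵐ x ∂(condAt P y), f x = y

/-- Posterior consistency: one of the equivalent conditions holds. -/
def PosteriorConsistent (P : Measure (Cantor × Cantor)) : Prop :=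
  ConsSingular P ∨ ConsDisjointStr P ∨ ConsPosterior P ∨ ConsDisjointSection P ∨
    ConsUnique P ∨ ConsGraph P ∨ ConsEstimator P

end BayesML

/-! Almost every step turns a test for one measure into a test for another. By `notMem_mlRandomIn`
it suffices to enumerate layers of measure at most C · 2^(-n) and to find the point in infinitely
many of them; nesting is free.

Part (a). The ratios P(x | y₀…y_{n-1}) form a martingale under P_Y. The sequences along which they
alternate k times between two rational bounds have a P_Y-measure that is geometrically small in k,
and alternation is semi-decidable, so a random y sees only finitely many alternations
(`not_frequently_alternating`) and the limits exist. Compactness makes them a probability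
(`isCondAt_condAt`). If U is a test for P(· | s), the extensions t of s with P(U_{2m} | t) > 2^(-m)
have P_Y-measure at most P_Y(Δ(s)) · 2^(-m). A random y avoids them for large m, so the even layers
of U are small for P(· | y) too (`mlr_condAt_subset`). For the sections, U is multiplied by Δ(s)
(`mlr₂_mem_condStr`).

Part (b). Of the seven forms of consistency only one consequence is used: sections at different
parameters are disjoint. An estimator gives singularity by disintegration
(`ConsEstimator.singular`). Singularity gives disjoint random sets by a test on strings where one
measure fails to dominate the other, at levels of small overlap (`mlr_condStr_inter_eq_empty`). If x
is random for P(· | s), a universal test and compactness of Δ(s) give a random pair (x, z) with z in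
Δ(s) (`exists_mem_mlr₂`). Applied to all prefixes s of y, this yields partners z that coincide by
disjointness, hence equal y (`prefixInter_subset`).

Part (c). It remains to show that an oracle test U for Q = P(· | y) that captures x yields a test
for P that captures (x, y) (`mlrSection_subset_mlrOracle`). By the use principle the enumeration of
U and the approximations of Q depend on finite prefixes of y, so both can be run along every string
t. Along other sequences the result is meaningless and possibly large. Hence Δ(w) × Δ(t) is
enumerated only after t has produced a bound for the measure of Δ(w), these bounds have a small sum
over the minimal strings found so far, and P(w | t) is below its bound. The sum condition bounds the
new test under P, and along y itself all conditions are eventually met. -/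

namespace BayesML

/-! ### Computable functions: bounded sums and bounded quantifiers. -/

section Computability

variable {α β γ : Type} [Primcodable α] [Primcodable β] [Primcodable γ]

theorem computable_and {p q : α → Bool} (hp : Computable p) (hq : Computable q) :
    Computable fun a => p a && q a :=
  Primrec.and.to_comp.comp hp hq

theorem computable_not {p : α → Bool} (hp : Computable p) : Computable fun a => !p a :=
  Primrec.not.to_comp.comp hp

theorem computable_decide_lt {f g : α → ℕ} (hf : Computable f) (hg : Computable g) :
    Computable fun a => decide (f a < g a) :=
  (Primrec.nat_lt.decide.to_comp).comp hf hg

theorem computable_decide_le {f g : α → ℕ} (hf : Computable f) (hg : Computable g) :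
    Computable fun a => decide (f a ≤ g a) :=
  (Primrec.nat_le.decide.to_comp).comp hf hg

theorem computable_decide_eq [DecidableEq β] {f g : α → β} (hf : Computable f)
    (hg : Computable g) : Computable fun a => decide (f a = g a) :=
  (Primrec.eq.decide.to_comp).comp hf hg

theorem computable_mul {f g : α → ℕ} (hf : Computable f) (hg : Computable g) :
    Computable fun a => f a * g a :=
  Primrec.nat_mul.to_comp.comp hf hg

theorem computable_add {f g : α → ℕ} (hf : Computable f) (hg : Computable g) :
    Computable fun a => f a + g a :=
  Primrec.nat_add.to_comp.comp hf hg

theorem computable_two_pow {f : α → ℕ} (hf : Computable f) : Computable fun a => 2 ^ f a := by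
  have h : Primrec fun n : ℕ => 2 ^ n := by
    refine (Primrec.nat_rec₁ (f := fun _ b => 2 * b) 1 ?_).of_eq fun n => ?_
    · exact Primrec.nat_mul.comp₂ (Primrec₂.const 2) Primrec₂.right
    · induction n with
      | zero => rfl
      | succ n ih => rw [pow_succ, mul_comm, ← ih]
  exact h.to_comp.comp hf

theorem computable_isPrefix {f g : α → Str} (hf : Computable f) (hg : Computable g) :
    Computable fun a => decide (f a <+: g a) := by
  refine (computable_decide_eq hf (Primrec.list_take.to_comp.comp
    (Computable.list_length.comp hf) hg)).of_eq fun a => ?_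
  simp only [List.prefix_iff_eq_take]

theorem computable_sum_range {f : α → ℕ} {g : α → ℕ → ℕ} (hf : Computable f)
    (hg : Computable₂ g) : Computable fun a => ∑ i ∈ Finset.range (f a), g a i := by
  refine (Computable.nat_rec (h := fun a p => p.2 + g a p.1) hf (Computable.const 0) ?_).of_eq
    fun a => ?_
  · exact computable_add (Computable.snd.comp Computable.snd)
      (hg.comp Computable.fst (Computable.fst.comp Computable.snd))
  · induction f a with
    | zero => rfl
    | succ n ih => rw [Finset.sum_range_succ, ← ih]

theorem computable_list_sum {f : α → List β} {g : α → β → ℕ} (hf : Computable f)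
    (hg : Computable₂ g) : Computable fun a => ((f a).map (g a)).sum := by
  refine (computable_sum_range (g := fun a i => ((f a)[i]?.map (g a)).getD 0)
    (Computable.list_length.comp hf) ?_).of_eq fun a => ?_
  · refine Computable.option_getD (Computable.option_map ?_ ?_) (Computable.const 0)
    · exact Computable.list_getElem?.comp (hf.comp Computable.fst) Computable.snd
    · exact hg.comp (Computable.fst.comp Computable.fst) Computable.snd
  · induction f a with
    | nil => rfl
    | cons b l ih =>
      rw [List.length_cons, Finset.sum_range_succ']
      simp only [List.getElem?_cons_succ, ih]
      simp [add_comm]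

theorem computable_toNat {p : α → Bool} (hp : Computable p) : Computable fun a => (p a).toNat :=
  (Primrec.dom_finite Bool.toNat).to_comp.comp hp

/-- All entries pass exactly when the number of failures, a computable sum, is zero. -/
theorem computable_ball_list {f : α → List β} {q : α → β → Bool} (hf : Computable f)
    (hq : Computable₂ q) : Computable fun a => decide (∀ b ∈ f a, q a b = true) := by
  refine (computable_decide_eq (computable_list_sum (g := fun a b => (!q a b).toNat) hf
    (computable_toNat (computable_not hq))) (Computable.const 0)).of_eq fun a => ?_
  congr 1
  simp [List.sum_eq_zero_iff]

theorem computable_ball_lt {f : α → ℕ} {q : α → ℕ → Bool} (hf : Computable f)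
    (hq : Computable₂ q) : Computable fun a => decide (∀ i < f a, q a i = true) := by
  refine (computable_ball_list (Primrec.list_range.to_comp.comp hf) hq).of_eq fun a => ?_
  simp

theorem computable_bex_lt {f : α → ℕ} {q : α → ℕ → Bool} (hf : Computable f)
    (hq : Computable₂ q) : Computable fun a => decide (∃ i < f a, q a i = true) := by
  refine (computable_not (computable_ball_lt hf
    (q := fun a i => !q a i) (computable_not hq))).of_eq fun a => ?_
  rw [← decide_not]
  simp

end Computability

/-! ### Closure properties of recursively enumerable predicates. -/

section RE

variable {α β γ : Type} [Primcodable α] [Primcodable β] [Primcodable γ]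

theorem _root_.REPred.of_stage {p : α → Prop} {q : α → ℕ → Bool} (hq : Computable₂ q)
    (h : ∀ a, p a ↔ ∃ n, q a n = true) : REPred p := by
  have h1 : Partrec fun a => Nat.rfind fun n => Part.some (q a n) :=
    Partrec.rfind (hq.partrec₂)
  refine h1.dom_re.of_eq fun a => ?_
  rw [h a]
  refine Nat.rfind_dom.trans ⟨?_, ?_⟩
  · rintro ⟨n, hn, -⟩
    exact ⟨n, (Part.mem_some_iff.1 hn).symm⟩
  · rintro ⟨n, hn⟩
    exact ⟨n, by simp [hn], by simp⟩

/-- A recursively enumerable predicate is the union of an increasing sequence of stages. -/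
theorem _root_.REPred.exists_stage {p : α → Prop} (hp : REPred p) :
    ∃ q : α → ℕ → Bool, Computable₂ q ∧ (∀ a m n, m ≤ n → q a m = true → q a n = true) ∧
      ∀ a, p a ↔ ∃ n, q a n = true := by
  obtain ⟨c, hc⟩ := Nat.Partrec.Code.exists_code.1 hp
  refine ⟨fun a n => (Nat.Partrec.Code.evaln n c (Encodable.encode a)).isSome, ?_, ?_, ?_⟩
  · refine Primrec.to_comp ?_
    refine Primrec.option_isSome.comp (Nat.Partrec.Code.primrec_evaln.comp
      (Primrec.pair (Primrec.pair Primrec.snd (Primrec.const c)) (Primrec.encode.comp Primrec.fst)))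
  · intro a m n hmn h
    obtain ⟨x, hx⟩ := Option.isSome_iff_exists.1 h
    exact Option.isSome_iff_exists.2 ⟨x, Nat.Partrec.Code.evaln_mono hmn hx⟩
  · intro a
    have h1 : (Nat.Partrec.Code.eval c (Encodable.encode a)).Dom ↔ p a := by
      rw [hc]
      simp [Part.assert]
    rw [← h1, Part.dom_iff_mem]
    constructor
    · rintro ⟨x, hx⟩
      obtain ⟨k, hk⟩ := Nat.Partrec.Code.evaln_complete.1 hx
      exact ⟨k, Option.isSome_iff_exists.2 ⟨x, hk⟩⟩
    · rintro ⟨k, hk⟩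
      obtain ⟨x, hx⟩ := Option.isSome_iff_exists.1 hk
      exact ⟨x, Nat.Partrec.Code.evaln_sound hx⟩

theorem _root_.REPred.of_bool {q : α → Bool} (hq : Computable q) : REPred fun a => q a = true :=
  REPred.of_stage (q := fun a _ => q a) (hq.comp Computable.fst) fun a => by simp

theorem _root_.REPred.comp {p : β → Prop} (hp : REPred p) {f : α → β} (hf : Computable f) :
    REPred fun a => p (f a) :=
  Partrec.comp hp hf

theorem _root_.REPred.and {p q : α → Prop} (hp : REPred p) (hq : REPred q) :
    REPred fun a => p a ∧ q a := by
  obtain ⟨p', hp1, hp2, hp3⟩ := hp.exists_stage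
  obtain ⟨q', hq1, hq2, hq3⟩ := hq.exists_stage
  refine REPred.of_stage (q := fun a n => p' a n && q' a n) (computable_and hp1 hq1) fun a => ?_
  rw [hp3, hq3]
  constructor
  · rintro ⟨⟨m, hm⟩, n, hn⟩
    exact ⟨max m n, by simp [hp2 a _ _ (le_max_left m n) hm, hq2 a _ _ (le_max_right m n) hn]⟩
  · rintro ⟨n, hn⟩
    rw [Bool.and_eq_true] at hn
    exact ⟨⟨n, hn.1⟩, n, hn.2⟩

theorem _root_.REPred.or {p q : α → Prop} (hp : REPred p) (hq : REPred q) :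
    REPred fun a => p a ∨ q a := by
  obtain ⟨p', hp1, hp2, hp3⟩ := hp.exists_stage
  obtain ⟨q', hq1, hq2, hq3⟩ := hq.exists_stage
  refine REPred.of_stage (q := fun a n => p' a n || q' a n) (Primrec.or.to_comp.comp hp1 hq1)
    fun a => ?_
  rw [hp3, hq3, ← exists_or]
  simp

theorem _root_.REPred.exists {p : α × β → Prop} (hp : REPred p) :
    REPred fun a => ∃ b, p (a, b) := by
  obtain ⟨q, hq1, hq2, hq3⟩ := hp.exists_stage
  refine REPred.of_stage (q := fun a n => ((Encodable.decode (α := β) n.unpair.1).map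
    fun b => q (a, b) n.unpair.2).getD false) ?_ fun a => ?_
  · refine Computable.option_getD (Computable.option_map ?_ ?_) (Computable.const false)
    · exact Computable.decode.comp (Computable.fst.comp (Computable.unpair.comp Computable.snd))
    · exact hq1.comp (Computable.pair (Computable.fst.comp Computable.fst) Computable.snd)
        (Computable.snd.comp (Computable.unpair.comp (Computable.snd.comp Computable.fst)))
  · constructor
    · rintro ⟨b, hb⟩
      obtain ⟨n, hn⟩ := (hq3 _).1 hb
      exact ⟨Nat.pair (Encodable.encode b) n, by simp [hn]⟩
    · rintro ⟨n, hn⟩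
      rcases h : (Encodable.decode (α := β) n.unpair.1) with _ | b
      · simp [h] at hn
      · exact ⟨b, (hq3 _).2 ⟨n.unpair.2, by simpa [h] using hn⟩⟩

theorem _root_.REPred.ball_list {p : α × β → Prop} (hp : REPred p) {f : α → List β}
    (hf : Computable f) :
    REPred fun a => ∀ b ∈ f a, p (a, b) := by
  obtain ⟨q, hq1, hq2, hq3⟩ := hp.exists_stage
  refine REPred.of_stage (q := fun a n => decide (∀ b ∈ f a, q (a, b) n = true)) ?_ fun a => ?_
  · exact computable_ball_list (f := fun x : α × ℕ => f x.1) (q := fun x b => q (x.1, b) x.2)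
      (hf.comp Computable.fst) (hq1.comp (Computable.pair (Computable.fst.comp Computable.fst)
        Computable.snd) (Computable.snd.comp Computable.fst))
  · simp only [hq3, decide_eq_true_eq]
    constructor
    · generalize f a = l
      intro h
      induction l with
      | nil => exact ⟨0, by simp⟩
      | cons b l ih =>
        obtain ⟨m, hm⟩ := h b (by simp)
        obtain ⟨n, hn⟩ := ih fun c hc => h c (by simp [hc])
        refine ⟨max m n, ?_⟩
        intro c hc
        rcases List.mem_cons.1 hc with rfl | hc
        · exact hq2 _ _ _ (le_max_left m n) hm
        · exact hq2 _ _ _ (le_max_right m n) (hn c hc)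
    · rintro ⟨n, hn⟩ b hb
      exact ⟨n, hn b hb⟩

theorem _root_.REPred.ball_lt {p : α × ℕ → Prop} (hp : REPred p) {f : α → ℕ} (hf : Computable f) :
    REPred fun a => ∀ i < f a, p (a, i) :=
  (hp.ball_list (Primrec.list_range.to_comp.comp hf)).of_eq fun a => by simp

/-- Run `f` and halt only if the result agrees with `g`; the predicate is the domain of this
procedure. -/
theorem _root_.REPred.mem_partrec {f : α →. β} [DecidableEq β] (hf : Partrec f) {g : α → β}
    (hg : Computable g) : REPred fun a => g a ∈ f a := by
  have h : Partrec fun a => (f a).bind fun b => ((if decide (b = g a) then some () else none :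
      Option Unit) : Part Unit) := by
    refine hf.bind (Computable.ofOption ?_)
    refine ((computable_decide_eq Computable.snd (hg.comp Computable.fst)).cond
      (Computable.const (some ())) (Computable.const none)).of_eq fun x => ?_
    cases h : decide (x.2 = g x.1) <;> simp_all
  refine h.dom_re.of_eq fun a => ?_
  constructor
  · intro h
    obtain ⟨u, hu⟩ := Part.dom_iff_mem.1 h
    rw [Part.mem_bind_iff] at hu
    obtain ⟨b, hb, hu⟩ := hu
    by_cases hbg : b = g a
    · exact hbg ▸ hb
    · simp [hbg] at hu
  · intro h
    refine Part.dom_iff_mem.2 ⟨(), Part.mem_bind_iff.2 ⟨g a, h, by simp⟩⟩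

end RE

/-! ### Computable nonnegative reals with dyadic bounds. -/

section ComputableReals

variable {α β ι Ω : Type} [Primcodable α] [Primcodable β] [Primcodable ι] [MeasurableSpace Ω]

/-- A family of (nonnegative) reals is computable if it is the limit of computable sequences of
dyadic lower and upper bounds. -/
def ComputableReal (r : α → ℝ) : Prop :=
  ∃ l u : α → ℕ → ℕ, Computable₂ l ∧ Computable₂ u ∧
    (∀ a k, (l a k : ℝ) ≤ r a * 2 ^ k ∧ r a * 2 ^ k ≤ u a k) ∧
    ∀ a, Tendsto (fun k => (l a k : ℝ) / 2 ^ k) atTop (𝓝 (r a)) ∧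
      Tendsto (fun k => (u a k : ℝ) / 2 ^ k) atTop (𝓝 (r a))

theorem ComputableReal.of_eq {r s : α → ℝ} (hr : ComputableReal r) (h : ∀ a, r a = s a) :
    ComputableReal s :=
  (funext h : r = s) ▸ hr

theorem ComputableReal.comp {r : β → ℝ} (hr : ComputableReal r) {f : α → β} (hf : Computable f) :
    ComputableReal fun a => r (f a) := by
  obtain ⟨l, u, hl, hu, h1, h2⟩ := hr
  exact ⟨fun a => l (f a), fun a => u (f a), hl.comp (hf.comp Computable.fst) Computable.snd,
    hu.comp (hf.comp Computable.fst) Computable.snd, fun a => h1 (f a), fun a => h2 (f a)⟩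

theorem ComputableReal.natCast {f : α → ℕ} (hf : Computable f) :
    ComputableReal fun a => (f a : ℝ) := by
  have h : Computable₂ fun a k => f a * 2 ^ k :=
    computable_mul (hf.comp Computable.fst) (computable_two_pow Computable.snd)
  have h' : ∀ a, (fun k => ((f a * 2 ^ k : ℕ) : ℝ) / 2 ^ k) = fun _ => (f a : ℝ) := by
    intro a
    funext k
    push_cast
    field_simp
  refine ⟨_, _, h, h, fun a k => by simp, fun a => ?_⟩
  simp only [h']
  exact ⟨tendsto_const_nhds, tendsto_const_nhds⟩

theorem ComputableReal.natCast_mul {f : α → ℕ} (hf : Computable f) {r : α → ℝ}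
    (hr : ComputableReal r) : ComputableReal fun a => (f a : ℝ) * r a := by
  obtain ⟨l, u, hl, hu, h1, h2⟩ := hr
  refine ⟨fun a k => f a * l a k, fun a k => f a * u a k,
    computable_mul (hf.comp Computable.fst) hl,
    computable_mul (hf.comp Computable.fst) hu, fun a k => ?_, fun a => ?_⟩
  · push_cast
    rw [mul_assoc]
    exact ⟨by gcongr; exact (h1 a k).1, by gcongr; exact (h1 a k).2⟩
  · push_cast
    simp only [mul_div_assoc]
    exact ⟨(h2 a).1.const_mul _, (h2 a).2.const_mul _⟩

theorem ComputableReal.min {r s : α → ℝ} (hr : ComputableReal r) (hs : ComputableReal s) :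
    ComputableReal fun a => min (r a) (s a) := by
  obtain ⟨l, u, hl, hu, h1, h2⟩ := hr
  obtain ⟨l', u', hl', hu', h1', h2'⟩ := hs
  have hd : ∀ (x y : ℕ) (k : ℕ), ((Min.min x y : ℕ) : ℝ) / 2 ^ k =
      Min.min ((x : ℝ) / 2 ^ k) ((y : ℝ) / 2 ^ k) := by
    intro x y k
    rw [Nat.cast_min, min_div_div_right (by positivity)]
  refine ⟨fun a k => Min.min (l a k) (l' a k), fun a k => Min.min (u a k) (u' a k),
    Primrec.nat_min.to_comp.comp hl hl', Primrec.nat_min.to_comp.comp hu hu',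
    fun a k => ?_, fun a => ?_⟩
  · rw [min_mul_of_nonneg _ _ (by positivity)]
    push_cast
    exact ⟨min_le_min (h1 a k).1 (h1' a k).1, min_le_min (h1 a k).2 (h1' a k).2⟩
  · simp only [hd]
    exact ⟨(h2 a).1.min (h2' a).1, (h2 a).2.min (h2' a).2⟩

theorem ComputableReal.ite {r : α → ℝ} (hr : ComputableReal r) {q : α → Bool} (hq : Computable q) :
    ComputableReal fun a => if q a then r a else 0 :=
  (hr.natCast_mul (computable_toNat hq)).of_eq fun a => by cases q a <;> simp

theorem ComputableReal.list_sum {r : α × β → ℝ} (hr : ComputableReal r) {f : α → List β}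
    (hf : Computable f) : ComputableReal fun a => ((f a).map fun b => r (a, b)).sum := by
  obtain ⟨l, u, hl, hu, h1, h2⟩ := hr
  have hc : ∀ g : α × β → ℕ → ℕ, Computable₂ g →
      Computable₂ fun a k => ((f a).map fun b => g (a, b) k).sum := fun g hg =>
    computable_list_sum (f := fun x : α × ℕ => f x.1) (g := fun x b => g (x.1, b) x.2)
      (hf.comp Computable.fst) (hg.comp (Computable.pair (Computable.fst.comp Computable.fst)
        Computable.snd) (Computable.snd.comp Computable.fst))
  refine ⟨_, _, hc l hl, hc u hu, fun a k => ?_, fun a => ?_⟩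
  · beta_reduce
    induction f a with
    | nil => simp
    | cons b L ih =>
      simp only [List.map_cons, List.sum_cons, Nat.cast_add, add_mul]
      exact ⟨add_le_add (h1 (a, b) k).1 ih.1, add_le_add (h1 (a, b) k).2 ih.2⟩
  · beta_reduce
    induction f a with
    | nil => simp
    | cons b L ih =>
      simp only [List.map_cons, List.sum_cons, Nat.cast_add, add_div]
      exact ⟨(h2 (a, b)).1.add ih.1, (h2 (a, b)).2.add ih.2⟩

/-- A strict inequality is confirmed once an upper bound of one side falls below a lower bound of
the other. This is why the tests below compare measures by strict inequalities. -/
theorem ComputableReal.lt_re {r s : α → ℝ} (hr : ComputableReal r) (hs : ComputableReal s) :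
    REPred fun a => r a < s a := by
  obtain ⟨l, u, hl, hu, h1, h2⟩ := hr
  obtain ⟨l', u', hl', hu', h1', h2'⟩ := hs
  refine REPred.of_stage (q := fun a k => decide (u a k < l' a k)) (computable_decide_lt hu hl')
    fun a => ?_
  simp only [decide_eq_true_eq]
  constructor
  · intro h
    obtain ⟨k, hk⟩ := ((h2 a).2.eventually_lt (h2' a).1 h).exists
    refine ⟨k, ?_⟩
    rw [div_lt_div_iff_of_pos_right (by positivity)] at hk
    exact_mod_cast hk
  · rintro ⟨k, hk⟩
    have h3 : r a * 2 ^ k < s a * 2 ^ k :=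
      (h1 a k).2.trans_lt ((Nat.cast_lt.2 hk).trans_le (h1' a k).1)
    exact lt_of_mul_lt_mul_right h3 (by positivity)

/-- The code of n ≥ 0 is 2n and that of -(n + 1) is 2n + 1, so the parity of the code decides the
sign. -/
theorem primrec_int_toNat : Primrec Int.toNat := by
  have h : Primrec fun n : ℕ => (if n % 2 = 0 then n / 2 else 0) :=
    Primrec.ite (Primrec.eq.comp (Primrec.nat_mod.comp Primrec.id (Primrec.const 2))
      (Primrec.const 0)) (Primrec.nat_div.comp Primrec.id (Primrec.const 2)) (Primrec.const 0)
  refine (h.comp Primrec.encode).of_eq fun z => ?_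
  rcases z with n | n
  · change (if (2 * n) % 2 = 0 then (2 * n) / 2 else 0) = _
    simp
  · change (if (2 * n + 1) % 2 = 0 then (2 * n + 1) / 2 else 0) = _
    simp [Nat.add_mod]

/-- A strict dyadic upper bound for a number that is close to `a / d`. -/
def dyadicUpper (a : ℤ) (d k : ℕ) : ℕ := a.toNat * 2 ^ k / d + 2

theorem computable_dyadicUpper {f : α → ℤ} {g h : α → ℕ} (hf : Computable f) (hg : Computable g)
    (hh : Computable h) : Computable fun a => dyadicUpper (f a) (g a) (h a) :=
  computable_add (Primrec.nat_div.to_comp.comp (computable_mul (primrec_int_toNat.to_comp.comp hf)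
    (computable_two_pow hh)) hg) (Computable.const 2)

/-- After scaling by 2^k the approximation error is below 1, and rounding down loses less than 1.
Adding 2 therefore gives a strict upper bound that is too large by at most 3. Strictness matters in
part (c), where the bound has to survive a passage to the limit. -/
theorem dyadicUpper_spec {x : ℝ} (hx : 0 ≤ x) {q : ℚ} {k : ℕ}
    (h : |x - q| < 1 / (((2 ^ k : ℕ) : ℝ) + 1)) :
    x * 2 ^ k < dyadicUpper q.num q.den k ∧ (dyadicUpper q.num q.den k : ℝ) ≤ x * 2 ^ k + 3 ∧
      ((dyadicUpper q.num q.den k - 3 : ℕ) : ℝ) ≤ x * 2 ^ k := by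
  have hk : (0 : ℝ) < 2 ^ k := by positivity
  have hd : (0 : ℝ) < q.den := by exact_mod_cast q.den_pos
  have h1 : |x * 2 ^ k - q * 2 ^ k| < 1 := by
    rw [← sub_mul, abs_mul, abs_of_pos hk, ← lt_div_iff₀ hk]
    refine h.trans_le ?_
    push_cast
    gcongr
    linarith
  rw [abs_lt] at h1
  set n := q.num.toNat * 2 ^ k / q.den with hn
  have h2 : (n : ℝ) ≤ x * 2 ^ k + 1 ∧ x * 2 ^ k < n + 2 ∧ (n : ℝ) - 1 ≤ x * 2 ^ k := by
    have hx2 : 0 ≤ x * 2 ^ k := by positivity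
    rcases le_or_gt q 0 with hq | hq
    · have : q.num.toNat = 0 := by
        rw [Int.toNat_eq_zero]
        exact Rat.num_nonpos.2 hq
      have hn0 : n = 0 := by rw [hn, this]; simp
      have hq' : (q : ℝ) * 2 ^ k ≤ 0 := mul_nonpos_of_nonpos_of_nonneg (by exact_mod_cast hq) hk.le
      rw [hn0]
      push_cast
      exact ⟨by linarith, by linarith, by linarith⟩
    · have hz : ((q.num.toNat : ℕ) : ℝ) = (q.num : ℝ) := by
        have : ((q.num.toNat : ℕ) : ℤ) = q.num := Int.toNat_of_nonneg (Rat.num_nonneg.2 hq.le)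
        exact_mod_cast this
      have hq2 : (q : ℝ) * 2 ^ k = (q.num.toNat * 2 ^ k : ℕ) / (q.den : ℝ) := by
        push_cast
        rw [hz, Rat.cast_def]
        ring
      have ha : (n : ℝ) ≤ q * 2 ^ k := by rw [hq2]; exact Nat.cast_div_le
      have hb : (q : ℝ) * 2 ^ k < n + 1 := by
        rw [hq2, div_lt_iff₀ hd]
        exact_mod_cast Nat.lt_mul_of_div_lt (Nat.lt_succ_self _) q.den_pos
      exact ⟨by linarith, by linarith, by linarith⟩
  have e : dyadicUpper q.num q.den k = n + 2 := rfl
  rw [e]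
  refine ⟨by push_cast; linarith, by push_cast; linarith, ?_⟩
  rcases n with _ | n
  · simp; positivity
  · have : n + 1 + 2 - 3 = n := by omega
    rw [this]
    have := h2.2.2
    push_cast at this
    linarith

theorem tendsto_div_two_pow_of_bounded {f : ℕ → ℝ} {x C : ℝ}
    (h : ∀ k, |f k - x * 2 ^ k| ≤ C) : Tendsto (fun k => f k / 2 ^ k) atTop (𝓝 x) := by
  rw [tendsto_iff_norm_sub_tendsto_zero]
  have h0 : Tendsto (fun k : ℕ => C * (1 / 2 : ℝ) ^ k) atTop (𝓝 0) := by
    simpa using (tendsto_pow_atTop_nhds_zero_of_lt_one (r := (1 / 2 : ℝ)) (by norm_num)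
      (by norm_num)).const_mul C
  refine squeeze_zero (fun _ => norm_nonneg _) (fun k => ?_) h0
  have hk : (0 : ℝ) < 2 ^ k := by positivity
  rw [Real.norm_eq_abs, show f k / 2 ^ k - x = (f k - x * 2 ^ k) / 2 ^ k by field_simp,
    abs_div, abs_of_pos hk, one_div, inv_pow, ← div_eq_mul_inv]
  gcongr
  exact h k

theorem ComputableMeasureIn.computableReal {B : ι → Set Ω} {μ : Measure Ω}
    (h : ComputableMeasureIn ∅ B μ) : ComputableReal fun i => μ.real (B i) := by
  obtain ⟨A, h1, h2, h3⟩ := h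
  have h1' : Computable fun p => (A p).num := recursiveIn_empty_iff.1 h1
  have h2' : Computable fun p => (A p).den := recursiveIn_empty_iff.1 h2
  have hp : Computable fun x : ι × ℕ => (x.1, 2 ^ x.2) :=
    Computable.pair Computable.fst (computable_two_pow Computable.snd)
  have hu : Computable₂ fun (i : ι) k =>
      dyadicUpper (A (i, 2 ^ k)).num (A (i, 2 ^ k)).den k :=
    computable_dyadicUpper (h1'.comp hp) (h2'.comp hp) Computable.snd
  have hs := fun i k => dyadicUpper_spec (measureReal_nonneg (μ := μ) (s := B i)) (h3 i (2 ^ k))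
  refine ⟨fun i k => dyadicUpper (A (i, 2 ^ k)).num (A (i, 2 ^ k)).den k - 3, _,
    Primrec.nat_sub.to_comp.comp hu (Computable.const 3), hu,
    fun i k => ⟨(hs i k).2.2, (hs i k).1.le⟩, fun i => ⟨?_, ?_⟩⟩
  · refine tendsto_div_two_pow_of_bounded (C := 3) fun k => ?_
    obtain ⟨ha, hb, hc⟩ := hs i k
    have : (dyadicUpper (A (i, 2 ^ k)).num (A (i, 2 ^ k)).den k : ℝ) ≤
        ((dyadicUpper (A (i, 2 ^ k)).num (A (i, 2 ^ k)).den k - 3 : ℕ) : ℝ) + 3 := by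
      exact_mod_cast (by omega : _ ≤ (_ - 3) + 3)
    rw [abs_le]
    constructor <;> linarith
  · refine tendsto_div_two_pow_of_bounded (C := 3) fun k => ?_
    obtain ⟨ha, hb, hc⟩ := hs i k
    rw [abs_le]
    constructor <;> linarith

end ComputableReals

/-! ### Strings of given length and computable covers. -/

section Strings

/-- The list of all strings of length `n`. -/
def strings : ℕ → List Str
  | 0 => [[]]
  | n + 1 => (strings n).flatMap fun w => [w ++ [false], w ++ [true]]

theorem mem_strings {n : ℕ} {w : Str} : w ∈ strings n ↔ w.length = n := by
  induction n generalizing w with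
  | zero => simp [strings]
  | succ n ih =>
    simp only [strings, List.mem_flatMap, ih]
    constructor
    · rintro ⟨v, rfl, hv⟩
      simp only [List.mem_cons, List.not_mem_nil, or_false] at hv
      rcases hv with rfl | rfl <;> simp
    · intro h
      have hw : w ≠ [] := by rintro rfl; simp at h
      refine ⟨w.dropLast, by simp [h], ?_⟩
      have := List.dropLast_append_getLast hw
      rcases hb : w.getLast hw with _ | _ <;> rw [hb] at this <;> simp [this]

theorem nodup_strings (n : ℕ) : (strings n).Nodup := by
  induction n with
  | zero => simp [strings]
  | succ n ih =>
    refine List.nodup_flatMap.2 ⟨fun w _ => by simp, ?_⟩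
    refine ih.imp fun {v w} hvw => ?_
    rw [Function.onFun, List.disjoint_left]
    intro u hu hu'
    simp only [List.mem_cons, List.not_mem_nil, or_false] at hu hu'
    apply hvw
    have h1 : u.dropLast = v := by rcases hu with rfl | rfl <;> simp
    have h2 : u.dropLast = w := by rcases hu' with rfl | rfl <;> simp
    rw [← h1, ← h2]

theorem computable_strings {α : Type} [Primcodable α] {f : α → ℕ} (hf : Computable f) :
    Computable fun a => strings (f a) := by
  have h : Primrec strings := by
    refine (Primrec.nat_rec₁ (f := fun _ (l : List Str) => l.flatMap fun w =>
      [w ++ [false], w ++ [true]]) [[]] ?_).of_eq fun n => ?_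
    · refine Primrec.list_flatMap Primrec.snd ?_
      exact Primrec.list_cons.comp (Primrec.list_append.comp Primrec.snd (Primrec.const [false]))
        (Primrec.list_cons.comp (Primrec.list_append.comp Primrec.snd (Primrec.const [true]))
          (Primrec.const []))
    · induction n with
      | zero => rfl
      | succ n ih => simp only [strings, ← ih]
  exact h.to_comp.comp hf

/-- The pairs of strings in a recursively enumerable set are exhausted by a computable, monotone
set of pairs of strings. -/
theorem exists_computable_cover {β : Type} [Primcodable β] {U : (Str × Str) × β → Prop}
    (hU : REPred U) :
    ∃ cov : β → Str → Str → Bool,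
      (Computable fun x : β × Str × Str => cov x.1 x.2.1 x.2.2) ∧
      (∀ b w t w' t', w <+: w' → t <+: t' → cov b w t = true → cov b w' t' = true) ∧
      (∀ b w t, cov b w t = true → ∃ a a', a <+: w ∧ a' <+: t ∧ U ((a, a'), b)) ∧
      (∀ b a a', U ((a, a'), b) → ∃ N, ∀ w t, a <+: w → a' <+: t → N ≤ w.length →
        cov b w t = true) ∧
      ∀ b t, cov b [] t = false := by
  obtain ⟨q, hq1, hq2, hq3⟩ := hU.exists_stage
  let d : (β × Str × Str) → ℕ → Bool := fun x i =>
    ((Encodable.decode (α := Str × Str) i).map fun a =>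
      decide (a.1 <+: x.2.1) && (decide (a.2 <+: x.2.2) && q (a, x.1) x.2.1.length)).getD false
  have hd : ∀ x i, d x i = true ↔ ∃ a, Encodable.decode (α := Str × Str) i = some a ∧
      a.1 <+: x.2.1 ∧ a.2 <+: x.2.2 ∧ q (a, x.1) x.2.1.length = true := by
    intro x i
    simp only [d]
    rcases Encodable.decode (α := Str × Str) i with _ | a <;> simp
  have hdc : Computable₂ d := by
    refine Computable.option_getD (Computable.option_map
      (Computable.decode.comp Computable.snd) ?_) (Computable.const false)
    have c1 : Computable fun z : ((β × Str × Str) × ℕ) × (Str × Str) => z.1.1.2.1 :=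
      Computable.fst.comp (Computable.snd.comp (Computable.fst.comp Computable.fst))
    have c2 : Computable fun z : ((β × Str × Str) × ℕ) × (Str × Str) => z.1.1.2.2 :=
      Computable.snd.comp (Computable.snd.comp (Computable.fst.comp Computable.fst))
    have c3 : Computable fun z : ((β × Str × Str) × ℕ) × (Str × Str) => z.1.1.1 :=
      Computable.fst.comp (Computable.fst.comp Computable.fst)
    exact computable_and (computable_isPrefix (Computable.fst.comp Computable.snd) c1)
      (computable_and (computable_isPrefix (Computable.snd.comp Computable.snd) c2)
        (hq1.comp (Computable.pair Computable.snd c3) (Computable.list_length.comp c1)))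
  -- The length of `w` bounds both the search and the stage, so coverage grows along prefixes. It
  -- also means that the empty string covers nothing, which `exists_isNew` needs.
  refine ⟨fun b w t => decide (∃ i < w.length, d (b, w, t) i = true), ?_, ?_, ?_, ?_, ?_⟩
  · exact computable_bex_lt (f := fun x : β × Str × Str => x.2.1.length)
      (Computable.list_length.comp (Computable.fst.comp Computable.snd)) hdc
  · intro b w t w' t' hw ht h
    simp only [decide_eq_true_eq, hd] at h ⊢
    obtain ⟨i, hi, a, ha, h1, h2, h3⟩ := h
    exact ⟨i, hi.trans_le hw.length_le, a, ha, h1.trans hw, h2.trans ht,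
      hq2 _ _ _ hw.length_le h3⟩
  · intro b w t h
    simp only [decide_eq_true_eq, hd] at h
    obtain ⟨i, hi, a, ha, h1, h2, h3⟩ := h
    exact ⟨a.1, a.2, h1, h2, (hq3 _).2 ⟨_, h3⟩⟩
  · intro b a a' h
    obtain ⟨n, hn⟩ := (hq3 _).1 h
    refine ⟨max n (Encodable.encode (a, a') + 1), fun w t hw ht hN => ?_⟩
    simp only [decide_eq_true_eq, hd]
    exact ⟨Encodable.encode (a, a'), by omega, (a, a'), Encodable.encodek _, hw, ht,
      hq2 _ _ _ (by omega) hn⟩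
  · intro b t
    simp

end Strings

/-! ### Prefixes and cylinders. -/

section Cylinders

@[simp] theorem length_pre (ω : Cantor) (n : ℕ) : (pre ω n).length = n := by simp [pre]

theorem getElem?_pre (ω : Cantor) (n i : ℕ) :
    (pre ω n)[i]? = if i < n then some (ω i) else none := by
  unfold pre
  rw [List.getElem?_ofFn]
  by_cases h : i < n <;> simp [h]

@[simp] theorem getElem_pre (ω : Cantor) (n i : ℕ) (h : i < (pre ω n).length) :
    (pre ω n)[i] = ω i := by
  simp [pre]

theorem pre_prefix_pre (ω : Cantor) {m n : ℕ} (h : m ≤ n) : pre ω m <+: pre ω n := by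
  rw [List.prefix_iff_getElem?]
  intro i hi
  have hi' : i < m := by simpa using hi
  rw [getElem?_pre, if_pos (hi'.trans_le h), getElem_pre]

theorem prefix_pre_iff {s : Str} {ω : Cantor} {n : ℕ} :
    s <+: pre ω n ↔ s.length ≤ n ∧ ω ∈ cyl s := by
  rw [List.prefix_iff_getElem?]
  simp only [getElem?_pre]
  constructor
  · intro h
    have h1 : s.length ≤ n := by
      by_contra! hn
      have := h n hn
      simp at this
    refine ⟨h1, fun i hi => ?_⟩
    have := h i hi
    rw [if_pos (hi.trans_le h1)] at this
    exact Option.some_injective _ this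
  · rintro ⟨h1, h2⟩ i hi
    rw [if_pos (hi.trans_le h1), h2 i hi]

theorem mem_cyl_pre (ω : Cantor) (n : ℕ) : ω ∈ cyl (pre ω n) :=
  (prefix_pre_iff.1 (List.prefix_refl (pre ω n))).2

theorem mem_cyl_iff {ω : Cantor} {s : Str} : ω ∈ cyl s ↔ pre ω s.length = s := by
  constructor
  · intro h
    exact ((prefix_pre_iff.2 ⟨le_rfl, h⟩).eq_of_length (by simp)).symm
  · intro h
    rw [← h]
    exact mem_cyl_pre _ _

theorem take_pre (ω : Cantor) {m n : ℕ} (h : m ≤ n) : (pre ω n).take m = pre ω m := by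
  have := List.prefix_iff_eq_take.1 (pre_prefix_pre ω h)
  rw [length_pre] at this
  exact this.symm

theorem dropLast_pre (ω : Cantor) (n : ℕ) : (pre ω n).dropLast = pre ω (n - 1) := by
  rw [List.dropLast_eq_take, length_pre, take_pre ω (Nat.sub_le _ _)]

theorem cyl_subset_cyl {s t : Str} (h : s <+: t) : cyl t ⊆ cyl s := by
  intro ω hω
  exact (prefix_pre_iff.1 (h.trans (prefix_pre_iff.2 ⟨le_rfl, hω⟩))).2

theorem prefix_of_mem_cyl {s t : Str} {ω : Cantor} (hs : ω ∈ cyl s) (ht : ω ∈ cyl t)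
    (h : s.length ≤ t.length) : s <+: t := by
  have := prefix_pre_iff.2 ⟨h, hs⟩
  rwa [mem_cyl_iff.1 ht] at this

theorem exists_mem_cyl (s : Str) : ∃ ω, ω ∈ cyl s :=
  ⟨fun i => s[i]?.getD false, fun i h => by simp [h]⟩

@[simp] theorem cyl_nil : cyl [] = univ := by
  ext ω
  simp [cyl]

theorem isClopen_cyl (s : Str) : IsClopen (cyl s) := by
  have : cyl s = ⋂ i : Fin s.length, (fun ω : Cantor => ω i) ⁻¹' {s[i]} := by
    ext ω
    simp only [cyl, Set.mem_ofPred_eq, mem_iInter, mem_preimage, mem_singleton_iff]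
    exact ⟨fun h i => h i i.2, fun h i hi => h ⟨i, hi⟩⟩
  rw [this]
  exact isClopen_iInter_of_finite fun i =>
    (isClopen_discrete _).preimage (continuous_apply (i : ℕ))

theorem measurableSet_cyl (s : Str) : MeasurableSet (cyl s) := (isClopen_cyl s).1.measurableSet

theorem measurableSet_cyl₂ (p : Str × Str) : MeasurableSet (cyl₂ p) :=
  (measurableSet_cyl p.1).prod (measurableSet_cyl p.2)

theorem exists_cyl_pre_subset {U : Set Cantor} (hU : IsOpen U) {ω : Cantor} (h : ω ∈ U) :
    ∃ n, cyl (pre ω n) ⊆ U := by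
  obtain ⟨I, u, hu, hs⟩ := isOpen_pi_iff.1 hU ω h
  refine ⟨I.sup id + 1, fun x hx => hs fun i hi => ?_⟩
  have h1 : i < I.sup id + 1 := Nat.lt_succ_of_le (Finset.le_sup (f := id) hi)
  have h2 := hx i (by simpa using h1)
  have h3 : x i = ω i := by rwa [getElem_pre] at h2
  rw [h3]
  exact (hu i hi).2

theorem pre_eq_iff_of_le {x y : Cantor} {n : ℕ} : pre x n = pre y n ↔ x ∈ cyl (pre y n) := by
  rw [mem_cyl_iff, length_pre]

theorem eq_of_forall_pre_eq {x y : Cantor} (h : ∀ n, pre x n = pre y n) : x = y := by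
  funext i
  have h1 : (pre x (i + 1))[i]? = (pre y (i + 1))[i]? := by rw [h]
  rw [getElem?_pre, getElem?_pre, if_pos i.lt_succ_self, if_pos i.lt_succ_self] at h1
  exact Option.some_injective _ h1

theorem disjoint_cyl_pre {x y : Cantor} {n : ℕ} (h : pre x n ≠ pre y n) :
    Disjoint (cyl (pre x n)) (cyl (pre y n)) := by
  rw [Set.disjoint_left]
  intro z hz hz'
  exact h ((pre_eq_iff_of_le.2 hz).symm.trans (pre_eq_iff_of_le.2 hz'))

end Cylinders

/-! ### The use principle for oracle computations. -/

section Use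

/-- The partial functions `Φ t`, indexed by strings, approximate `f` along the sequence `y`. -/
def Approximates (y : Cantor) {α σ : Type} (Φ : Str → α →. σ) (f : α →. σ) : Prop :=
  (∀ s t a b, s <+: t → b ∈ Φ s a → b ∈ Φ t a) ∧ ∀ a b, b ∈ f a ↔ ∃ k, b ∈ Φ (pre y k) a

theorem approximates_const (y : Cantor) {α σ : Type} (f : α →. σ) :
    Approximates y (fun _ => f) f :=
  ⟨fun _ _ _ _ _ h => h, fun _ _ => by simp⟩

theorem exists_approximates_nat (y : Cantor) {f : ℕ →. ℕ} (hf : Nat.RecursiveIn (oracle y) f) :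
    ∃ Φ : Str → ℕ →. ℕ, Partrec₂ Φ ∧ Approximates y Φ f := by
  have hconst : ∀ {g : ℕ →. ℕ}, Nat.Partrec g →
      ∃ Φ : Str → ℕ →. ℕ, Partrec₂ Φ ∧ Approximates y Φ g :=
    fun {g} hg => ⟨fun _ => g, (Partrec.nat_iff.2 hg).comp Computable.snd, approximates_const y g⟩
  induction hf with
  | zero => exact hconst .zero
  | succ => exact hconst .succ
  | left => exact hconst .left
  | right => exact hconst .right
  | oracle g hg =>
    obtain rfl : g = fun n => Part.some (y n).toNat := hg
    -- A string answers only the queries below its length and diverges on the others; hence longer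
    -- strings only extend the computation.
    refine ⟨fun t n => ((t[n]?.map Bool.toNat : Option ℕ) : Part ℕ), ?_, ?_, ?_⟩
    · refine Computable.ofOption (Computable.option_map Computable.list_getElem? ?_)
      exact (Primrec.dom_finite Bool.toNat).to_comp.comp Computable.snd
    · intro s t a b hst hb
      simp only [Part.mem_ofOption, Option.mem_def, Option.map_eq_some_iff] at hb ⊢
      obtain ⟨c, hc, rfl⟩ := hb
      obtain ⟨hi, hc'⟩ := List.getElem?_eq_some_iff.1 hc
      refine ⟨c, ?_, rfl⟩
      rw [List.prefix_iff_getElem?.1 hst a hi, hc']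
    · intro a b
      simp only [Part.mem_some_iff, Part.mem_ofOption, Option.mem_def, Option.map_eq_some_iff,
        getElem?_pre]
      constructor
      · rintro rfl
        exact ⟨a + 1, y a, by simp, rfl⟩
      · rintro ⟨k, c, hc, rfl⟩
        split_ifs at hc with hk
        rw [Option.some_injective _ hc]
  | @pair f h _ _ ihf ihh =>
    obtain ⟨Φ, hΦ, mΦ, iΦ⟩ := ihf
    obtain ⟨Ψ, hΨ, mΨ, iΨ⟩ := ihh
    refine ⟨fun t n => (Φ t n).bind fun a => (Ψ t n).map fun b => Nat.pair a b, ?_, ?_, ?_⟩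
    · refine Partrec.bind hΦ (Partrec.map (hΨ.comp (Computable.fst.comp Computable.fst)
        (Computable.snd.comp Computable.fst)) ?_)
      exact Primrec₂.natPair.to_comp.comp (Computable.snd.comp Computable.fst) Computable.snd
    · intro s t a b hst hb
      simp only [Part.mem_bind_iff, Part.mem_map_iff] at hb ⊢
      obtain ⟨c, hc, d, hd, rfl⟩ := hb
      exact ⟨c, mΦ s t a c hst hc, d, mΨ s t a d hst hd, rfl⟩
    · intro a b
      have e : (Nat.pair <$> f a <*> h a) = (f a).bind fun c => (h a).map (Nat.pair c) := by
        simp [Seq.seq, Part.map_eq_map]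
      change b ∈ (Nat.pair <$> f a <*> h a) ↔
        ∃ k, b ∈ (Φ (pre y k) a).bind fun c => (Ψ (pre y k) a).map fun d => Nat.pair c d
      rw [e]
      simp only [Part.mem_bind_iff, Part.mem_map_iff]
      constructor
      · rintro ⟨c, hc, d, hd, rfl⟩
        obtain ⟨m, hm⟩ := (iΦ _ _).1 hc
        obtain ⟨n, hn⟩ := (iΨ _ _).1 hd
        exact ⟨max m n, c, mΦ _ _ _ _ (pre_prefix_pre y (le_max_left _ _)) hm, d,
          mΨ _ _ _ _ (pre_prefix_pre y (le_max_right _ _)) hn, rfl⟩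
      · rintro ⟨k, c, hc, d, hd, rfl⟩
        exact ⟨c, (iΦ _ _).2 ⟨k, hc⟩, d, (iΨ _ _).2 ⟨k, hd⟩, rfl⟩
  | @comp f h _ _ ihf ihh =>
    obtain ⟨Φ, hΦ, mΦ, iΦ⟩ := ihf
    obtain ⟨Ψ, hΨ, mΨ, iΨ⟩ := ihh
    refine ⟨fun t n => (Ψ t n).bind fun a => Φ t a, ?_, ?_, ?_⟩
    · exact Partrec.bind hΨ (hΦ.comp (Computable.fst.comp Computable.fst) Computable.snd)
    · intro s t a b hst hb
      simp only [Part.mem_bind_iff] at hb ⊢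
      obtain ⟨c, hc, hd⟩ := hb
      exact ⟨c, mΨ s t a c hst hc, mΦ s t c b hst hd⟩
    · intro a b
      change b ∈ (h a).bind (fun c => f c) ↔ ∃ k, b ∈ (Ψ (pre y k) a).bind fun c => Φ (pre y k) c
      simp only [Part.mem_bind_iff]
      constructor
      · rintro ⟨c, hc, hd⟩
        obtain ⟨m, hm⟩ := (iΨ _ _).1 hc
        obtain ⟨n, hn⟩ := (iΦ _ _).1 hd
        exact ⟨max m n, c, mΨ _ _ _ _ (pre_prefix_pre y (le_max_left _ _)) hm,
          mΦ _ _ _ _ (pre_prefix_pre y (le_max_right _ _)) hn⟩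
      · rintro ⟨k, c, hc, hd⟩
        exact ⟨c, (iΨ _ _).2 ⟨k, hc⟩, (iΦ _ _).2 ⟨k, hd⟩⟩
  | @prec f h _ _ ihf ihh =>
    obtain ⟨Φ, hΦ, mΦ, iΦ⟩ := ihf
    obtain ⟨Ψ, hΨ, mΨ, iΨ⟩ := ihh
    refine ⟨fun t p => Nat.rec (Φ t p.unpair.1) (fun y IH => IH.bind fun i =>
      Ψ t (Nat.pair p.unpair.1 (Nat.pair y i))) p.unpair.2, ?_, ?_, ?_⟩
    · refine Partrec.nat_rec (f := fun x : Str × ℕ => x.2.unpair.2)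
        (g := fun x => Φ x.1 x.2.unpair.1)
        (h := fun x z => Ψ x.1 (Nat.pair x.2.unpair.1 (Nat.pair z.1 z.2))) ?_ ?_ ?_
      · exact Computable.snd.comp (Computable.unpair.comp Computable.snd)
      · exact hΦ.comp Computable.fst (Computable.fst.comp (Computable.unpair.comp Computable.snd))
      · refine hΨ.comp (Computable.fst.comp Computable.fst) (Primrec₂.natPair.to_comp.comp
          (Computable.fst.comp (Computable.unpair.comp (Computable.snd.comp Computable.fst)))
          (Primrec₂.natPair.to_comp.comp (Computable.fst.comp Computable.snd)
            (Computable.snd.comp Computable.snd)))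
    · intro s t a b hst
      dsimp only
      induction a.unpair.2 generalizing b with
      | zero => exact mΦ s t _ _ hst
      | succ n ih =>
        intro hb
        simp only [Part.mem_bind_iff] at hb ⊢
        obtain ⟨c, hc, hd⟩ := hb
        exact ⟨c, ih c hc, mΨ s t _ _ hst hd⟩
    · intro a b
      -- Monotonicity at every recursion depth allows the uses of successive steps to be merged by a
      -- maximum.
      have mono : ∀ (m : ℕ) s t b, s <+: t → b ∈ (Nat.rec (Φ s a.unpair.1) (fun y IH => IH.bind
          fun i => Ψ s (Nat.pair a.unpair.1 (Nat.pair y i))) m : Part ℕ) →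
          b ∈ (Nat.rec (Φ t a.unpair.1) (fun y IH => IH.bind
          fun i => Ψ t (Nat.pair a.unpair.1 (Nat.pair y i))) m : Part ℕ) := by
        intro m s t b hst
        induction m generalizing b with
        | zero => exact mΦ s t _ _ hst
        | succ n ih =>
          intro hb
          simp only [Part.mem_bind_iff] at hb ⊢
          obtain ⟨c, hc, hd⟩ := hb
          exact ⟨c, ih c hc, mΨ s t _ _ hst hd⟩
      dsimp only
      induction a.unpair.2 generalizing b with
      | zero => exact iΦ _ _
      | succ n ih =>
        simp only [Part.bind_eq_bind, Part.mem_bind_iff]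
        constructor
        · rintro ⟨c, hc, hd⟩
          obtain ⟨m, hm⟩ := (ih _).1 hc
          obtain ⟨n, hn⟩ := (iΨ _ _).1 hd
          exact ⟨max m n, c, mono _ _ _ _ (pre_prefix_pre y (le_max_left _ _)) hm,
            mΨ _ _ _ _ (pre_prefix_pre y (le_max_right _ _)) hn⟩
        · rintro ⟨k, c, hc, hd⟩
          exact ⟨c, (ih _).2 ⟨k, hc⟩, (iΨ _ _).2 ⟨k, hd⟩⟩
  | @rfind f _ ihf =>
    obtain ⟨Φ, hΦ, mΦ, iΦ⟩ := ihf
    have key : ∀ (g : ℕ →. ℕ) (a b : ℕ),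
        b ∈ (Nat.rfind fun n => (fun m => decide (m = 0)) <$> g (Nat.pair a n)) ↔
        0 ∈ g (Nat.pair a b) ∧ ∀ m < b, ∃ c ∈ g (Nat.pair a m), c ≠ 0 := by
      intro g a b
      refine Nat.mem_rfind.trans ?_
      simp
    refine ⟨fun t a => Nat.rfind fun n => (fun m => decide (m = 0)) <$> Φ t (Nat.pair a n),
      ?_, ?_, ?_⟩
    · refine Partrec.rfind (p := fun (x : Str × ℕ) n =>
        (fun m => decide (m = 0)) <$> Φ x.1 (Nat.pair x.2 n)) ?_
      refine Partrec.map (f := fun x : (Str × ℕ) × ℕ => Φ x.1.1 (Nat.pair x.1.2 x.2)) ?_ ?_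
      · exact hΦ.comp (Computable.fst.comp Computable.fst) (Primrec₂.natPair.to_comp.comp
          (Computable.snd.comp Computable.fst) Computable.snd)
      · exact computable_decide_eq Computable.snd (Computable.const 0)
    · intro s t a b hst hb
      rw [key] at hb ⊢
      refine ⟨mΦ _ _ _ _ hst hb.1, fun m hm => ?_⟩
      obtain ⟨c, hc, hc0⟩ := hb.2 m hm
      exact ⟨c, mΦ _ _ _ _ hst hc, hc0⟩
    · intro a b
      rw [key]
      simp only [key]
      constructor
      · rintro ⟨h0, h1⟩
        choose! c hc hc0 using h1
        obtain ⟨k0, hk0⟩ := (iΦ _ _).1 h0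
        have h2 : ∀ m < b, ∃ k, c m ∈ Φ (pre y k) (Nat.pair a m) := fun m hm =>
          (iΦ _ _).1 (hc m hm)
        choose! k hk using h2
        -- A search that stops at `b` evaluates finitely many values, so one prefix serves all of
        -- them.
        refine ⟨max k0 ((Finset.range b).sup k), ?_, fun m hm => ⟨c m, ?_, hc0 m hm⟩⟩
        · exact mΦ _ _ _ _ (pre_prefix_pre y (le_max_left _ _)) hk0
        · exact mΦ _ _ _ _ (pre_prefix_pre y ((Finset.le_sup (f := k)
            (Finset.mem_range.2 hm)).trans (le_max_right _ _))) (hk m hm)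
      · rintro ⟨k, h0, h1⟩
        refine ⟨(iΦ _ _).2 ⟨k, h0⟩, fun m hm => ?_⟩
        obtain ⟨c, hc, hc0⟩ := h1 m hm
        exact ⟨c, (iΦ _ _).2 ⟨k, hc⟩, hc0⟩

variable {α σ : Type} [Primcodable α] [Primcodable σ]

/-- The use principle: a function that is partial recursive in the sequence `y` is determined, at
each argument, by a finite prefix of `y`. -/
theorem exists_approximates (y : Cantor) {f : α →. σ} (hf : RecursiveIn (oracle y) f) :
    ∃ Φ : Str → α →. σ, Partrec₂ Φ ∧ Approximates y Φ f := by
  obtain ⟨Φ, hΦ, mΦ, iΦ⟩ := exists_approximates_nat y hf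
  refine ⟨fun t a => (Φ t (Encodable.encode a)).bind fun b =>
    ((Encodable.decode (α := σ) b : Option σ) : Part σ), ?_, ?_, ?_⟩
  · exact Partrec.bind (hΦ.comp Computable.fst (Computable.encode.comp Computable.snd))
      (Computable.ofOption (Computable.decode.comp Computable.snd))
  · intro s t a b hst hb
    simp only [Part.mem_bind_iff] at hb ⊢
    obtain ⟨c, hc, hd⟩ := hb
    exact ⟨c, mΦ s t _ _ hst hc, hd⟩
  · intro a b
    simp only [Part.mem_bind_iff, Part.mem_ofOption, Option.mem_def]
    have h : ∀ c, c ∈ (f a).map Encodable.encode ↔ ∃ k, c ∈ Φ (pre y k) (Encodable.encode a) := by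
      intro c
      rw [← iΦ]
      simp
    constructor
    · intro hb
      obtain ⟨k, hk⟩ := (h (Encodable.encode b)).1 (Part.mem_map _ hb)
      exact ⟨k, _, hk, Encodable.encodek b⟩
    · rintro ⟨k, c, hc, hd⟩
      obtain ⟨b', hb', rfl⟩ := (Part.mem_map_iff _).1 ((h c).2 ⟨k, hc⟩)
      rw [Encodable.encodek] at hd
      rwa [← Option.some_injective _ hd]

/-- The use principle for recursively enumerable predicates. -/
theorem REIn.exists_use (y : Cantor) {p : α → Prop} (hp : REIn (oracle y) p) :
    ∃ q : Str × α → Prop, REPred q ∧ ∀ a, p a ↔ ∃ k, q (pre y k, a) := by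
  obtain ⟨Φ, hΦ, -, iΦ⟩ := exists_approximates y hp
  refine ⟨fun x => (Φ x.1 x.2).Dom, Partrec.dom_re hΦ, fun a => ?_⟩
  simp only [Part.dom_iff_mem]
  constructor
  · intro h
    obtain ⟨k, hk⟩ := (iΦ a ()).1 (by simpa using h)
    exact ⟨k, (), hk⟩
  · rintro ⟨k, u, hk⟩
    simpa using (iΦ a u).2 ⟨k, hk⟩

end Use

/-! ### Flexible Martin-Löf tests. -/

section Tests

variable {ι Ω : Type} [Primcodable ι] [MeasurableSpace Ω] {B : ι → Set Ω} {μ : Measure Ω}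

omit [Primcodable ι] [MeasurableSpace Ω] in
theorem mem_layer {U : Set (ι × ℕ)} {n : ℕ} {ω : Ω} :
    ω ∈ layer B U n ↔ ∃ s, (s, n) ∈ U ∧ ω ∈ B s := by
  simp [layer]

theorem mem_mlRandomIn {O : Set (ℕ →. ℕ)} {ω : Ω} :
    ω ∈ MLRandomIn O B μ ↔ ∀ U, IsTest O B μ U → ∃ n, ω ∉ layer B U n := by
  simp [MLRandomIn]

theorem tsum_two_inv_pow_add (C : ℝ≥0∞) (N : ℕ) :
    ∑' m : ℕ, C * (2 : ℝ≥0∞)⁻¹ ^ (N + 1 + m) = C * 2⁻¹ ^ N := by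
  have h : ∑' m : ℕ, (2 : ℝ≥0∞)⁻¹ ^ m = 2 := by
    rw [ENNReal.tsum_geometric, ENNReal.one_sub_inv_two, inv_inv]
  simp only [pow_add, pow_one]
  rw [ENNReal.tsum_mul_left, ENNReal.tsum_mul_left, h, mul_assoc,
    ENNReal.inv_mul_cancel (by simp) (by simp), mul_one]

/-- A point in infinitely many layers of a recursively enumerable set with geometrically decreasing
layers is not random. -/
theorem notMem_mlRandomIn {U : Set (ι × ℕ)} (hU : REPred fun p => p ∈ U) {C : ℝ≥0∞}
    (hC : C ≠ ⊤) (h : ∀ n, μ (layer B U n) ≤ C * 2⁻¹ ^ n) {ω : Ω}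
    (hω : ∃ᶠ n in atTop, ω ∈ layer B U n) : ω ∉ MLRandomIn ∅ B μ := by
  obtain ⟨N, hN⟩ : ∃ N : ℕ, C ≤ 2 ^ N := by
    obtain ⟨n, hn⟩ := ENNReal.exists_nat_gt hC
    refine ⟨n, hn.le.trans ?_⟩
    exact_mod_cast (Nat.lt_two_pow_self (n := n)).le
  rw [mem_mlRandomIn]
  push Not
  -- Tails of the sequence of layers are automatically nested. With C ≤ 2^N, the tail from n + N + 2
  -- on has measure at most 2^(-(n+1)), which leaves room for the strict inequality.
  let V : Set (ι × ℕ) := {p | ∃ m, p.2 + (N + 2) ≤ m ∧ (p.1, m) ∈ U}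
  have hV : ∀ n, layer B V n = ⋃ m, layer B U (n + N + 1 + 1 + m) := by
    intro n
    ext x
    simp only [mem_layer, mem_iUnion]
    constructor
    · rintro ⟨s, ⟨m, hm, hs⟩, hx⟩
      refine ⟨m - (n + N + 1 + 1), s, ?_, hx⟩
      dsimp only at hm hs
      rwa [Nat.add_sub_of_le (by omega)]
    · rintro ⟨m, s, hs, hx⟩
      exact ⟨s, ⟨_, by dsimp only; omega, hs⟩, hx⟩
  refine ⟨V, ⟨?_, fun n => ?_, fun n => ?_⟩, fun n => ?_⟩
  · rw [reIn_empty]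
    refine REPred.exists (p := fun x : (ι × ℕ) × ℕ => x.1.2 + (N + 2) ≤ x.2 ∧ (x.1.1, x.2) ∈ U) ?_
    refine REPred.and ?_ (hU.comp (Computable.pair (Computable.fst.comp Computable.fst)
      Computable.snd))
    refine (REPred.of_bool (computable_decide_le (computable_add (Computable.snd.comp
      Computable.fst) (Computable.const (N + 2))) Computable.snd)).of_eq fun x => ?_
    simp
  · rw [hV, hV]
    refine iUnion_subset fun m => ?_
    rw [show n + 1 + N + 1 + 1 + m = n + N + 1 + 1 + (m + 1) by omega]
    exact subset_iUnion (fun m => layer B U (n + N + 1 + 1 + m)) (m + 1)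
  · rw [hV]
    calc μ (⋃ m, layer B U (n + N + 1 + 1 + m))
        ≤ ∑' m, μ (layer B U (n + N + 1 + 1 + m)) := measure_iUnion_le _
      _ ≤ ∑' m, C * 2⁻¹ ^ (n + N + 1 + 1 + m) := ENNReal.tsum_le_tsum fun m => h _
      _ = C * 2⁻¹ ^ (n + N + 1) := tsum_two_inv_pow_add _ _
      _ ≤ 2 ^ N * 2⁻¹ ^ (n + N + 1) := by gcongr
      _ = 2⁻¹ ^ (n + 1) := by
        rw [show n + N + 1 = N + (n + 1) by omega, pow_add, ← mul_assoc, ← mul_pow,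
          ENNReal.mul_inv_cancel (by simp) (by simp), one_pow, one_mul]
      _ < 2⁻¹ ^ n := by
        rw [pow_succ]
        conv_rhs => rw [← mul_one ((2 : ℝ≥0∞)⁻¹ ^ n)]
        refine ENNReal.mul_lt_mul_right ?_ ?_ ?_
        · exact pow_ne_zero _ (by simp)
        · exact ENNReal.pow_ne_top (by simp)
        · exact ENNReal.inv_lt_one.2 (by norm_num)
  · rw [hV]
    obtain ⟨m, hm, hx⟩ := frequently_atTop.1 hω (n + N + 1 + 1)
    refine mem_iUnion.2 ⟨m - (n + N + 1 + 1), ?_⟩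
    rwa [Nat.add_sub_of_le hm]

theorem rePred_eq (i : ι) : REPred fun j : ι => j = i :=
  (REPred.of_bool (computable_decide_eq Computable.encode
    (Computable.const (Encodable.encode i)))).of_eq fun j => by simp

/-- A null basic set, repeated in every layer, is a test. -/
theorem measure_ne_zero_of_mem_mlRandomIn {ω : Ω} (hω : ω ∈ MLRandomIn ∅ B μ) {i : ι}
    (hi : ω ∈ B i) : μ (B i) ≠ 0 := by
  intro h
  refine notMem_mlRandomIn (U := {p : ι × ℕ | p.1 = i}) (C := 0) ((rePred_eq i).comp Computable.fst)
    (by simp) (fun n => ?_) (Frequently.of_forall fun n => ?_) hω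
  · rw [zero_mul, nonpos_iff_eq_zero, ← nonpos_iff_eq_zero, ← h]
    exact measure_mono fun x hx => by
      obtain ⟨s, rfl, hs⟩ := mem_layer.1 hx
      exact hs
  · exact mem_layer.2 ⟨i, rfl, hi⟩

theorem measurableSet_layer (hB : ∀ i, MeasurableSet (B i)) (U : Set (ι × ℕ)) (n : ℕ) :
    MeasurableSet (layer B U n) :=
  MeasurableSet.biUnion (Set.to_countable _) fun i _ => hB i

end Tests

/-! ### Measures of open and clopen sets. -/

section Cylinders

/-- Comparison of two measures on an open set given by comparison on its cylinders. -/
theorem measure_biUnion_cyl_le {μ ν : Measure Cantor} {T : Set Str}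
    (h : ∀ t ∈ T, μ (cyl t) ≤ ν (cyl t)) : μ (⋃ t ∈ T, cyl t) ≤ ν (⋃ t ∈ T, cyl t) := by
  -- The prefix-minimal strings of `T` have disjoint cylinders with the same union, so both measures
  -- become sums.
  let M : Set Str := {t | t ∈ T ∧ ∀ s ∈ T, s <+: t → s = t}
  have hM : ⋃ t ∈ T, cyl t = ⋃ t ∈ M, cyl t := by
    apply subset_antisymm
    · intro ω hω
      simp only [mem_iUnion] at hω ⊢
      have hex : ∃ n, pre ω n ∈ T := by
        obtain ⟨t, ht, hωt⟩ := hω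
        exact ⟨t.length, by rwa [mem_cyl_iff.1 hωt]⟩
      classical
      refine ⟨pre ω (Nat.find hex), ⟨Nat.find_spec hex, fun s hs hst => ?_⟩, mem_cyl_pre _ _⟩
      obtain ⟨h1, h2⟩ := prefix_pre_iff.1 hst
      have h3 := Nat.find_min' hex (m := s.length) (by rwa [mem_cyl_iff.1 h2])
      rw [← le_antisymm h1 h3, mem_cyl_iff.1 h2]
    · exact biUnion_mono (fun t ht => ht.1) fun _ _ => subset_rfl
  have hd : M.PairwiseDisjoint cyl := by
    intro s hs t ht hst
    rw [Function.onFun, Set.disjoint_left]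
    intro ω h1 h2
    rcases le_total s.length t.length with hl | hl
    · exact hst (ht.2 s hs.1 (prefix_of_mem_cyl h1 h2 hl))
    · exact hst (hs.2 t ht.1 (prefix_of_mem_cyl h2 h1 hl)).symm
  rw [hM, measure_biUnion (Set.to_countable _) hd fun t _ => measurableSet_cyl t,
    measure_biUnion (Set.to_countable _) hd fun t _ => measurableSet_cyl t]
  exact ENNReal.tsum_le_tsum fun t => h t t.2.1

variable {Ω : Type} [MeasurableSpace Ω]

theorem sum_measureReal_inter_cyl (μ : Measure Ω) [IsFiniteMeasure μ] {f : Ω → Cantor}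
    (hf : Measurable f) {A : Set Ω} (hA : MeasurableSet A) (n : ℕ) :
    ((strings n).map fun w => μ.real (A ∩ f ⁻¹' cyl w)).sum = μ.real A := by
  rw [← List.sum_toFinset _ (nodup_strings n)]
  have h : A = ⋃ w ∈ (strings n).toFinset, (A ∩ f ⁻¹' cyl w) := by
    ext ω
    simp only [mem_iUnion, mem_inter_iff, exists_prop, List.mem_toFinset, mem_strings]
    exact ⟨fun h => ⟨pre (f ω) n, by simp, h, mem_cyl_pre _ _⟩, fun ⟨_, _, h, _⟩ => h⟩
  conv_rhs => rw [h]
  rw [measureReal_biUnion_finset]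
  · intro w hw v hv hwv
    simp only [List.coe_toFinset, Set.mem_ofPred_eq, mem_strings] at hw hv
    rw [Function.onFun, Set.disjoint_left]
    rintro ω ⟨-, h1⟩ ⟨-, h2⟩
    apply hwv
    rw [← mem_cyl_iff.1 h1, ← mem_cyl_iff.1 h2, hw, hv]
  · exact fun w _ => hA.inter (hf (measurableSet_cyl w))

theorem measurableSet_pre₂ (p : Str → Str → Prop) (m n : ℕ) :
    MeasurableSet {ω : Cantor × Cantor | p (pre ω.1 m) (pre ω.2 n)} := by
  have : {ω : Cantor × Cantor | p (pre ω.1 m) (pre ω.2 n)} =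
      ⋃ s ∈ {s : Str × Str | s.1.length = m ∧ s.2.length = n ∧ p s.1 s.2}, cyl₂ s := by
    ext ω
    simp only [Set.mem_ofPred_eq, mem_iUnion, exists_prop, cyl₂, mem_prod]
    constructor
    · exact fun h => ⟨(pre ω.1 m, pre ω.2 n), ⟨by simp, by simp, h⟩, mem_cyl_pre _ _,
        mem_cyl_pre _ _⟩
    · rintro ⟨⟨s, t⟩, ⟨rfl, rfl, h⟩, h1, h2⟩
      rwa [mem_cyl_iff.1 h1, mem_cyl_iff.1 h2]
  rw [this]
  exact MeasurableSet.biUnion (Set.to_countable _) fun s _ => measurableSet_cyl₂ s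

theorem measurableSet_pre (p : Str → Prop) (n : ℕ) : MeasurableSet {x : Cantor | p (pre x n)} :=
  (measurable_id.prodMk measurable_id) (measurableSet_pre₂ (fun w _ => p w) n 0)

/-- The measures of uniformly computable clopen sets are computable. -/
theorem computableReal_pre {α : Type} [Primcodable α] {P : Measure (Cantor × Cantor)}
    [IsFiniteMeasure P] (hP : ComputableReal fun s => P.real (cyl₂ s)) {cov : α → Str → Str → Bool}
    (hcov : Computable fun x : α × Str × Str => cov x.1 x.2.1 x.2.2) {m n : α → ℕ}
    (hm : Computable m) (hn : Computable n) :
    ComputableReal fun a => P.real {ω | cov a (pre ω.1 (m a)) (pre ω.2 (n a)) = true} := by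
  have h1 : ComputableReal fun x : (α × Str) × Str =>
      if cov x.1.1 x.1.2 x.2 then P.real (cyl₂ (x.1.2, x.2)) else 0 := by
    refine ComputableReal.ite (hP.comp (Computable.pair (Computable.snd.comp Computable.fst)
      Computable.snd)) ?_
    exact hcov.comp (Computable.pair (Computable.fst.comp Computable.fst)
      (Computable.pair (Computable.snd.comp Computable.fst) Computable.snd))
  have h2 := h1.list_sum (f := fun x : α × Str => strings (n x.1))
    (computable_strings (hn.comp Computable.fst))
  refine (h2.list_sum (f := fun a : α => strings (m a)) (computable_strings hm)).of_eq fun a => ?_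
  have hA := measurableSet_pre₂ (fun w t => cov a w t = true) (m a) (n a)
  rw [← sum_measureReal_inter_cyl P measurable_fst hA (m a)]
  congr 1
  refine List.map_congr_left fun w hw => ?_
  rw [← sum_measureReal_inter_cyl P measurable_snd (hA.inter (measurable_fst
    (measurableSet_cyl w))) (n a)]
  congr 1
  refine List.map_congr_left fun t ht => ?_
  rw [mem_strings] at hw ht
  have hw' : ∀ {ω : Cantor}, ω ∈ cyl w → pre ω (m a) = w := fun {ω} h => by
    rw [← hw]; exact mem_cyl_iff.1 h
  have ht' : ∀ {ω : Cantor}, ω ∈ cyl t → pre ω (n a) = t := fun {ω} h => by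
    rw [← ht]; exact mem_cyl_iff.1 h
  dsimp only
  split_ifs with hc
  · congr 1
    ext ω
    simp only [cyl₂, mem_prod, mem_inter_iff, Set.mem_ofPred_eq, mem_preimage]
    refine ⟨fun h => ⟨⟨?_, h.1⟩, h.2⟩, fun h => ⟨h.1.2, h.2⟩⟩
    rwa [hw' h.1, ht' h.2]
  · symm
    convert measureReal_empty
    ext ω
    simp only [mem_inter_iff, Set.mem_ofPred_eq, mem_preimage, mem_empty_iff_false, iff_false]
    rintro ⟨⟨h1, h2⟩, h3⟩
    rw [hw' h2, ht' h3] at h1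
    exact hc h1

end Cylinders

/-! ### Conditional measures given a string, and projections of random pairs. -/

section Conditional

variable (P : Measure (Cantor × Cantor))

/-- The measure `A ↦ P (A × Δ(s))` on the first coordinate. -/
noncomputable def slice (s : Str) : Measure Cantor :=
  (P.restrict (Prod.snd ⁻¹' cyl s)).map Prod.fst

instance [IsFiniteMeasure P] (s : Str) : IsFiniteMeasure (slice P s) := by
  unfold slice
  infer_instance

theorem slice_apply (s : Str) {A : Set Cantor} (hA : MeasurableSet A) :
    slice P s A = P (A ×ˢ cyl s) := by
  rw [slice, Measure.map_apply measurable_fst hA, Measure.restrict_apply (measurable_fst hA)]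
  rfl

theorem slice_cyl (s t : Str) : slice P t (cyl s) = P (cyl₂ (s, t)) :=
  slice_apply P t (measurableSet_cyl s)

theorem snd_cyl (t : Str) : P.snd (cyl t) = P (cyl₂ ([], t)) := by
  rw [Measure.snd_apply (measurableSet_cyl t)]
  congr 1
  ext ω
  simp [cyl₂]

theorem slice_univ (t : Str) : slice P t univ = P.snd (cyl t) := by
  rw [slice_apply P t MeasurableSet.univ, Measure.snd_apply (measurableSet_cyl t), univ_prod]

theorem condStr_eq (s : Str) : condStr P s = (P.snd (cyl s))⁻¹ • slice P s := by
  rw [condStr, ProbabilityTheory.cond, Measure.map_smul, slice,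
    Measure.snd_apply (measurableSet_cyl s)]

theorem condStr_apply (s : Str) (A : Set Cantor) :
    condStr P s A = (P.snd (cyl s))⁻¹ * slice P s A := by
  rw [condStr_eq]
  rfl

variable [IsFiniteMeasure P]

theorem mul_condStr_apply (s : Str) (A : Set Cantor) :
    P.snd (cyl s) * condStr P s A = slice P s A := by
  rw [condStr_apply]
  by_cases h : P.snd (cyl s) = 0
  · rw [h, zero_mul]
    symm
    rw [← nonpos_iff_eq_zero, ← h, ← slice_univ]
    exact measure_mono (subset_univ _)
  · rw [← mul_assoc, ENNReal.mul_inv_cancel h (measure_ne_top _ _), one_mul]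

theorem isProbabilityMeasure_condStr {s : Str} (h : P.snd (cyl s) ≠ 0) :
    IsProbabilityMeasure (condStr P s) := by
  constructor
  rw [condStr_apply, slice_univ, ENNReal.inv_mul_cancel h (measure_ne_top _ _)]

omit [IsFiniteMeasure P] in
theorem condStr_cyl_le_one (s t : Str) : condStr P t (cyl s) ≤ 1 := by
  rw [condStr_apply]
  refine (mul_le_mul_right (measure_mono (subset_univ _)) _).trans ?_
  rw [slice_univ]
  exact ENNReal.inv_mul_le_one _

variable {P}

omit [IsFiniteMeasure P] in
theorem snd_cyl_ne_zero {y : Cantor} (hy : y ∈ MLR P.snd) (n : ℕ) : P.snd (cyl (pre y n)) ≠ 0 :=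
  measure_ne_zero_of_mem_mlRandomIn hy (mem_cyl_pre y n)

/-- The product of a test for P(· | s) with Δ(s) has layers of P-measure at most P_Y(Δ(s)) · 2^(-m).
-/
theorem mlr₂_mem_condStr {x y : Cantor} (h : (x, y) ∈ MLR₂ P) (n : ℕ) :
    x ∈ MLR (condStr P (pre y n)) := by
  by_contra hx
  obtain ⟨U, hU, hx⟩ : ∃ U, IsTest ∅ cyl (condStr P (pre y n)) U ∧ ∀ m, x ∈ layer cyl U m := by
    by_contra! hc
    exact hx (mem_mlRandomIn.2 hc)
  have hl : ∀ m, layer cyl₂ {p : (Str × Str) × ℕ | (p.1.1, p.2) ∈ U ∧ p.1.2 = pre y n} m =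
      layer cyl U m ×ˢ cyl (pre y n) := by
    intro m
    ext ω
    simp only [mem_layer, Set.mem_ofPred_eq, Prod.exists, cyl₂, mem_prod]
    constructor
    · rintro ⟨s, t, ⟨h1, rfl⟩, h2, h3⟩
      exact ⟨⟨s, h1, h2⟩, h3⟩
    · rintro ⟨⟨s, h1, h2⟩, h3⟩
      exact ⟨s, _, ⟨h1, rfl⟩, h2, h3⟩
  refine notMem_mlRandomIn (C := P.snd (cyl (pre y n))) (μ := P) (B := cyl₂)
    (U := {p : (Str × Str) × ℕ | (p.1.1, p.2) ∈ U ∧ p.1.2 = pre y n}) ?_ (measure_ne_top _ _)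
    (fun m => ?_) (Frequently.of_forall fun m => ?_) h
  · exact (((reIn_empty _).1 hU.re).comp (Computable.pair (Computable.fst.comp Computable.fst)
      Computable.snd)).and ((rePred_eq (pre y n)).comp (Computable.snd.comp Computable.fst))
  · rw [hl, ← slice_apply P _ (measurableSet_layer measurableSet_cyl U m), ← mul_condStr_apply]
    gcongr
    exact (hU.small m).le
  · rw [hl]
    exact ⟨hx m, mem_cyl_pre y n⟩

omit [IsFiniteMeasure P] in
theorem mlr₂_mem_snd {x y : Cantor} (h : (x, y) ∈ MLR₂ P) : y ∈ MLR P.snd := by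
  by_contra hx
  obtain ⟨U, hU, hx⟩ : ∃ U, IsTest ∅ cyl P.snd U ∧ ∀ m, y ∈ layer cyl U m := by
    by_contra! hc
    exact hx (mem_mlRandomIn.2 hc)
  have hl : ∀ m, layer cyl₂ {p : (Str × Str) × ℕ | (p.1.2, p.2) ∈ U ∧ p.1.1 = []} m =
      Prod.snd ⁻¹' layer cyl U m := by
    intro m
    ext ω
    simp only [mem_layer, Set.mem_ofPred_eq, Prod.exists, cyl₂, mem_prod, mem_preimage]
    constructor
    · rintro ⟨s, t, ⟨h1, rfl⟩, h2, h3⟩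
      exact ⟨t, h1, h3⟩
    · rintro ⟨s, h1, h2⟩
      exact ⟨[], s, ⟨h1, rfl⟩, by simp, h2⟩
  refine notMem_mlRandomIn (C := 1) (μ := P) (B := cyl₂)
    (U := {p : (Str × Str) × ℕ | (p.1.2, p.2) ∈ U ∧ p.1.1 = []}) ?_ (by simp)
    (fun m => ?_) (Frequently.of_forall fun m => ?_) h
  · exact (((reIn_empty _).1 hU.re).comp (Computable.pair (Computable.snd.comp Computable.fst)
      Computable.snd)).and ((rePred_eq []).comp (Computable.fst.comp Computable.fst))
  · rw [hl, ← Measure.snd_apply (measurableSet_layer measurableSet_cyl U m), one_mul]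
    exact (hU.small m).le
  · rw [hl]
    exact hx m

/-- This is the case of the empty prefix, where the conditional distribution is the marginal. -/
theorem mlr₂_mem_fst {P : Measure (Cantor × Cantor)} [IsProbabilityMeasure P] {x y : Cantor}
    (h : (x, y) ∈ MLR₂ P) : x ∈ MLR P.fst := by
  have h1 := mlr₂_mem_condStr h 0
  have h2 : condStr P (pre y 0) = P.fst := by
    have h3 : pre y 0 = [] := rfl
    rw [h3, condStr, cyl_nil, preimage_univ, ProbabilityTheory.cond_univ]
    rfl
  rwa [h2] at h1

end Conditional

/-! ### The universal test and random partners. -/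

section Universal

theorem computable_cover_level {β : Type} {U : (Str × Str) × β → Prop} {cov : β → Str → Str → Bool}
    (h1 : ∀ b w t, cov b w t = true → ∃ a a', a <+: w ∧ a' <+: t ∧ U ((a, a'), b))
    (h2 : ∀ b a a', U ((a, a'), b) → ∃ N, ∀ w t, a <+: w → a' <+: t → N ≤ w.length →
      cov b w t = true) (b : β) (ω : Cantor × Cantor) :
    (∃ n, cov b (pre ω.1 n) (pre ω.2 n) = true) ↔ ∃ p, U (p, b) ∧ ω ∈ cyl₂ p := by
  constructor
  · rintro ⟨n, hn⟩
    obtain ⟨a, a', ha, ha', hU⟩ := h1 _ _ _ hn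
    exact ⟨(a, a'), hU, (prefix_pre_iff.1 ha).2, (prefix_pre_iff.1 ha').2⟩
  · rintro ⟨⟨a, a'⟩, hU, ha, ha'⟩
    obtain ⟨N, hN⟩ := h2 _ _ _ hU
    refine ⟨N + a.length + a'.length, hN _ _ (prefix_pre_iff.2 ⟨by omega, ha⟩)
      (prefix_pre_iff.2 ⟨by omega, ha'⟩) (by rw [length_pre]; omega)⟩

theorem two_pow_mul_measureReal_lt_one_iff {Ω : Type} [MeasurableSpace Ω] (μ : Measure Ω)
    [IsFiniteMeasure μ] (A : Set Ω) (n : ℕ) :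
    ((2 ^ n : ℕ) : ℝ) * μ.real A < ((1 : ℕ) : ℝ) ↔ μ A < 2⁻¹ ^ n := by
  have e : ((2 : ℝ≥0∞)⁻¹ ^ n) = ENNReal.ofReal ((2 ^ n)⁻¹) := by
    rw [ENNReal.ofReal_inv_of_pos (by positivity), ENNReal.ofReal_pow (by norm_num),
      ENNReal.inv_pow]
    simp
  rw [e, ENNReal.lt_ofReal_iff_toReal_lt (measure_ne_top _ _), ← measureReal_def,
    Nat.cast_pow, Nat.cast_ofNat, Nat.cast_one, ← one_div, lt_div_iff₀' (by positivity)]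

/-- A universal Martin-Löf test for a computable probability on the product space. -/
theorem exists_universal_test {P : Measure (Cantor × Cantor)} [IsFiniteMeasure P]
    (hP : ComputableReal fun s => P.real (cyl₂ s)) :
    ∃ U : Set ((Str × Str) × ℕ), (REPred fun p => p ∈ U) ∧
      (∀ n, P (layer cyl₂ U n) ≤ 1 * 2⁻¹ ^ n) ∧
      ∀ ω, (∃ n, ω ∉ layer cyl₂ U n) → ω ∈ MLR₂ P := by
  -- The pair of numbers consists of a program and a layer, so all candidate tests are enumerated at
  -- once.
  let R : (Str × Str) × (ℕ × ℕ) → Prop := fun x =>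
    ((Denumerable.ofNat Nat.Partrec.Code x.2.1).eval (Encodable.encode (x.1, x.2.2))).Dom
  have hR : REPred R := by
    refine Partrec.dom_re (Nat.Partrec.Code.eval_part.comp ?_ ?_)
    · exact (Computable.ofNat _).comp (Computable.fst.comp Computable.snd)
    · exact Computable.encode.comp (Computable.pair Computable.fst
        (Computable.snd.comp Computable.snd))
  obtain ⟨cov, hcov, hmono, hsound, hcomplete, -⟩ := exists_computable_cover hR
  let M : ℕ × ℕ → ℕ → Set (Cantor × Cantor) := fun b L =>
    {ω | cov b (pre ω.1 L) (pre ω.2 L) = true}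
  have hM : ∀ b, Monotone (M b) := fun b i j hij ω hω =>
    hmono _ _ _ _ _ (pre_prefix_pre _ hij) (pre_prefix_pre _ hij) hω
  let good : ℕ × ℕ → ℕ → Prop := fun b L => ((2 ^ b.2 : ℕ) : ℝ) * P.real (M b L) < ((1 : ℕ) : ℝ)
  have hgood_re : REPred fun x : (ℕ × ℕ) × ℕ => good x.1 x.2 := by
    have c : ComputableReal fun x : (ℕ × ℕ) × ℕ => P.real (M x.1 x.2) :=
      computableReal_pre hP (cov := fun x : (ℕ × ℕ) × ℕ => cov x.1)
        (m := fun x => x.2) (n := fun x => x.2)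
        (hcov.comp (g := fun x : ((ℕ × ℕ) × ℕ) × (Str × Str) => (x.1.1, x.2))
          (Computable.pair (Computable.fst.comp Computable.fst) Computable.snd))
        Computable.snd Computable.snd
    exact (ComputableReal.natCast_mul (f := fun x : (ℕ × ℕ) × ℕ => 2 ^ x.1.2)
      (computable_two_pow (Computable.snd.comp Computable.fst)) c).lt_re
      (ComputableReal.natCast (f := fun _ : (ℕ × ℕ) × ℕ => 1) (Computable.const 1))
  have hgood : ∀ b L, good b L ↔ P (M b L) < 2⁻¹ ^ b.2 := fun b L =>
    two_pow_mul_measureReal_lt_one_iff P (M b L) b.2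
  have hanti : ∀ b i j, i ≤ j → good b j → good b i := by
    intro b i j hij h
    rw [hgood] at h ⊢
    exact (measure_mono (hM b hij)).trans_lt h
  -- Layer n collects, over all programs e, level n + 1 + e of the e-th candidate, but only those
  -- stages whose measure is below 2^(-(n+1+e)). These bounds sum to 2^(-n), and a genuine test is
  -- never cut off because its whole layer satisfies the bound.
  let U : Set ((Str × Str) × ℕ) := {x | ∃ e : ℕ, x.1.2.length = x.1.1.length ∧
    cov (e, x.2 + 1 + e) x.1.1 x.1.2 = true ∧ good (e, x.2 + 1 + e) x.1.1.length}
  have hlayer : ∀ n, layer cyl₂ U n =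
      ⋃ e : ℕ, ⋃ L, ⋃ _ : good (e, n + 1 + e) L, M (e, n + 1 + e) L := by
    intro n
    ext ω
    simp only [mem_layer, mem_iUnion]
    constructor
    · rintro ⟨⟨s, t⟩, ⟨e, h1, h2, h3⟩, h4, h5⟩
      refine ⟨e, s.length, h3, ?_⟩
      change cov _ (pre ω.1 s.length) (pre ω.2 s.length) = true
      dsimp only at h1 h2 h4 h5
      rwa [mem_cyl_iff.1 h4, ← h1, mem_cyl_iff.1 h5]
    · rintro ⟨e, L, h1, h2⟩
      refine ⟨(pre ω.1 L, pre ω.2 L), ⟨e, by simp, h2, ?_⟩, mem_cyl_pre _ _, mem_cyl_pre _ _⟩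
      simpa using h1
  refine ⟨U, ?_, fun n => ?_, ?_⟩
  · refine REPred.exists (p := fun y : ((Str × Str) × ℕ) × ℕ => y.1.1.2.length = y.1.1.1.length ∧
      cov (y.2, y.1.2 + 1 + y.2) y.1.1.1 y.1.1.2 = true ∧
      good (y.2, y.1.2 + 1 + y.2) y.1.1.1.length) ?_
    have c1 : Computable fun y : ((Str × Str) × ℕ) × ℕ => y.1.1.1 :=
      Computable.fst.comp (Computable.fst.comp Computable.fst)
    have c2 : Computable fun y : ((Str × Str) × ℕ) × ℕ => y.1.1.2 :=
      Computable.snd.comp (Computable.fst.comp Computable.fst)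
    have c3 : Computable fun y : ((Str × Str) × ℕ) × ℕ => (y.2, y.1.2 + 1 + y.2) :=
      Computable.pair Computable.snd (computable_add (computable_add
        (Computable.snd.comp Computable.fst) (Computable.const 1)) Computable.snd)
    refine REPred.and ?_ (REPred.and ?_ ?_)
    · refine (REPred.of_bool (computable_decide_eq (Computable.list_length.comp c2)
        (Computable.list_length.comp c1))).of_eq fun x => ?_
      simp
    · exact REPred.of_bool (hcov.comp (g := fun y : ((Str × Str) × ℕ) × ℕ =>
        ((y.2, y.1.2 + 1 + y.2), y.1.1.1, y.1.1.2)) (Computable.pair c3 (Computable.pair c1 c2)))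
    · exact hgood_re.comp (f := fun y : ((Str × Str) × ℕ) × ℕ =>
        ((y.2, y.1.2 + 1 + y.2), y.1.1.1.length))
        (Computable.pair c3 (Computable.list_length.comp c1))
  · rw [hlayer, ← tsum_two_inv_pow_add]
    refine (measure_iUnion_le _).trans (ENNReal.tsum_le_tsum fun e => ?_)
    rw [one_mul, Directed.measure_iUnion]
    · refine iSup_le fun L => ?_
      by_cases h : good (e, n + 1 + e) L
      · simp only [h, iUnion_true]
        exact ((hgood _ _).1 h).le
      · simp [h]
    · intro i j
      wlog hij : i ≤ j generalizing i j
      · obtain ⟨k, h1, h2⟩ := this j i (le_of_not_ge hij)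
        exact ⟨k, h2, h1⟩
      by_cases h : good (e, n + 1 + e) j
      · refine ⟨j, ?_, subset_rfl⟩
        simpa [h, hanti _ i j hij h] using hM _ hij
      · exact ⟨i, subset_rfl, by simp [h]⟩
  · rintro ω ⟨n, hn⟩
    refine mem_mlRandomIn.2 fun T hT => ?_
    obtain ⟨c, hc⟩ := Nat.Partrec.Code.exists_code.1 ((reIn_empty _).1 hT.re)
    have hc' : ∀ a, (c.eval (Encodable.encode a)).Dom ↔ a ∈ T := by
      intro a
      rw [hc]
      simp [Part.assert]
    refine ⟨n + 1 + Encodable.encode c, fun hω => hn ?_⟩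
    rw [hlayer]
    set b : ℕ × ℕ := (Encodable.encode c, n + 1 + Encodable.encode c) with hb
    have hRT : ∀ p, R (p, b) ↔ (p, b.2) ∈ T := by
      intro p
      simp only [R, b, Denumerable.ofNat_encode]
      exact hc' _
    obtain ⟨L, hL⟩ := (computable_cover_level hsound hcomplete b ω).2 (by
      obtain ⟨p, hp, hω⟩ := mem_layer.1 hω
      exact ⟨p, (hRT p).2 hp, hω⟩)
    refine mem_iUnion.2 ⟨Encodable.encode c, mem_iUnion.2 ⟨L, mem_iUnion.2 ⟨?_, hL⟩⟩⟩
    rw [hgood]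
    refine lt_of_le_of_lt (measure_mono fun ω' hω' => ?_) (hT.small b.2)
    obtain ⟨p, hp, hω'⟩ := (computable_cover_level hsound hcomplete b ω').1 ⟨L, hω'⟩
    exact mem_layer.2 ⟨p, (hRT p).1 hp, hω'⟩

/-- A point that is random with respect to `P(· | s)` is the first coordinate of a random pair with
second coordinate in `Δ(s)`. -/
theorem exists_mem_mlr₂ {P : Measure (Cantor × Cantor)} [IsFiniteMeasure P]
    (hP : ComputableReal fun s => P.real (cyl₂ s)) {s : Str} (hs : P.snd (cyl s) ≠ 0) {x : Cantor}
    (hx : x ∈ MLR (condStr P s)) : ∃ y ∈ cyl s, (x, y) ∈ MLR₂ P := by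
  obtain ⟨U, hU, hUP, hUR⟩ := exists_universal_test hP
  by_contra! hc
  have hxU : ∀ n, ∀ y ∈ cyl s, (x, y) ∈ layer cyl₂ U n := by
    intro n y hy
    by_contra h
    exact hc y hy (hUR _ ⟨n, h⟩)
  let R : (Str × Str) × ℕ → Prop := fun z => ∃ p : Str × Str, (p, z.2) ∈ U ∧
    p.1 <+: z.1.1 ∧ p.2 <+: z.1.2
  have hR : REPred R := by
    refine REPred.exists (p := fun z : ((Str × Str) × ℕ) × (Str × Str) => (z.2, z.1.2) ∈ U ∧
      z.2.1 <+: z.1.1.1 ∧ z.2.2 <+: z.1.1.2) ?_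
    refine REPred.and (hU.comp (Computable.pair Computable.snd
      (Computable.snd.comp Computable.fst))) (REPred.and ?_ ?_)
    · refine (REPred.of_bool (computable_isPrefix (Computable.fst.comp Computable.snd)
        (Computable.fst.comp (Computable.fst.comp Computable.fst)))).of_eq fun z => ?_
      simp
    · refine (REPred.of_bool (computable_isPrefix (Computable.snd.comp Computable.snd)
        (Computable.snd.comp (Computable.fst.comp Computable.fst)))).of_eq fun z => ?_
      simp
  -- A string enters once some finite level shows that its cylinder times Δ(s) is covered by layer n
  -- of `U`; this inclusion bounds the measure of the new layer.
  let V : Set (Str × ℕ) := {z | ∃ N : ℕ, ∀ t ∈ strings (s.length + N),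
    ¬ s <+: t ∨ R ((z.1, t), z.2)}
  have hV : REPred fun z => z ∈ V := by
    refine REPred.exists (p := fun z : (Str × ℕ) × ℕ => ∀ t ∈ strings (s.length + z.2),
      ¬ s <+: t ∨ R ((z.1.1, t), z.1.2)) ?_
    refine REPred.ball_list (p := fun z : ((Str × ℕ) × ℕ) × Str =>
      ¬ s <+: z.2 ∨ R ((z.1.1.1, z.2), z.1.1.2)) (REPred.or ?_ ?_)
      (computable_strings (computable_add (Computable.const _) Computable.snd))
    · refine (REPred.of_bool (computable_not (computable_isPrefix (Computable.const s)
        Computable.snd))).of_eq fun z => ?_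
      simp
    · exact hR.comp (Computable.pair (Computable.pair (Computable.fst.comp (Computable.fst.comp
        Computable.fst)) Computable.snd) (Computable.snd.comp (Computable.fst.comp Computable.fst)))
  refine notMem_mlRandomIn (C := (P.snd (cyl s))⁻¹ * 1) (μ := condStr P s) hV
    (ENNReal.mul_ne_top (ENNReal.inv_ne_top.2 hs) (by simp)) (fun n => ?_)
    (Frequently.of_forall fun n => ?_) hx
  · rw [condStr_apply, slice_apply P s (measurableSet_layer measurableSet_cyl V n), mul_assoc]
    gcongr
    refine (measure_mono ?_).trans (hUP n)
    rintro ⟨x', y'⟩ ⟨hx', hy'⟩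
    obtain ⟨w, ⟨N, hN⟩, hxw⟩ := mem_layer.1 hx'
    rcases hN (pre y' (s.length + N)) (by simp [mem_strings]) with h | ⟨p, hp, h1, h2⟩
    · exact absurd (prefix_pre_iff.2 ⟨by omega, hy'⟩) h
    · exact mem_layer.2 ⟨p, hp, cyl_subset_cyl h1 hxw, (prefix_pre_iff.1 h2).2⟩
  · let O : ℕ → Set Cantor := fun k => ⋃ p ∈ {p : Str × Str | (p, n) ∈ U ∧ p.1.length ≤ k ∧
      p.2.length ≤ k ∧ x ∈ cyl p.1}, cyl p.2
    -- The fibre over x is the compact set Δ(s). It is covered by rectangles with sides of length at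
    -- most k, which then also cover the fibres over Δ(`pre x k`).
    obtain ⟨k, hk⟩ := ((isClopen_cyl s).1.isCompact).elim_directed_cover O
      (fun k => isOpen_biUnion fun p _ => (isClopen_cyl p.2).2) (fun y hy => by
        obtain ⟨p, hp, h1, h2⟩ := mem_layer.1 (hxU n y hy)
        exact mem_iUnion.2 ⟨p.1.length + p.2.length, mem_biUnion (x := p)
          ⟨hp, by omega, by omega, h1⟩ h2⟩)
      (directed_of_isDirected_le fun i j hij => biUnion_mono (fun p hp =>
        ⟨hp.1, hp.2.1.trans hij, hp.2.2.1.trans hij, hp.2.2.2⟩) fun _ _ => subset_rfl)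
    refine mem_layer.2 ⟨pre x k, ⟨k, fun t ht => ?_⟩, mem_cyl_pre x k⟩
    by_cases hst : s <+: t
    · right
      obtain ⟨y, hy⟩ := exists_mem_cyl t
      obtain ⟨p, ⟨hp, h1, h2, h3⟩, h4⟩ := mem_iUnion₂.1 (hk (cyl_subset_cyl hst hy))
      rw [mem_strings] at ht
      exact ⟨p, hp, prefix_pre_iff.2 ⟨h1, h3⟩, prefix_of_mem_cyl h4 hy (by dsimp only; omega)⟩
    · exact Or.inl hst

end Universal

/-! ### Existence of the conditional probability at a random parameter. -/

section Convergence

variable {P : Measure (Cantor × Cantor)} [IsFiniteMeasure P]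

/-- The measure `B ↦ P (A × B)` on the second coordinate. -/
noncomputable def cut (P : Measure (Cantor × Cantor)) (A : Set Cantor) : Measure Cantor :=
  (P.restrict (Prod.fst ⁻¹' A)).map Prod.snd

theorem cut_apply (P : Measure (Cantor × Cantor)) (A : Set Cantor) {B : Set Cantor}
    (hB : MeasurableSet B) : cut P A B = P (A ×ˢ B) := by
  rw [cut, Measure.map_apply measurable_snd hB, Measure.restrict_apply (measurable_snd hB),
    inter_comm]
  rfl

theorem cut_cyl (P : Measure (Cantor × Cantor)) (s t : Str) :
    cut P (cyl s) (cyl t) = P (cyl₂ (s, t)) :=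
  cut_apply P _ (measurableSet_cyl t)

theorem natCast_mul_measureReal_le_iff {Ω Ω' : Type} [MeasurableSpace Ω] [MeasurableSpace Ω']
    {μ : Measure Ω} {ν : Measure Ω'} [IsFiniteMeasure μ] [IsFiniteMeasure ν] {a b : ℕ} {A : Set Ω}
    {B : Set Ω'} : (a : ℝ) * μ.real A ≤ b * ν.real B ↔ (a : ℝ≥0∞) * μ A ≤ b * ν B := by
  rw [← ENNReal.toReal_le_toReal (ENNReal.mul_ne_top (by simp) (measure_ne_top _ _))
    (ENNReal.mul_ne_top (by simp) (measure_ne_top _ _))]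
  simp [measureReal_def]

theorem natCast_mul_measureReal_lt_iff {Ω Ω' : Type} [MeasurableSpace Ω] [MeasurableSpace Ω']
    {μ : Measure Ω} {ν : Measure Ω'} [IsFiniteMeasure μ] [IsFiniteMeasure ν] {a b : ℕ} {A : Set Ω}
    {B : Set Ω'} : (a : ℝ) * μ.real A < b * ν.real B ↔ (a : ℝ≥0∞) * μ A < b * ν B := by
  rw [← not_le, natCast_mul_measureReal_le_iff, not_le]

/-- The strings at which an alternation between `L` and `H` along the prefixes has occurred at least
`k` times. -/
def alternations (L H : Str → Prop) : ℕ → Set Str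
  | 0 => univ
  | k + 1 => {t | ∃ s ∈ alternations L H k, (∃ u, s <+: u ∧ u <+: t ∧ L u) ∧ H t}

theorem alternations_re {L H : Str → Prop} (hL : REPred L) (hH : REPred H) :
    REPred fun x : Str × ℕ => x.1 ∈ alternations L H x.2 := by
  let R : Str × Str → Prop := fun x => (∃ u, x.1 <+: u ∧ u <+: x.2 ∧ L u) ∧ H x.2
  have hR : REPred R := by
    refine REPred.and (REPred.exists (p := fun z : (Str × Str) × Str =>
      z.1.1 <+: z.2 ∧ z.2 <+: z.1.2 ∧ L z.2) (REPred.and ?_ (REPred.and ?_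
        (hL.comp Computable.snd)))) (hH.comp Computable.snd)
    · refine (REPred.of_bool (computable_isPrefix (Computable.fst.comp Computable.fst)
        Computable.snd)).of_eq fun z => ?_
      simp
    · refine (REPred.of_bool (computable_isPrefix Computable.snd (Computable.snd.comp
        Computable.fst))).of_eq fun z => ?_
      simp
  -- The recursion unfolds into a single quantifier over the list of earlier stages of the chain.
  -- Reading past the end of the list gives the empty string, so short lists are harmless.
  have key : ∀ k t, t ∈ alternations L H k ↔ ∃ l : List Str,
      ∀ i < k, R ((t :: l).getD (i + 1) [], (t :: l).getD i []) := by
    intro k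
    induction k with
    | zero => intro t; simp [alternations]
    | succ k ih =>
      intro t
      constructor
      · rintro ⟨s, hs, h⟩
        obtain ⟨l, hl⟩ := (ih s).1 hs
        refine ⟨s :: l, fun i hi => ?_⟩
        rcases i with _ | i
        · exact h
        · exact hl i (by omega)
      · rintro ⟨l, hl⟩
        refine ⟨l.getD 0 [], (ih _).2 ⟨l.tail, fun i hi => ?_⟩, hl 0 (by omega)⟩
        have h := hl (i + 1) (by omega)
        rcases l with _ | ⟨s, l⟩
        · rcases i with _ | i <;> exact h
        · exact h
  refine (REPred.exists (p := fun z : (Str × ℕ) × List Str => ∀ i < z.1.2,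
    R ((z.1.1 :: z.2).getD (i + 1) [], (z.1.1 :: z.2).getD i [])) ?_).of_eq
      fun x => (key x.2 x.1).symm
  have hc : Computable fun z : ((Str × ℕ) × List Str) × ℕ => z.1.1.1 :: z.1.2 :=
    Computable.list_cons.comp (Computable.fst.comp (Computable.fst.comp Computable.fst))
      (Computable.snd.comp Computable.fst)
  have hg : Computable₂ fun (l : List Str) (n : ℕ) => l.getD n [] :=
    (Primrec.list_getD []).to_comp
  exact REPred.ball_lt (p := fun z : ((Str × ℕ) × List Str) × ℕ =>
    R ((z.1.1.1 :: z.1.2).getD (z.2 + 1) [], (z.1.1.1 :: z.1.2).getD z.2 []))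
    (hR.comp (Computable.pair (hg.comp hc (Computable.succ.comp Computable.snd))
      (hg.comp hc Computable.snd))) (Computable.snd.comp Computable.fst)

/-- The (k+1)-st high strings lie above low strings, and these lie above the k-th high strings.
Passing from μ to ρ on the high strings and back to μ on the low ones costs the factor ad / (bc); it
is written without division. -/
theorem measure_alternations_le {μ ρ : Measure Cantor} {L H : Str → Prop} {a b c d : ℝ≥0∞}
    (hL : ∀ t, L t → b * ρ (cyl t) ≤ a * μ (cyl t)) (hH : ∀ t, H t → c * μ (cyl t) ≤ d * ρ (cyl t))
    (k : ℕ) : (b * c) ^ k * μ (⋃ t ∈ alternations L H k, cyl t) ≤ (a * d) ^ k * μ univ := by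
  induction k with
  | zero => simpa using measure_mono (subset_univ _)
  | succ k ih =>
    let W : Set Str := {u | L u ∧ ∃ s ∈ alternations L H k, s <+: u}
    have h1 : c * μ (⋃ t ∈ alternations L H (k + 1), cyl t) ≤
        d * ρ (⋃ t ∈ alternations L H (k + 1), cyl t) :=
      measure_biUnion_cyl_le (μ := c • μ) (ν := d • ρ) fun t ht => hH t (by
        obtain ⟨s, -, -, h⟩ := ht
        exact h)
    have h2 : ρ (⋃ t ∈ alternations L H (k + 1), cyl t) ≤ ρ (⋃ t ∈ W, cyl t) := by
      refine measure_mono (iUnion₂_subset fun t ht => ?_)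
      obtain ⟨s, hs, ⟨u, hsu, hut, hu⟩, -⟩ := ht
      exact (cyl_subset_cyl hut).trans (subset_biUnion_of_mem (u := cyl)
        (show u ∈ W from ⟨hu, s, hs, hsu⟩))
    have h3 : b * ρ (⋃ t ∈ W, cyl t) ≤ a * μ (⋃ t ∈ W, cyl t) :=
      measure_biUnion_cyl_le (μ := b • ρ) (ν := a • μ) fun t ht => hL t ht.1
    have h4 : μ (⋃ t ∈ W, cyl t) ≤ μ (⋃ t ∈ alternations L H k, cyl t) := by
      refine measure_mono (iUnion₂_subset fun t ht => ?_)
      obtain ⟨-, s, hs, hst⟩ := ht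
      exact (cyl_subset_cyl hst).trans (subset_biUnion_of_mem (u := cyl) hs)
    calc (b * c) ^ (k + 1) * μ (⋃ t ∈ alternations L H (k + 1), cyl t)
        = (b * c) ^ k * b * (c * μ (⋃ t ∈ alternations L H (k + 1), cyl t)) := by ring
      _ ≤ (b * c) ^ k * b * (d * ρ (⋃ t ∈ W, cyl t)) := by
        gcongr (b * c) ^ k * b * ?_
        exact h1.trans (by gcongr)
      _ = (b * c) ^ k * d * (b * ρ (⋃ t ∈ W, cyl t)) := by ring
      _ ≤ (b * c) ^ k * d * (a * μ (⋃ t ∈ alternations L H k, cyl t)) := by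
        gcongr (b * c) ^ k * d * ?_
        exact h3.trans (by gcongr)
      _ = (a * d) * ((b * c) ^ k * μ (⋃ t ∈ alternations L H k, cyl t)) := by ring
      _ ≤ (a * d) * ((a * d) ^ k * μ univ) := by gcongr
      _ = (a * d) ^ (k + 1) * μ univ := by ring

/-- Along a random sequence, the conditional probabilities do not oscillate. -/
theorem not_frequently_alternating (hP : ComputableReal fun s => P.real (cyl₂ s)) {y : Cantor}
    (hy : y ∈ MLR P.snd) (x : Str) {a b c d : ℕ} (h : a * d < b * c) :
    ¬ ((∃ᶠ n in atTop, (b : ℝ) * P.real (cyl₂ (x, pre y n)) < a * P.real (cyl₂ ([], pre y n))) ∧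
      ∃ᶠ n in atTop, (c : ℝ) * P.real (cyl₂ ([], pre y n)) < d * P.real (cyl₂ (x, pre y n))) := by
  rintro ⟨h1, h2⟩
  let L : Str → Prop := fun t => (b : ℝ) * P.real (cyl₂ (x, t)) < a * P.real (cyl₂ ([], t))
  let H : Str → Prop := fun t => (c : ℝ) * P.real (cyl₂ ([], t)) < d * P.real (cyl₂ (x, t))
  have hc : ∀ (s : Str) (n : ℕ), ComputableReal fun t => (n : ℝ) * P.real (cyl₂ (s, t)) :=
    fun s n => ComputableReal.natCast_mul (f := fun _ => n) (Computable.const n)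
      (hP.comp (f := fun t : Str => (s, t)) (Computable.pair (Computable.const s) Computable.id))
  have hre := alternations_re (L := L) (H := H) ((hc x b).lt_re (hc [] a))
    ((hc [] c).lt_re (hc x d))
  have hle : ∀ k, ((b * c : ℕ) : ℝ≥0∞) ^ k * P.snd (⋃ t ∈ alternations L H k, cyl t) ≤
      ((a * d : ℕ) : ℝ≥0∞) ^ k * P.snd univ := by
    intro k
    push_cast
    refine measure_alternations_le (ρ := cut P (cyl x)) (fun t ht => ?_) (fun t ht => ?_) k
    · rw [cut_cyl, snd_cyl]
      exact natCast_mul_measureReal_le_iff.1 (le_of_lt ht)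
    · rw [cut_cyl, snd_cyl]
      exact natCast_mul_measureReal_le_iff.1 (le_of_lt ht)
  have hbc0 : ((b * c : ℕ) : ℝ≥0∞) ≠ 0 := by
    rw [Nat.cast_ne_zero]
    omega
  have hr : ((a * d : ℕ) : ℝ≥0∞) / (b * c : ℕ) < 1 := by
    rw [ENNReal.div_lt_iff (Or.inl hbc0) (Or.inl (ENNReal.natCast_ne_top _)), one_mul]
    exact_mod_cast h
  -- As `j` alternations reduce the measure by more than half, layer n consists of the strings with
  -- `j * n` alternations.
  obtain ⟨j, hj⟩ : ∃ j : ℕ, (((a * d : ℕ) : ℝ≥0∞) / (b * c : ℕ)) ^ j < 2⁻¹ :=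
    ((ENNReal.tendsto_pow_atTop_nhds_zero_of_lt_one hr).eventually_lt_const (by simp)).exists
  have hmem : ∀ k, ∃ n, pre y n ∈ alternations L H k := by
    intro k
    induction k with
    | zero => exact ⟨0, trivial⟩
    | succ k ih =>
      obtain ⟨n, hn⟩ := ih
      obtain ⟨m, hm, hL⟩ := frequently_atTop.1 h1 n
      obtain ⟨l, hl, hH⟩ := frequently_atTop.1 h2 m
      exact ⟨l, pre y n, hn, ⟨pre y m, pre_prefix_pre y hm, pre_prefix_pre y hl, hL⟩, hH⟩
  refine notMem_mlRandomIn (U := {p : Str × ℕ | p.1 ∈ alternations L H (j * p.2)})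
    (C := P.snd univ) (μ := P.snd) (B := cyl)
    (hre.comp (Computable.pair Computable.fst (computable_mul (Computable.const j)
      Computable.snd))) (measure_ne_top _ _) (fun n => ?_) (Frequently.of_forall fun n => ?_) hy
  · have e : layer cyl {p : Str × ℕ | p.1 ∈ alternations L H (j * p.2)} n =
        ⋃ t ∈ alternations L H (j * n), cyl t := rfl
    rw [e]
    have h3 := hle (j * n)
    have h4 : P.snd (⋃ t ∈ alternations L H (j * n), cyl t) ≤
        ((((a * d : ℕ) : ℝ≥0∞) / (b * c : ℕ)) ^ j) ^ n * P.snd univ := by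
      rw [← pow_mul, div_eq_mul_inv, mul_pow, ← ENNReal.inv_pow, mul_right_comm, ← div_eq_mul_inv,
        ENNReal.le_div_iff_mul_le (Or.inl (pow_ne_zero _ hbc0))
          (Or.inl (ENNReal.pow_ne_top (ENNReal.natCast_ne_top _))), mul_comm]
      exact h3
    refine h4.trans ?_
    rw [mul_comm]
    gcongr
  · obtain ⟨k, hk⟩ := hmem (j * n)
    exact mem_layer.2 ⟨_, hk, mem_cyl_pre y k⟩

/-- A bounded sequence that does not cross any rational interval infinitely often converges.
Numerators and denominators of the endpoints are the integers for the alternation bound. -/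
theorem exists_tendsto_condStr (hP : ComputableReal fun s => P.real (cyl₂ s)) {y : Cantor}
    (hy : y ∈ MLR P.snd) (x : Str) :
    ∃ L, Tendsto (fun n => condStr P (pre y n) (cyl x)) atTop (𝓝 L) := by
  have hreal : ∀ n, (condStr P (pre y n)).real (cyl x) =
      P.real (cyl₂ (x, pre y n)) / P.real (cyl₂ ([], pre y n)) := by
    intro n
    rw [measureReal_def, condStr_apply, slice_cyl, snd_cyl, ENNReal.toReal_mul, ENNReal.toReal_inv,
      measureReal_def, measureReal_def, mul_comm]
    rfl
  have hpos : ∀ n, 0 < P.real (cyl₂ ([], pre y n)) := by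
    intro n
    rw [measureReal_def, ENNReal.toReal_pos_iff]
    exact ⟨pos_iff_ne_zero.2 (snd_cyl P _ ▸ snd_cyl_ne_zero hy n), measure_lt_top _ _⟩
  have hle : ∀ n, (condStr P (pre y n)).real (cyl x) ≤ 1 := fun n => by
    rw [measureReal_def]
    exact ENNReal.toReal_le_of_le_ofReal zero_le_one (by simpa using condStr_cyl_le_one P x _)
  obtain ⟨l, hl⟩ := tendsto_of_no_upcrossings (f := atTop)
    (u := fun n => (condStr P (pre y n)).real (cyl x)) (s := Set.range ((↑) : ℚ → ℝ))
    Rat.denseRange_cast (by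
      rintro _ ⟨a, rfl⟩ _ ⟨b, rfl⟩ hab ⟨h1, h2⟩
      have hab' : a < b := by exact_mod_cast hab
      have ha : 0 < a := by
        obtain ⟨n, hn⟩ := h1.exists
        have : (0 : ℝ) < a := lt_of_le_of_lt measureReal_nonneg hn
        exact_mod_cast this
      have hnum : ∀ q : ℚ, 0 < q → (q : ℝ) = (q.num.toNat : ℝ) / (q.den : ℝ) := by
        intro q hq
        have h3 : ((q.num.toNat : ℕ) : ℤ) = q.num := Int.toNat_of_nonneg (Rat.num_nonneg.2 hq.le)
        have h4 : ((q.num.toNat : ℕ) : ℝ) = (q.num : ℝ) := by exact_mod_cast h3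
        rw [h4]
        exact Rat.cast_def q
      have hda : (0 : ℝ) < a.den := by exact_mod_cast a.den_pos
      have hdb : (0 : ℝ) < b.den := by exact_mod_cast b.den_pos
      rw [hnum a ha] at h1 hab
      rw [hnum b (ha.trans hab')] at h2 hab
      refine not_frequently_alternating hP hy x (a := a.num.toNat) (b := a.den)
        (c := b.num.toNat) (d := b.den) ?_ ⟨h1.mono fun n hn => ?_, h2.mono fun n hn => ?_⟩
      · rw [div_lt_div_iff₀ hda hdb] at hab
        have : a.num.toNat * b.den < b.num.toNat * a.den := by exact_mod_cast hab
        rwa [mul_comm a.den]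
      · rw [hreal, div_lt_div_iff₀ (hpos n) hda] at hn
        linarith
      · rw [hreal, div_lt_div_iff₀ hdb (hpos n)] at hn
        linarith)
    (isBoundedUnder_of ⟨1, hle⟩) (isBoundedUnder_of ⟨0, fun n => measureReal_nonneg⟩)
  refine ⟨ENNReal.ofReal l, (ENNReal.tendsto_ofReal hl).congr fun n => ?_⟩
  exact ENNReal.ofReal_toReal (ne_top_of_le_ne_top (by simp) (condStr_cyl_le_one P x _))

/-- Probabilities on a compact space form a compact space, so the conditional measures have a limit
along an ultrafilter. Cylinders are clopen, so its values there are the limits already known to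
exist. -/
theorem isCondAt_condAt (hP : ComputableReal fun s => P.real (cyl₂ s)) {y : Cantor}
    (hy : y ∈ MLR P.snd) : IsCondAt P y (condAt P y) := by
  have hex : ∃ Q, IsCondAt P y Q := by
    choose L hL using exists_tendsto_condStr hP hy
    let u : ℕ → ProbabilityMeasure Cantor := fun n =>
      ⟨condStr P (pre y n), isProbabilityMeasure_condStr P (snd_cyl_ne_zero hy n)⟩
    let F : Ultrafilter ℕ := Ultrafilter.of atTop
    obtain ⟨Q, -, hQ⟩ := isCompact_univ.ultrafilter_le_nhds (F.map u) (by simp)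
    refine ⟨Q, inferInstance, fun x => ?_⟩
    have h1 : Tendsto (fun n => (u n : Measure Cantor) (cyl x))
        F (𝓝 ((Q : Measure Cantor) (cyl x))) :=
      ProbabilityMeasure.tendsto_measure_of_null_frontier_of_tendsto' (μs := u) hQ
        (by rw [(isClopen_cyl x).frontier_eq, measure_empty])
    have h2 : Tendsto (fun n => (u n : Measure Cantor) (cyl x)) F (𝓝 (L x)) :=
      (hL x).mono_left (Ultrafilter.of_le atTop)
    rw [tendsto_nhds_unique h1 h2]
    exact hL x
  rw [condAt, dif_pos hex]
  exact hex.choose_spec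

end Convergence

/-! ### The inclusions of part (a). -/

section Inclusion

theorem measure_pre_eq_sum (μ : Measure Cantor) (p : Str → Prop) [DecidablePred p] (n : ℕ) :
    μ {x | p (pre x n)} = ∑ w ∈ (strings n).toFinset.filter p, μ (cyl w) := by
  have h : {x | p (pre x n)} = ⋃ w ∈ (strings n).toFinset.filter p, cyl w := by
    ext x
    simp only [Set.mem_ofPred_eq, mem_iUnion, Finset.mem_filter, List.mem_toFinset, mem_strings,
      exists_prop]
    constructor
    · exact fun h => ⟨pre x n, ⟨by simp, h⟩, mem_cyl_pre x n⟩
    · rintro ⟨w, ⟨rfl, hw⟩, hx⟩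
      rwa [mem_cyl_iff.1 hx]
  rw [h, measure_biUnion_finset]
  · intro w hw v hv hwv
    simp only [Finset.coe_filter, List.mem_toFinset, Set.mem_ofPred_eq, mem_strings] at hw hv
    rw [Function.onFun, Set.disjoint_left]
    intro x h1 h2
    apply hwv
    rw [← mem_cyl_iff.1 h1, ← mem_cyl_iff.1 h2, hw.1, hv.1]
  · exact fun w _ => measurableSet_cyl w

theorem iUnion_pre_eq {A : Set Cantor} (hA : IsOpen A) : A = ⋃ n, {x | cyl (pre x n) ⊆ A} := by
  ext x
  simp only [mem_iUnion, Set.mem_ofPred_eq]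
  exact ⟨fun h => exists_cyl_pre_subset hA h, fun ⟨n, hn⟩ => hn (mem_cyl_pre x n)⟩

theorem monotone_setOf_cyl_pre_subset (A : Set Cantor) :
    Monotone fun n => {x | cyl (pre x n) ⊆ A} := fun _ _ h x hx =>
  (cyl_subset_cyl (pre_prefix_pre x h)).trans hx

theorem isOpen_layer (U : Set (Str × ℕ)) (n : ℕ) : IsOpen (layer cyl U n) :=
  isOpen_biUnion fun s _ => (isClopen_cyl s).2

variable {P : Measure (Cantor × Cantor)} [IsFiniteMeasure P] {y : Cantor} {Q : Measure Cantor}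

omit [IsFiniteMeasure P] in
theorem IsCondAt.tendsto_pre (h : IsCondAt P y Q) (p : Str → Prop) (m : ℕ) :
    Tendsto (fun n => condStr P (pre y n) {x | p (pre x m)}) atTop (𝓝 (Q {x | p (pre x m)})) := by
  classical
  simp only [measure_pre_eq_sum]
  exact tendsto_finsetSum _ fun w _ => h.2 w

omit [IsFiniteMeasure P] in
-- An open set is the increasing union of the clopen sets of points whose cylinder at level m lies
-- inside it, and on these the measures converge.
theorem IsCondAt.open_le (h : IsCondAt P y Q) {A : Set Cantor} (hA : IsOpen A) {c : ℝ≥0∞}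
    (hc : ∀ᶠ n in atTop, condStr P (pre y n) A ≤ c) : Q A ≤ c := by
  rw [iUnion_pre_eq hA, (monotone_setOf_cyl_pre_subset A).measure_iUnion]
  refine iSup_le fun m => ?_
  refine le_of_tendsto (h.tendsto_pre (fun w => cyl w ⊆ A) m) (hc.mono fun n hn => ?_)
  refine (measure_mono fun x hx => ?_).trans hn
  exact hx (mem_cyl_pre x m)

/-- The strings `t` such that `P (layer × Δ(t))` is large compared to `P_Y (Δ(t))` form a
recursively enumerable set. -/
theorem slice_layer_large_re (hP : ComputableReal fun s => P.real (cyl₂ s)) {U : Set (Str × ℕ)}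
    (hU : REPred fun p => p ∈ U) :
    REPred fun z : Str × ℕ => P.snd (cyl z.1) < 2 ^ z.2 * slice P z.1 (layer cyl U (2 * z.2)) := by
  obtain ⟨cov, hcov, hmono, hsound, hcomplete, -⟩ := exists_computable_cover
    (U := fun x : (Str × Str) × ℕ => (x.1.1, x.2) ∈ U)
    (hU.comp (Computable.pair (Computable.fst.comp Computable.fst) Computable.snd))
  have hc : ComputableReal fun z : (Str × ℕ) × ℕ =>
      P.real {ω | (cov (2 * z.1.2) (pre ω.1 z.2) [] &&
        decide (z.1.1 = pre ω.2 z.1.1.length)) = true} :=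
    computableReal_pre hP (cov := fun (z : (Str × ℕ) × ℕ) w t =>
      cov (2 * z.1.2) w [] && decide (z.1.1 = t)) (m := fun z => z.2) (n := fun z => z.1.1.length)
      (computable_and (hcov.comp (g := fun z : ((Str × ℕ) × ℕ) × Str × Str =>
        (2 * z.1.1.2, z.2.1, ([] : Str))) (Computable.pair (computable_mul (Computable.const 2)
          (Computable.snd.comp (Computable.fst.comp Computable.fst)))
          (Computable.pair (Computable.fst.comp Computable.snd) (Computable.const []))))
        (computable_decide_eq (Computable.fst.comp (Computable.fst.comp Computable.fst))
          (Computable.snd.comp Computable.snd)))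
      Computable.snd (Computable.list_length.comp (Computable.fst.comp Computable.fst))
  have hlt : REPred fun z : (Str × ℕ) × ℕ => ((1 : ℕ) : ℝ) * P.real (cyl₂ ([], z.1.1)) <
      ((2 ^ z.1.2 : ℕ) : ℝ) * P.real {ω | (cov (2 * z.1.2) (pre ω.1 z.2) [] &&
        decide (z.1.1 = pre ω.2 z.1.1.length)) = true} := by
    refine ComputableReal.lt_re ?_ ?_
    · exact ComputableReal.natCast_mul (f := fun _ => 1) (Computable.const 1)
        (hP.comp (f := fun z : (Str × ℕ) × ℕ => (([] : Str), z.1.1))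
          (Computable.pair (Computable.const []) (Computable.fst.comp Computable.fst)))
    · exact ComputableReal.natCast_mul (f := fun z : (Str × ℕ) × ℕ => 2 ^ z.1.2)
        (computable_two_pow (Computable.snd.comp Computable.fst)) hc
  -- The measure of an open layer is the supremum over its clopen stages, so a strict lower bound is
  -- confirmed at some stage.
  refine hlt.exists.of_eq fun z => ?_
  let E : ℕ → Set Cantor := fun n => {x | cov (2 * z.2) (pre x n) [] = true}
  have hE : Monotone E := fun i j hij x hx => hmono _ _ _ _ _ (pre_prefix_pre x hij)
    (List.prefix_refl _) hx
  have hEU : layer cyl U (2 * z.2) = ⋃ n, E n := by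
    ext x
    simp only [mem_layer, mem_iUnion]
    constructor
    · rintro ⟨s, hs, hx⟩
      obtain ⟨N, hN⟩ := hcomplete (2 * z.2) s [] hs
      exact ⟨s.length + N, hN _ _ (prefix_pre_iff.2 ⟨by omega, hx⟩) (List.prefix_refl _)
        (by rw [length_pre]; omega)⟩
    · rintro ⟨n, hn⟩
      obtain ⟨a, a', h1, -, h2⟩ := hsound _ _ _ hn
      exact ⟨a, h2, (prefix_pre_iff.1 h1).2⟩
  have hEz : ∀ n, P {ω | (cov (2 * z.2) (pre ω.1 n) [] &&
        decide (z.1 = pre ω.2 z.1.length)) = true} = slice P z.1 (E n) := by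
    intro n
    have hm : MeasurableSet (E n) := measurableSet_pre (fun w => cov (2 * z.2) w [] = true) n
    rw [slice_apply P _ hm]
    congr 1
    ext ω
    simp only [Set.mem_ofPred_eq, Bool.and_eq_true, decide_eq_true_eq, mem_prod, mem_cyl_iff, E,
      eq_comm (a := z.1)]
  simp only [natCast_mul_measureReal_lt_iff, hEz, ← snd_cyl]
  rw [hEU, hE.measure_iUnion, ENNReal.mul_iSup, lt_iSup_iff]
  push_cast
  simp only [one_mul]

theorem mlr_condAt_subset (hP : ComputableReal fun s => P.real (cyl₂ s)) (hy : y ∈ MLR P.snd) :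
    MLR (condAt P y) ⊆ prefixInter P y := by
  have hcond := isCondAt_condAt hP hy
  intro x hx
  refine mem_iInter.2 fun k => mem_mlRandomIn.2 fun U hU => ?_
  by_contra! hxU
  set s := pre y k with hs
  have hUre := (reIn_empty _).1 hU.re
  -- These are the extensions of `s` at which layer 2m of `U` has conditional measure above 2^(-m).
  -- The index 2m leaves the factor 2^m · 2^(-2m) = 2^(-m) for the P_Y-measure of these strings.
  let H : Set (Str × ℕ) := {z | s <+: z.1 ∧
    P.snd (cyl z.1) < 2 ^ z.2 * slice P z.1 (layer cyl U (2 * z.2))}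
  have hH : REPred fun z => z ∈ H := by
    refine REPred.and ?_ (slice_layer_large_re hP hUre)
    refine (REPred.of_bool (computable_isPrefix (Computable.const s) Computable.fst)).of_eq
      fun z => ?_
    simp
  have hmeas : ∀ m, MeasurableSet (layer cyl U m) := measurableSet_layer measurableSet_cyl U
  have hHm : ∀ m, P.snd (layer cyl H m) ≤ P.snd (cyl s) * 2⁻¹ ^ m := by
    intro m
    have h1 : P.snd (layer cyl H m) ≤ (2 ^ m • cut P (layer cyl U (2 * m))) (layer cyl H m) := by
      refine measure_biUnion_cyl_le fun t ht => ?_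
      have h2 := ht.2.le
      rw [slice_apply P _ (hmeas _), ← cut_apply P _ (measurableSet_cyl t)] at h2
      simpa using h2
    refine h1.trans ?_
    have h3 : cut P (layer cyl U (2 * m)) (layer cyl H m) ≤ cut P (layer cyl U (2 * m)) (cyl s) :=
      measure_mono (iUnion₂_subset fun t ht => cyl_subset_cyl ht.1)
    rw [cut_apply P _ (measurableSet_cyl s), ← slice_apply P _ (hmeas _),
      ← mul_condStr_apply] at h3
    calc (2 ^ m • cut P (layer cyl U (2 * m))) (layer cyl H m)
        = 2 ^ m * cut P (layer cyl U (2 * m)) (layer cyl H m) := by simp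
      _ ≤ 2 ^ m * (P.snd (cyl s) * 2⁻¹ ^ (2 * m)) := by
        gcongr
        refine h3.trans ?_
        gcongr
        exact (hU.small _).le
      _ = P.snd (cyl s) * 2⁻¹ ^ m * (2 ^ m * 2⁻¹ ^ m) := by ring
      _ = P.snd (cyl s) * 2⁻¹ ^ m := by
        rw [← mul_pow, ENNReal.mul_inv_cancel (by simp) (by simp), one_pow, mul_one]
  have hev : ∀ᶠ m in atTop, y ∉ layer cyl H m := by
    by_contra hc
    exact notMem_mlRandomIn hH (measure_ne_top _ _) hHm
      (by simpa only [not_eventually, not_not] using hc) hy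
  obtain ⟨m₀, hm₀⟩ := eventually_atTop.1 hev
  have hle : ∀ m, m₀ ≤ m → condAt P y (layer cyl U (2 * m)) ≤ 2⁻¹ ^ m := by
    intro m hm
    refine hcond.open_le (isOpen_layer U _) (eventually_atTop.2 ⟨k, fun n hn => ?_⟩)
    have h1 : ¬ P.snd (cyl (pre y n)) < 2 ^ m * slice P (pre y n) (layer cyl U (2 * m)) :=
      fun h => hm₀ m hm (mem_layer.2 ⟨pre y n, ⟨pre_prefix_pre y hn, h⟩, mem_cyl_pre y n⟩)
    have h2 := not_lt.1 h1
    have h0 := snd_cyl_ne_zero hy n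
    rw [← mul_condStr_apply] at h2
    calc condStr P (pre y n) (layer cyl U (2 * m))
        = 2⁻¹ ^ m * ((P.snd (cyl (pre y n)))⁻¹ * (2 ^ m * (P.snd (cyl (pre y n)) *
          condStr P (pre y n) (layer cyl U (2 * m))))) := by
          have e : ∀ a b c d e : ℝ≥0∞, a * (b * (c * (d * e))) = (c * a) * (d * b) * e := by
            intros; ring
          rw [e, ← mul_pow, ENNReal.mul_inv_cancel (by simp) (by simp),
            ENNReal.mul_inv_cancel h0 (measure_ne_top _ _), one_pow, one_mul, one_mul]
      _ ≤ 2⁻¹ ^ m * ((P.snd (cyl (pre y n)))⁻¹ * P.snd (cyl (pre y n))) := by gcongr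
      _ = 2⁻¹ ^ m := by rw [ENNReal.inv_mul_cancel h0 (measure_ne_top _ _), mul_one]
  -- From `m₀` on, the even layers of `U` are small for all conditional measures along y beyond `k`,
  -- hence for the limit; shifted by `m₀` they form a test for it.
  refine notMem_mlRandomIn (U := {z : Str × ℕ | (z.1, 2 * (z.2 + m₀)) ∈ U}) (C := 1)
    (B := cyl) (μ := condAt P y) ?_ (by simp) (fun n => ?_) (Frequently.of_forall fun n => ?_) hx
  · exact hUre.comp (Computable.pair Computable.fst (computable_mul (Computable.const 2)
      (computable_add Computable.snd (Computable.const m₀))))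
  · have e : layer cyl {z : Str × ℕ | (z.1, 2 * (z.2 + m₀)) ∈ U} n =
      layer cyl U (2 * (n + m₀)) := rfl
    rw [e, one_mul]
    refine (hle _ (by omega)).trans ?_
    exact pow_le_pow_of_le_one (by simp) (by simp) (by omega)
  · exact hxU (2 * (n + m₀))

theorem mlrSection_subset (y : Cantor) : mlrSection P y ⊆ prefixInter P y := fun _ hx =>
  mem_iInter.2 fun n => mlr₂_mem_condStr hx n

end Inclusion

/-! ### Singular conditional measures have disjoint random sets. -/

section Singular

/-- The total overlap of two measures at the strings of length `n`. -/
noncomputable def overlap (μ ν : Measure Cantor) (n : ℕ) : ℝ≥0∞ :=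
  ∑ w ∈ (strings n).toFinset, min (μ (cyl w)) (ν (cyl w))

theorem overlap_comm (μ ν : Measure Cantor) (n : ℕ) : overlap μ ν n = overlap ν μ n := by
  simp only [overlap, min_comm]

theorem overlap_ne_top (μ ν : Measure Cantor) [IsFiniteMeasure μ] (n : ℕ) : overlap μ ν n ≠ ⊤ :=
  (ENNReal.sum_lt_top.2 fun w _ => (min_le_left _ _).trans_lt (measure_lt_top μ (cyl w))).ne

theorem toReal_overlap (μ ν : Measure Cantor) [IsFiniteMeasure μ] [IsFiniteMeasure ν] (n : ℕ) :
    (overlap μ ν n).toReal =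
      ((strings n).map fun w => min (μ.real (cyl w)) (ν.real (cyl w))).sum := by
  rw [overlap, ENNReal.toReal_sum fun w _ =>
    ((min_le_left _ _).trans_lt (measure_lt_top μ (cyl w))).ne,
    ← List.sum_toFinset _ (nodup_strings n)]
  refine Finset.sum_congr rfl fun w _ => ?_
  rw [ENNReal.toReal_min (measure_ne_top _ _) (measure_ne_top _ _)]
  rfl

/-- A μ-null set carrying ν lies in an open set of small μ-measure, which is exhausted by clopen
sets. One of them has small μ-measure and a complement of small ν-measure, and at its level the
overlap is at most the sum of the two. -/
theorem exists_overlap_lt {μ ν : Measure Cantor} [IsFiniteMeasure μ] [IsFiniteMeasure ν]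
    (h : μ.MutuallySingular ν) {ε : ℝ≥0∞} (hε : ε ≠ 0) : ∃ n, overlap μ ν n < ε := by
  classical
  obtain ⟨S, hS, hμ, hν⟩ := h
  obtain ⟨O, hSO, hO, hμO⟩ := S.exists_isOpen_lt_of_lt (μ := μ) (ε / 2)
    (by rw [hμ]; exact ENNReal.half_pos hε)
  let A : ℕ → Set Cantor := fun n => {x | cyl (pre x n) ⊆ O}
  have hAm : ∀ n, MeasurableSet (A n) := measurableSet_pre fun w => cyl w ⊆ O
  have hlim : Tendsto (fun n => ν (A n)ᶜ) atTop (𝓝 (ν (⋂ n, (A n)ᶜ))) :=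
    tendsto_measure_iInter_atTop (fun n => (hAm n).compl.nullMeasurableSet)
      (fun i j hij => compl_subset_compl.2 (monotone_setOf_cyl_pre_subset O hij))
      ⟨0, measure_ne_top _ _⟩
  have h0 : ν (⋂ n, (A n)ᶜ) = 0 := by
    rw [← compl_iUnion, ← iUnion_pre_eq hO]
    exact measure_mono_null (compl_subset_compl.2 hSO) hν
  rw [h0] at hlim
  obtain ⟨n, hn⟩ := (hlim.eventually_lt_const (ENNReal.half_pos hε)).exists
  refine ⟨n, ?_⟩
  have hA : μ (A n) ≤ μ O := measure_mono fun x hx => hx (mem_cyl_pre x n)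
  have e2 : (A n)ᶜ = {x | ¬ cyl (pre x n) ⊆ O} := rfl
  rw [e2, measure_pre_eq_sum ν (fun w => ¬ cyl w ⊆ O)] at hn
  rw [measure_pre_eq_sum μ (fun w => cyl w ⊆ O)] at hA
  rw [overlap, ← Finset.sum_filter_add_sum_filter_not _ (fun w => cyl w ⊆ O)]
  calc _ ≤ ∑ w ∈ (strings n).toFinset.filter (fun w => cyl w ⊆ O), μ (cyl w) +
        ∑ w ∈ (strings n).toFinset.filter (fun w => ¬ cyl w ⊆ O), ν (cyl w) := by
        gcongr
        · exact min_le_left _ _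
        · exact min_le_right _ _
    _ < ε / 2 + ε / 2 := ENNReal.add_lt_add (hA.trans_lt hμO) hn
    _ = ε := ENNReal.add_halves ε

variable {P : Measure (Cantor × Cantor)} [IsFiniteMeasure P]

/-- The strings at which the conditional measure given `s` does not dominate the one given `t`, at
levels where the two have a small overlap. -/
def overlapTest (P : Measure (Cantor × Cantor)) (s t : Str) : Set (Str × ℕ) :=
  {z | overlap (slice P s) (slice P t) z.1.length < 2⁻¹ ^ z.2 ∧
    slice P s (cyl z.1) < 2 * slice P t (cyl z.1)}

theorem overlapTest_re (hP : ComputableReal fun s => P.real (cyl₂ s)) (s t : Str) :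
    REPred fun z => z ∈ overlapTest P s t := by
  have hc : ∀ (t : Str), ComputableReal fun w => P.real (cyl₂ (w, t)) := fun t =>
    hP.comp (f := fun w : Str => (w, t)) (Computable.pair Computable.id (Computable.const t))
  have hs : ComputableReal fun z : Str × ℕ => ((strings z.1.length).map fun w =>
      min (P.real (cyl₂ (w, s))) (P.real (cyl₂ (w, t)))).sum :=
    ComputableReal.list_sum (r := fun x : (Str × ℕ) × Str =>
      min (P.real (cyl₂ (x.2, s))) (P.real (cyl₂ (x.2, t))))
      (((hc s).comp Computable.snd).min ((hc t).comp Computable.snd))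
      (computable_strings (Computable.list_length.comp Computable.fst))
  have h1 := (ComputableReal.natCast_mul (f := fun z : Str × ℕ => 2 ^ z.2)
    (computable_two_pow Computable.snd) hs).lt_re
      (ComputableReal.natCast (f := fun _ : Str × ℕ => 1) (Computable.const 1))
  have h2 := (ComputableReal.natCast_mul (f := fun _ : Str × ℕ => 1) (Computable.const 1)
    ((hc s).comp Computable.fst)).lt_re (ComputableReal.natCast_mul (f := fun _ : Str × ℕ => 2)
      (Computable.const 2) ((hc t).comp Computable.fst))
  refine (h1.and h2).of_eq fun z => and_congr ?_ ?_
  · have e : ∀ w t, P.real (cyl₂ (w, t)) = (slice P t).real (cyl w) := fun w t => by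
      rw [measureReal_def, measureReal_def, slice_cyl]
    simp only [e, ← toReal_overlap]
    have e2 : ((2 : ℝ≥0∞)⁻¹ ^ z.2) = ENNReal.ofReal ((2 ^ z.2)⁻¹) := by
      rw [ENNReal.ofReal_inv_of_pos (by positivity), ENNReal.ofReal_pow (by norm_num),
        ENNReal.inv_pow]
      simp
    rw [e2, ENNReal.lt_ofReal_iff_toReal_lt (overlap_ne_top _ _ _), Nat.cast_pow, Nat.cast_ofNat,
      Nat.cast_one, ← one_div, lt_div_iff₀' (by positivity)]
  · rw [natCast_mul_measureReal_lt_iff, slice_cyl, slice_cyl]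
    simp

omit [IsFiniteMeasure P] in
-- Let m be the first level with overlap below 2^(-n). All strings of the layer have length at least
-- m. Above a string u of length m, the part of the layer has μ-measure at most μ(Δ(u)) and, by the
-- domination condition, at most 2ν(Δ(u)). Summing over u gives twice the overlap.
theorem slice_overlapTest_le (s t : Str) (n : ℕ) :
    slice P s (layer cyl (overlapTest P s t) n) ≤ 2 * 2⁻¹ ^ n := by
  set μ := slice P s
  set ν := slice P t
  by_cases hex : ∃ m, overlap μ ν m < 2⁻¹ ^ n
  · classical
    set m := Nat.find hex
    let T : Str → Set Str := fun u => {w | (w, n) ∈ overlapTest P s t ∧ u <+: w}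
    have hsub : layer cyl (overlapTest P s t) n ⊆
        ⋃ u ∈ (strings m).toFinset, ⋃ w ∈ T u, cyl w := by
      intro x hx
      obtain ⟨w, hw, hxw⟩ := mem_layer.1 hx
      have hm : m ≤ w.length := Nat.find_min' hex hw.1
      refine mem_biUnion (x := pre x m) (by simp [mem_strings]) (mem_biUnion (x := w) ⟨hw, ?_⟩ hxw)
      rw [← mem_cyl_iff.1 hxw]
      exact pre_prefix_pre x hm
    have hle : ∀ u, μ (⋃ w ∈ T u, cyl w) ≤ 2 * min (μ (cyl u)) (ν (cyl u)) := by
      intro u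
      have hTu : ⋃ w ∈ T u, cyl w ⊆ cyl u := iUnion₂_subset fun w hw => cyl_subset_cyl hw.2
      have h1 : μ (⋃ w ∈ T u, cyl w) ≤ ((2 : ℝ≥0∞) • ν) (⋃ w ∈ T u, cyl w) :=
        measure_biUnion_cyl_le fun w hw => hw.1.2.le
      rcases le_total (μ (cyl u)) (ν (cyl u)) with h | h
      · rw [min_eq_left h]
        exact (measure_mono hTu).trans (le_mul_of_one_le_left (zero_le) (by norm_num))
      · rw [min_eq_right h]
        refine h1.trans ?_
        rw [Measure.smul_apply, smul_eq_mul]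
        gcongr
    calc μ (layer cyl (overlapTest P s t) n)
        ≤ ∑ u ∈ (strings m).toFinset, μ (⋃ w ∈ T u, cyl w) :=
          (measure_mono hsub).trans (measure_biUnion_finset_le _ _)
      _ ≤ ∑ u ∈ (strings m).toFinset, 2 * min (μ (cyl u)) (ν (cyl u)) :=
          Finset.sum_le_sum fun u _ => hle u
      _ = 2 * overlap μ ν m := by rw [overlap, Finset.mul_sum]
      _ ≤ 2 * 2⁻¹ ^ n := by
        gcongr
        exact (Nat.find_spec hex).le
  · have : layer cyl (overlapTest P s t) n = ∅ := by
      ext x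
      simp only [mem_layer, mem_empty_iff_false, iff_false]
      rintro ⟨w, hw, -⟩
      exact hex ⟨_, hw.1⟩
    rw [this, measure_empty]
    exact zero_le

theorem eventually_notMem_overlapTest (hP : ComputableReal fun s => P.real (cyl₂ s)) {s : Str}
    (hs : P.snd (cyl s) ≠ 0) (t : Str) {x : Cantor} (hx : x ∈ MLR (condStr P s)) :
    ∀ᶠ n in atTop, x ∉ layer cyl (overlapTest P s t) n := by
  by_contra hc
  refine notMem_mlRandomIn (C := (P.snd (cyl s))⁻¹ * 2) (overlapTest_re hP s t)
    (ENNReal.mul_ne_top (ENNReal.inv_ne_top.2 hs) (by simp)) (fun n => ?_)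
    (by simpa only [not_eventually, not_not] using hc) hx
  rw [condStr_apply, mul_assoc]
  gcongr
  exact slice_overlapTest_le s t n

theorem slice_mutuallySingular {s t : Str} (h : (condStr P s).MutuallySingular (condStr P t)) :
    (slice P s).MutuallySingular (slice P t) := by
  have e : ∀ s, slice P s = P.snd (cyl s) • condStr P s := fun s => by
    ext A -
    rw [Measure.smul_apply, smul_eq_mul, mul_condStr_apply]
  rw [e s, e t]
  exact ((h.smul _).symm.smul _).symm

theorem mlr_condStr_inter_eq_empty (hP : ComputableReal fun s => P.real (cyl₂ s)) {s t : Str}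
    (hs : P.snd (cyl s) ≠ 0) (ht : P.snd (cyl t) ≠ 0)
    (h : (condStr P s).MutuallySingular (condStr P t)) :
    MLR (condStr P s) ∩ MLR (condStr P t) = ∅ := by
  rw [eq_empty_iff_forall_notMem]
  rintro x ⟨hxs, hxt⟩
  obtain ⟨n, h1, h2⟩ := ((eventually_notMem_overlapTest hP hs t hxs).and
    (eventually_notMem_overlapTest hP ht s hxt)).exists
  obtain ⟨m, hm⟩ := exists_overlap_lt (slice_mutuallySingular h) (ε := 2⁻¹ ^ n)
    (pow_ne_zero _ (by simp))
  -- The factor 2 makes the two strict conditions exhaustive: if the first one fails at a prefix of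
  -- `x`, the second holds, since random points lie only in cylinders of positive measure.
  rcases lt_or_ge (slice P s (cyl (pre x m))) (2 * slice P t (cyl (pre x m))) with h3 | h3
  · exact h1 (mem_layer.2 ⟨pre x m, ⟨by rwa [length_pre], h3⟩, mem_cyl_pre x m⟩)
  · refine h2 (mem_layer.2 ⟨pre x m, ⟨by rwa [length_pre, overlap_comm], ?_⟩, mem_cyl_pre x m⟩)
    have h4 := measure_ne_zero_of_mem_mlRandomIn hxs (mem_cyl_pre x m)
    have h5 : slice P s (cyl (pre x m)) ≠ 0 := by
      intro h0
      rw [condStr_apply, h0, mul_zero] at h4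
      exact h4 rfl
    calc slice P t (cyl (pre x m)) ≤ 2 * slice P t (cyl (pre x m)) :=
          le_mul_of_one_le_left (zero_le) (by norm_num)
      _ ≤ slice P s (cyl (pre x m)) := h3
      _ < 2 * slice P s (cyl (pre x m)) := by
        rw [two_mul]
        exact ENNReal.lt_add_right (measure_ne_top _ _) h5

end Singular

/-! ### From an estimator to singularity. -/

section Estimator

theorem ext_of_cyl {μ ν : Measure Cantor} [IsFiniteMeasure μ]
    (h : ∀ s, μ (cyl s) = ν (cyl s)) : μ = ν := by
  have hopen : ∀ A : Set Cantor, IsOpen A → μ A = ν A := by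
    intro A hA
    have e : A = ⋃ t ∈ {t : Str | cyl t ⊆ A}, cyl t := by
      refine subset_antisymm (fun x hx => ?_) (iUnion₂_subset fun t ht => ht)
      obtain ⟨n, hn⟩ := exists_cyl_pre_subset hA hx
      exact mem_biUnion (x := pre x n) hn (mem_cyl_pre x n)
    rw [e]
    exact le_antisymm (measure_biUnion_cyl_le fun t _ => (h t).le)
      (measure_biUnion_cyl_le fun t _ => (h t).ge)
  exact ext_of_generate_finite _ (BorelSpace.measurable_eq (α := Cantor)) isPiSystem_isOpen hopen
    (hopen _ isOpen_univ)

theorem measurable_comp_pre (F : Str → ℝ≥0∞) (n : ℕ) : Measurable fun y : Cantor => F (pre y n) :=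
  fun S _ => measurableSet_pre (fun w => F w ∈ S) n

variable {P : Measure (Cantor × Cantor)} [IsFiniteMeasure P]

/-- The integrand is constant on cylinders of length `n`, so this is the formula of total
probability. -/
theorem setLIntegral_condStr_cyl (x t : Str) {n : ℕ} (hn : t.length ≤ n) :
    ∫⁻ y in cyl t, condStr P (pre y n) (cyl x) ∂P.snd = P (cyl₂ (x, t)) := by
  classical
  have e : cyl t = {y | t <+: pre y n} := by
    ext y
    simp [prefix_pre_iff, hn]
  rw [← withDensity_apply _ (measurableSet_cyl t), ← cut_cyl, e, measure_pre_eq_sum,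
    measure_pre_eq_sum]
  refine Finset.sum_congr rfl fun w hw => ?_
  rw [Finset.mem_filter, List.mem_toFinset, mem_strings] at hw
  rw [withDensity_apply _ (measurableSet_cyl w), cut_cyl, ← slice_cyl, ← mul_condStr_apply,
    setLIntegral_congr_fun (g := fun _ => condStr P w (cyl x)) (measurableSet_cyl w)
      (fun y hy => by
        dsimp only
        rw [← hw.1, mem_cyl_iff.1 hy]),
    setLIntegral_const, mul_comm]

/-- By dominated convergence the limit has the same integrals over cylinders as the disintegration
kernel. These determine its value on each cylinder almost everywhere, and there are countably many
cylinders. The coordinates are swapped because `condKernel` conditions on the first one. -/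
theorem ae_condAt_eq_condKernel (hP : ComputableReal fun s => P.real (cyl₂ s))
    (h : ∀ᵐ y ∂P.snd, y ∈ MLR P.snd) :
    ∀ᵐ y ∂P.snd, condAt P y = (P.map Prod.swap).condKernel y := by
  set κ := (P.map Prod.swap).condKernel
  have hfst : (P.map Prod.swap).fst = P.snd := Measure.fst_map_swap
  have hκ : ∀ x t, ∫⁻ y in cyl t, κ y (cyl x) ∂P.snd = P (cyl₂ (x, t)) := by
    intro x t
    rw [← hfst, Measure.setLIntegral_condKernel_eq_measure_prod (measurableSet_cyl t)
      (measurableSet_cyl x), Measure.map_apply measurable_swap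
        ((measurableSet_cyl t).prod (measurableSet_cyl x)), preimage_swap_prod]
    rfl
  have hone : ∀ x t, condStr P t (cyl x) ≤ 1 := condStr_cyl_le_one P
  have hlim : ∀ x : Str, ∀ᵐ y ∂P.snd, Tendsto (fun n => condStr P (pre y n) (cyl x)) atTop
      (𝓝 (condAt P y (cyl x))) := fun x => h.mono fun y hy => (isCondAt_condAt hP hy).2 x
  have hae : ∀ x, AEMeasurable (fun y => condAt P y (cyl x)) P.snd := fun x =>
    aemeasurable_of_tendsto_metrizable_ae atTop
      (fun n => (measurable_comp_pre (fun w => condStr P w (cyl x)) n).aemeasurable) (hlim x)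
  have hcond : ∀ x t, ∫⁻ y in cyl t, condAt P y (cyl x) ∂P.snd = P (cyl₂ (x, t)) := by
    intro x t
    have h1 : Tendsto (fun n => ∫⁻ y in cyl t, condStr P (pre y n) (cyl x) ∂P.snd) atTop
        (𝓝 (∫⁻ y in cyl t, condAt P y (cyl x) ∂P.snd)) :=
      tendsto_lintegral_of_dominated_convergence (fun _ => 1)
        (fun n => measurable_comp_pre (fun w => condStr P w (cyl x)) n)
        (fun n => ae_of_all _ fun y => hone x _)
        (by rw [setLIntegral_const, one_mul]; exact measure_ne_top _ _)
        (ae_restrict_of_ae (hlim x))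
    refine tendsto_nhds_unique h1 (tendsto_const_nhds.congr' ?_)
    filter_upwards [eventually_ge_atTop t.length] with n hn
    rw [setLIntegral_condStr_cyl x t hn]
  have heq : ∀ x : Str, ∀ᵐ y ∂P.snd, condAt P y (cyl x) = κ y (cyl x) := by
    intro x
    have hfin : ∫⁻ y, condAt P y (cyl x) ∂P.snd ≠ ⊤ := by
      have := hcond x []
      rw [cyl_nil, setLIntegral_univ] at this
      rw [this]
      exact measure_ne_top _ _
    refine (withDensity_eq_iff (hae x)
      (ProbabilityTheory.Kernel.measurable_coe κ (measurableSet_cyl x)).aemeasurable hfin).1 ?_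
    have : IsFiniteMeasure (P.snd.withDensity fun y => condAt P y (cyl x)) :=
      isFiniteMeasure_withDensity hfin
    refine ext_of_cyl fun t => ?_
    rw [withDensity_apply _ (measurableSet_cyl t), withDensity_apply _ (measurableSet_cyl t),
      hκ, hcond]
  filter_upwards [ae_all_iff.2 heq, h] with y hy hyr
  have := (isCondAt_condAt hP hyr).1
  exact ext_of_cyl hy

/-- By disintegration P is concentrated on the graph f(x) = y. The preimages under f of disjoint
cylinders then separate the conditional measures. -/
theorem ConsEstimator.singular {P : Measure (Cantor × Cantor)} [IsProbabilityMeasure P]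
    (hP : ComputableReal fun s => P.real (cyl₂ s)) (h : ConsEstimator P) : ConsSingular P := by
  obtain ⟨f, Y', hf, hY', hsub, hone, hfY⟩ := h
  have hYae : ∀ᵐ y ∂P.snd, y ∈ Y' := by
    rw [← prob_compl_eq_zero_iff hY'] at hone
    exact hone
  have hκ := ae_condAt_eq_condKernel hP (hYae.mono fun y hy => hsub hy)
  set κ := (P.map Prod.swap).condKernel
  have hfst : (P.map Prod.swap).fst = P.snd := Measure.fst_map_swap
  have hmeas : MeasurableSet {z : Cantor × Cantor | f z.2 = z.1} :=
    measurableSet_eq_fun (hf.comp measurable_snd) measurable_fst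
  have hnull : P {z : Cantor × Cantor | ¬ f z.1 = z.2} = 0 := by
    have h1 : (P.map Prod.swap) {z : Cantor × Cantor | f z.2 = z.1}ᶜ = 0 := by
      rw [← (P.map Prod.swap).disintegrate κ, Measure.compProd_apply hmeas.compl, hfst,
        lintegral_eq_zero_iff (ProbabilityTheory.Kernel.measurable_kernel_prodMk_left hmeas.compl)]
      filter_upwards [hYae, hκ] with y hy hyκ
      rw [← hyκ]
      exact hfY y hy
    rwa [Measure.map_apply measurable_swap hmeas.compl] at h1
  intro s t _ _ hst
  have hA := hf (measurableSet_cyl s)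
  refine ⟨(f ⁻¹' cyl s)ᶜ, hA.compl, ?_, ?_⟩
  · rw [condStr_apply, slice_apply P s hA.compl, mul_eq_zero]
    right
    refine measure_mono_null ?_ hnull
    rintro ⟨x, y⟩ ⟨hx, hy⟩ (hxy : f x = y)
    exact hx (show f x ∈ cyl s from hxy ▸ hy)
  · rw [compl_compl, condStr_apply, slice_apply P t hA, mul_eq_zero]
    right
    refine measure_mono_null ?_ hnull
    rintro ⟨x, y⟩ ⟨hx, hy⟩ (hxy : f x = y)
    exact Set.disjoint_left.1 hst hx (show f x ∈ cyl t from hxy ▸ hy)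

end Estimator

/-! ### Consistency, disjoint sections and the equality in part (b). -/

section Consistency

variable {P : Measure (Cantor × Cantor)} [IsProbabilityMeasure P]

theorem ConsSingular.disjointStr (hP : ComputableReal fun s => P.real (cyl₂ s))
    (h : ConsSingular P) : ConsDisjointStr P := fun s t hs ht hst =>
  mlr_condStr_inter_eq_empty hP hs ht (h s t hs ht hst)

theorem ConsDisjointStr.disjointSection (h : ConsDisjointStr P) : ConsDisjointSection P := by
  intro y z hyz
  rw [eq_empty_iff_forall_notMem]
  rintro x ⟨hxy, hxz⟩
  obtain ⟨n, hn⟩ : ∃ n, pre y n ≠ pre z n := by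
    by_contra! hc
    exact hyz (eq_of_forall_pre_eq hc)
  have h1 := h _ _ (snd_cyl_ne_zero (mlr₂_mem_snd hxy) n) (snd_cyl_ne_zero (mlr₂_mem_snd hxz) n)
    (disjoint_cyl_pre hn)
  exact eq_empty_iff_forall_notMem.1 h1 x ⟨mlr₂_mem_condStr hxy n, mlr₂_mem_condStr hxz n⟩

theorem condAt_univ_le_one (P : Measure (Cantor × Cantor)) (y : Cantor) : condAt P y univ ≤ 1 := by
  unfold condAt
  split_ifs with h
  · have := h.choose_spec.1
    exact prob_le_one
  · simp

omit [IsProbabilityMeasure P] in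
-- The posterior has total mass at most 1, which leaves no room for two points of mass 1.
theorem ConsPosterior.disjointSection (h : ConsPosterior P) : ConsDisjointSection P := by
  intro y z hyz
  rw [eq_empty_iff_forall_notMem]
  rintro x ⟨hxy, hxz⟩
  have h1 := (h x y hxy).1
  have h2 := (h x z hxz).1
  have h3 : condAt (P.map Prod.swap) x ({y} ∪ {z}) = 1 + 1 := by
    rw [measure_union (by simpa using hyz) (measurableSet_singleton z), h1, h2]
  have h4 := (measure_mono (subset_univ _)).trans (condAt_univ_le_one (P.map Prod.swap) x)
    (a := condAt (P.map Prod.swap) x ({y} ∪ {z}))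
  rw [h3] at h4
  norm_num at h4

theorem ConsUnique.disjointSection (h : ConsUnique P) : ConsDisjointSection P := by
  intro y z hyz
  rw [eq_empty_iff_forall_notMem]
  rintro x ⟨hxy, hxz⟩
  exact hyz ((h x (mlr₂_mem_fst hxy)).unique ⟨mlr₂_mem_snd hxy, hxy⟩ ⟨mlr₂_mem_snd hxz, hxz⟩)

omit [IsProbabilityMeasure P] in
theorem ConsGraph.disjointSection (h : ConsGraph P) : ConsDisjointSection P := by
  obtain ⟨f, hf⟩ := h
  intro y z hyz
  rw [eq_empty_iff_forall_notMem]
  rintro x ⟨hxy, hxz⟩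
  exact hyz ((hf x y hxy).symm.trans (hf x z hxz))

theorem PosteriorConsistent.disjointSection (hP : ComputableReal fun s => P.real (cyl₂ s))
    (h : PosteriorConsistent P) : ConsDisjointSection P := by
  rcases h with h | h | h | h | h | h | h
  · exact (h.disjointStr hP).disjointSection
  · exact h.disjointSection
  · exact h.disjointSection
  · exact h
  · exact h.disjointSection
  · exact h.disjointSection
  · exact ((h.singular hP).disjointStr hP).disjointSection

/-- Each prefix of y supplies a random partner of x in its cylinder. Disjoint sections force all
partners to be equal, and the only point in all these cylinders is y. -/
theorem prefixInter_subset (hP : ComputableReal fun s => P.real (cyl₂ s))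
    (h : ConsDisjointSection P) {y : Cantor} (hy : y ∈ MLR P.snd) :
    prefixInter P y ⊆ mlrSection P y := by
  intro x hx
  have hex : ∀ n, ∃ z ∈ cyl (pre y n), (x, z) ∈ MLR₂ P := fun n =>
    exists_mem_mlr₂ hP (snd_cyl_ne_zero hy n) (mem_iInter.1 hx n)
  choose z hz hxz using hex
  have hz0 : ∀ n, z n = z 0 := by
    intro n
    by_contra hne
    exact eq_empty_iff_forall_notMem.1 (h _ _ hne) x ⟨hxz n, hxz 0⟩
  have : z 0 = y := eq_of_forall_pre_eq fun n => pre_eq_iff_of_le.2 (hz0 n ▸ hz n)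
  exact this ▸ hxz 0

theorem mlrOracle_subset (μ : Measure Cantor) (y : Cantor) : MLROracle μ y ⊆ MLR μ := by
  intro x hx
  refine mem_mlRandomIn.2 fun U hU => mem_mlRandomIn.1 hx U ⟨?_, hU.anti, hU.small⟩
  exact RecursiveIn.mono (empty_subset _) hU.re

end Consistency

/-! ### Part (c): the test for P built from an oracle test. -/

section OracleTest

/-- The use principle is applied to numerators and denominators of the approximation of Q. Prefixes
of y eventually produce the strict bounds `b`; nothing is claimed about the values along other
sequences. -/
theorem exists_approximates_dyadicUpper {y : Cantor} {Q : Measure Cantor}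
    (hQ : ComputableMeasureIn (oracle y) cyl Q) :
    ∃ (Φ : Str → Str × ℕ →. ℕ) (b : Str × ℕ → ℕ), Partrec₂ Φ ∧
      (∀ s t a v, s <+: t → v ∈ Φ s a → v ∈ Φ t a) ∧ (∀ a, ∃ k, b a ∈ Φ (pre y k) a) ∧
      ∀ w k, Q.real (cyl w) * 2 ^ k < b (w, k) ∧ (b (w, k) : ℝ) ≤ Q.real (cyl w) * 2 ^ k + 3 := by
  obtain ⟨A, h1, h2, h3⟩ := hQ
  obtain ⟨Φ, hΦ, mΦ, iΦ⟩ := exists_approximates y h1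
  obtain ⟨Ψ, hΨ, mΨ, iΨ⟩ := exists_approximates y h2
  refine ⟨fun t p => (Φ t (p.1, 2 ^ p.2)).bind fun a => (Ψ t (p.1, 2 ^ p.2)).map fun d =>
    dyadicUpper a d p.2, fun p => dyadicUpper (A (p.1, 2 ^ p.2)).num (A (p.1, 2 ^ p.2)).den p.2,
    ?_, ?_, ?_, ?_⟩
  · have hg : Computable fun z : Str × (Str × ℕ) => (z.2.1, 2 ^ z.2.2) :=
      Computable.pair (Computable.fst.comp Computable.snd)
        (computable_two_pow (Computable.snd.comp Computable.snd))
    refine Partrec.bind (hΦ.comp Computable.fst hg) (Partrec.map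
      (hΨ.comp (Computable.fst.comp Computable.fst) (hg.comp Computable.fst)) ?_)
    exact computable_dyadicUpper (Computable.snd.comp Computable.fst) Computable.snd
      (Computable.snd.comp (Computable.snd.comp (Computable.fst.comp Computable.fst)))
  · intro s t a v hst hv
    simp only [Part.mem_bind_iff, Part.mem_map_iff] at hv ⊢
    obtain ⟨c, hc, d, hd, rfl⟩ := hv
    exact ⟨c, mΦ s t _ c hst hc, d, mΨ s t _ d hst hd, rfl⟩
  · intro a
    obtain ⟨m, hm⟩ := (iΦ (a.1, 2 ^ a.2) _).1 (Part.mem_some _)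
    obtain ⟨n, hn⟩ := (iΨ (a.1, 2 ^ a.2) _).1 (Part.mem_some _)
    refine ⟨max m n, ?_⟩
    simp only [Part.mem_bind_iff, Part.mem_map_iff]
    exact ⟨_, mΦ _ _ _ _ (pre_prefix_pre y (le_max_left _ _)) hm, _,
      mΨ _ _ _ _ (pre_prefix_pre y (le_max_right _ _)) hn, rfl⟩
  · intro w k
    have := dyadicUpper_spec (measureReal_nonneg (μ := Q) (s := cyl w)) (h3 w (2 ^ k))
    exact ⟨this.1, this.2.1⟩

/-- The sum of `g i * 2 ^ (n - 1 - i)` over `i < n` of partial values. -/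
def cumul (g : ℕ → Part ℕ) (n : ℕ) : Part ℕ :=
  Nat.rec (Part.some 0) (fun i IH => IH.bind fun s => (g i).map fun v => 2 * s + v) n

theorem mem_cumul {g : ℕ → Part ℕ} {n s : ℕ} : s ∈ cumul g n ↔
    ∃ u : ℕ → ℕ, (∀ i < n, u i ∈ g i) ∧ s = ∑ i ∈ Finset.range n, u i * 2 ^ (n - 1 - i) := by
  have hsum : ∀ (u : ℕ → ℕ) n, ∑ i ∈ Finset.range (n + 1), u i * 2 ^ (n + 1 - 1 - i) =
      2 * (∑ i ∈ Finset.range n, u i * 2 ^ (n - 1 - i)) + u n := by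
    intro u n
    rw [Finset.sum_range_succ, Finset.mul_sum]
    congr 1
    · refine Finset.sum_congr rfl fun i hi => ?_
      rw [Finset.mem_range] at hi
      rw [show n + 1 - 1 - i = n - 1 - i + 1 by omega, pow_succ]
      ring
    · simp
  induction n generalizing s with
  | zero => simp [cumul]
  | succ n ih =>
    change s ∈ (cumul g n).bind (fun s => (g n).map fun v => 2 * s + v) ↔ _
    simp only [Part.mem_bind_iff, Part.mem_map_iff, ih]
    constructor
    · rintro ⟨_, ⟨u, hu, rfl⟩, v, hv, rfl⟩
      refine ⟨Function.update u n v, fun i hi => ?_, ?_⟩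
      · rcases Nat.lt_succ_iff_lt_or_eq.1 hi with h | rfl
        · rw [Function.update_of_ne h.ne]
          exact hu i h
        · rwa [Function.update_self]
      · rw [hsum, Function.update_self]
        congr 2
        refine Finset.sum_congr rfl fun i hi => ?_
        rw [Function.update_of_ne (Finset.mem_range.1 hi).ne]
    · rintro ⟨u, hu, rfl⟩
      exact ⟨_, ⟨u, fun i hi => hu i (by omega), rfl⟩, u n, hu n (by omega), (hsum u n).symm⟩

/-- The string `w` is minimal among those covered along `t`. -/
def isNew (cov : Str → Str → Bool) (w t : Str) : Bool :=
  cov w (t.take w.length) && !cov w.dropLast (t.take (w.length - 1))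

/-- Newness reads only as many symbols as `w` has, so it is settled once the other string has this
length. -/
theorem isNew_of_prefix (cov : Str → Str → Bool) {w s t : Str} (h : s <+: t)
    (hw : w.length ≤ s.length) : isNew cov w s = isNew cov w t := by
  have e : ∀ n ≤ s.length, s.take n = t.take n := by
    intro n hn
    rw [List.prefix_iff_eq_take.1 h, List.take_take, min_eq_left hn]
  rw [isNew, isNew, e _ hw, e _ (by omega)]

/-- The upper bound, in units of `2 ^ (-(n + i + 3))`, for the measure of the cylinder of the string
with code `i`, if this string is new along `t`. -/
def piece (cov : ℕ → Str → Str → Bool) (Φ : Str → Str × ℕ →. ℕ) (n : ℕ) (t : Str) (i : ℕ) :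
    Part ℕ :=
  bif decide (((Encodable.decode (α := Str) i).getD []).length ≤ t.length) then
    bif isNew (cov n) ((Encodable.decode (α := Str) i).getD []) t &&
      -- This discards numbers that are not the code of the string they are read as, so that no
      -- string is counted twice.
      decide (Encodable.encode ((Encodable.decode (α := Str) i).getD []) = i) then
      Φ t ((Encodable.decode (α := Str) i).getD [], n + i + 3)
    else Part.some 0
  else Part.none

variable {cov : ℕ → Str → Str → Bool} {Φ : Str → Str × ℕ →. ℕ}

theorem piece_encode {n : ℕ} {t w : Str} (h : w.length ≤ t.length)
    (hw : isNew (cov n) w t = true) :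
    piece cov Φ n t (Encodable.encode w) = Φ t (w, n + Encodable.encode w + 3) := by
  simp [piece, h, hw]

/-- A piece stays undefined until newness is settled, so a value, including 0, is never revised. -/
theorem piece_mono (hΦ : ∀ s t a v, s <+: t → v ∈ Φ s a → v ∈ Φ t a) {n : ℕ} {s t : Str} {i v : ℕ}
    (hst : s <+: t) (hv : v ∈ piece cov Φ n s i) : v ∈ piece cov Φ n t i := by
  unfold piece at hv ⊢
  generalize (Encodable.decode (α := Str) i).getD [] = w at hv ⊢
  by_cases h : w.length ≤ s.length
  · rw [← isNew_of_prefix (cov n) hst h]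
    simp only [h, h.trans hst.length_le, decide_true, cond_true] at hv ⊢
    cases hb : (isNew (cov n) w s && decide (Encodable.encode w = i))
    · simpa [hb] using hv
    · simp only [hb, cond_true] at hv ⊢
      exact hΦ _ _ _ _ hst hv
  · simp [h] at hv

theorem cumul_mono (hΦ : ∀ s t a v, s <+: t → v ∈ Φ s a → v ∈ Φ t a) {n : ℕ} {s t : Str} {j v : ℕ}
    (hst : s <+: t) (hv : v ∈ cumul (piece cov Φ n s) j) : v ∈ cumul (piece cov Φ n t) j := by
  obtain ⟨u, hu, hs⟩ := mem_cumul.1 hv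
  exact mem_cumul.2 ⟨u, fun i hi => piece_mono hΦ hst (hu i hi), hs⟩

theorem computable_isNew (hcov : Computable fun x : ℕ × Str × Str => cov x.1 x.2.1 x.2.2)
    {α : Type} [Primcodable α] {n : α → ℕ} {w t : α → Str} (hn : Computable n) (hw : Computable w)
    (ht : Computable t) : Computable fun a => isNew (cov (n a)) (w a) (t a) := by
  have hl : Computable fun a => (w a).length := Computable.list_length.comp hw
  have hl' : Computable fun a => (w a).length - 1 :=
    Primrec.nat_sub.to_comp.comp hl (Computable.const 1)
  have htake : ∀ {f : α → ℕ}, Computable f → Computable fun a => (t a).take (f a) := fun hf =>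
    Primrec.list_take.to_comp.comp hf ht
  have hd : Computable fun a => (w a).dropLast :=
    (Primrec.list_take.to_comp.comp hl' hw).of_eq fun a => List.dropLast_eq_take.symm
  refine computable_and (hcov.comp (g := fun a => (n a, w a, (t a).take (w a).length))
    (Computable.pair hn (Computable.pair hw (htake hl)))) (computable_not ?_)
  exact hcov.comp (g := fun a => (n a, (w a).dropLast, (t a).take ((w a).length - 1)))
    (Computable.pair hn (Computable.pair hd (htake hl')))

theorem partrec_cumul_piece (hcov : Computable fun x : ℕ × Str × Str => cov x.1 x.2.1 x.2.2)
    (hΦ : Partrec₂ Φ) {α : Type} [Primcodable α] {n j : α → ℕ} {t : α → Str} (hn : Computable n)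
    (ht : Computable t) (hj : Computable j) :
    Partrec fun a => cumul (piece cov Φ (n a) (t a)) (j a) := by
  have hpiece : Partrec fun x : α × ℕ => piece cov Φ (n x.1) (t x.1) x.2 := by
    have hw : Computable fun x : α × ℕ => (Encodable.decode (α := Str) x.2).getD [] :=
      Computable.option_getD (Computable.decode.comp Computable.snd) (Computable.const [])
    have hn' : Computable fun x : α × ℕ => n x.1 := hn.comp Computable.fst
    have ht' : Computable fun x : α × ℕ => t x.1 := ht.comp Computable.fst
    refine Partrec.cond (computable_decide_le (Computable.list_length.comp hw)
      (Computable.list_length.comp ht')) (Partrec.cond (computable_and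
        (computable_isNew hcov hn' hw ht') (computable_decide_eq (Computable.encode.comp hw)
          Computable.snd)) ?_ ?_) Partrec.none
    · exact hΦ.comp ht' (Computable.pair hw (computable_add (computable_add hn' Computable.snd)
        (Computable.const 3)))
    · exact Computable.const 0
  refine Partrec.nat_rec (f := j) (g := fun _ => Part.some 0)
    (h := fun a z => (piece cov Φ (n a) (t a) z.1).map fun v => 2 * z.2 + v) hj
    (Computable.const 0) ?_
  refine Partrec.map (f := fun x : α × (ℕ × ℕ) => piece cov Φ (n x.1) (t x.1) x.2.1)
    (hpiece.comp (Computable.pair Computable.fst (Computable.fst.comp Computable.snd))) ?_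
  exact computable_add (computable_mul (Computable.const 2)
    (Computable.snd.comp (Computable.snd.comp Computable.fst))) Computable.snd

/-- The conditions under which `Δ(w) × Δ(t)` is enumerated into layer `n`, with the bound `v`. -/
def Enters (P : Measure (Cantor × Cantor)) (cov : ℕ → Str → Str → Bool) (Φ : Str → Str × ℕ →. ℕ)
    (n : ℕ) (w t : Str) (v : ℕ) : Prop :=
  w.length ≤ t.length ∧ isNew (cov n) w t = true ∧ v ∈ Φ t (w, n + Encodable.encode w + 3) ∧
    (∃ s, s ∈ cumul (piece cov Φ n t) (Encodable.encode w + 1) ∧ s ≤ 2 ^ (Encodable.encode w + 4)) ∧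
    ((2 ^ (n + Encodable.encode w + 3) : ℕ) : ℝ) * P.real (cyl₂ (w, t)) <
      (v : ℝ) * P.real (cyl₂ ([], t))

theorem enters_re {P : Measure (Cantor × Cantor)} (hP : ComputableReal fun s => P.real (cyl₂ s))
    (hcov : Computable fun x : ℕ × Str × Str => cov x.1 x.2.1 x.2.2) (hΦ : Partrec₂ Φ) :
    REPred fun z : (Str × Str) × ℕ => ∃ v, Enters P cov Φ z.2 z.1.1 z.1.2 v := by
  refine REPred.exists (p := fun z : ((Str × Str) × ℕ) × ℕ =>
    Enters P cov Φ z.1.2 z.1.1.1 z.1.1.2 z.2) ?_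
  have hw : Computable fun z : ((Str × Str) × ℕ) × ℕ => z.1.1.1 :=
    Computable.fst.comp (Computable.fst.comp Computable.fst)
  have ht : Computable fun z : ((Str × Str) × ℕ) × ℕ => z.1.1.2 :=
    Computable.snd.comp (Computable.fst.comp Computable.fst)
  have hn : Computable fun z : ((Str × Str) × ℕ) × ℕ => z.1.2 :=
    Computable.snd.comp Computable.fst
  have he : Computable fun z : ((Str × Str) × ℕ) × ℕ => Encodable.encode z.1.1.1 :=
    Computable.encode.comp hw
  have hk : Computable fun z : ((Str × Str) × ℕ) × ℕ => z.1.2 + Encodable.encode z.1.1.1 + 3 :=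
    computable_add (computable_add hn he) (Computable.const 3)
  refine REPred.and ?_ (REPred.and ?_ (REPred.and ?_ (REPred.and ?_ ?_)))
  · exact (REPred.of_bool (computable_decide_le (Computable.list_length.comp hw)
      (Computable.list_length.comp ht))).of_eq fun z => by simp
  · exact REPred.of_bool (computable_isNew hcov hn hw ht)
  · exact REPred.mem_partrec (hΦ.comp ht (Computable.pair hw hk)) Computable.snd
  · refine REPred.exists (p := fun z : (((Str × Str) × ℕ) × ℕ) × ℕ =>
      z.2 ∈ cumul (piece cov Φ z.1.1.2 z.1.1.1.2) (Encodable.encode z.1.1.1.1 + 1) ∧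
        z.2 ≤ 2 ^ (Encodable.encode z.1.1.1.1 + 4)) (REPred.and ?_ ?_)
    · exact REPred.mem_partrec (partrec_cumul_piece hcov hΦ (hn.comp Computable.fst)
        (ht.comp Computable.fst) (computable_add (he.comp Computable.fst) (Computable.const 1)))
        Computable.snd
    · exact (REPred.of_bool (computable_decide_le Computable.snd (computable_two_pow
        (computable_add (he.comp Computable.fst) (Computable.const 4))))).of_eq fun z => by simp
  · refine ComputableReal.lt_re ?_ ?_
    · exact ComputableReal.natCast_mul
        (f := fun z : ((Str × Str) × ℕ) × ℕ => 2 ^ (z.1.2 + Encodable.encode z.1.1.1 + 3))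
        (computable_two_pow hk) (hP.comp (f := fun z : ((Str × Str) × ℕ) × ℕ =>
          (z.1.1.1, z.1.1.2)) (Computable.pair hw ht))
    · exact ComputableReal.natCast_mul (f := fun z : ((Str × Str) × ℕ) × ℕ => z.2)
        Computable.snd (hP.comp (f := fun z : ((Str × Str) × ℕ) × ℕ => (([] : Str), z.1.1.2))
          (Computable.pair (Computable.const []) ht))

end OracleTest

/-! ### The P-measure of the new test. -/

section Bound

variable {P : Measure (Cantor × Cantor)} {cov : ℕ → Str → Str → Bool} {Φ : Str → Str × ℕ →. ℕ}

/-- The rectangles enumerated into the layers. -/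
def enterSet (P : Measure (Cantor × Cantor)) (cov : ℕ → Str → Str → Bool)
    (Φ : Str → Str × ℕ →. ℕ) : Set ((Str × Str) × ℕ) :=
  {z | ∃ v, Enters P cov Φ z.2 z.1.1 z.1.2 v}

/-- The bound for the measure of `Δ(w)` that has been confirmed along the second coordinate. -/
noncomputable def enterBound (P : Measure (Cantor × Cantor)) (cov : ℕ → Str → Str → Bool)
    (Φ : Str → Str × ℕ →. ℕ) (n : ℕ) (w : Str) (y : Cantor) : ℝ≥0∞ :=
  ⨆ (t : Str) (v : ℕ) (_ : Enters P cov Φ n w t v),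
    (cyl t).indicator (fun _ => (v : ℝ≥0∞) * 2⁻¹ ^ (n + Encodable.encode w + 3)) y

theorem measurable_enterBound (n : ℕ) (w : Str) : Measurable (enterBound P cov Φ n w) := by
  refine Measurable.iSup fun t => Measurable.iSup fun v => Measurable.iSup_Prop _ ?_
  exact measurable_const.indicator (measurableSet_cyl t)

/-- The condition checked for the entering string with the largest code `j` already controls all the
others: by monotonicity the sum it inspects contains their bounds. In units of 2^(-(n+j+3)) that sum
is at most 2^(j+4), which is 2 · 2^(-n). -/
theorem sum_enters_le (hΦ : ∀ s t a v, s <+: t → v ∈ Φ s a → v ∈ Φ t a) {n : ℕ} {y : Cantor}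
    {F : Finset Str} {t : Str → Str} {v : Str → ℕ}
    (h : ∀ w ∈ F, y ∈ cyl (t w) ∧ Enters P cov Φ n w (t w) (v w)) :
    ∑ w ∈ F, (v w : ℝ≥0∞) * 2⁻¹ ^ (n + Encodable.encode w + 3) ≤ 2 * 2⁻¹ ^ n := by
  rcases F.eq_empty_or_nonempty with rfl | hF
  · simp
  obtain ⟨w₀, hw₀, hmax⟩ := F.exists_max_image Encodable.encode hF
  set j := Encodable.encode w₀
  set m := F.sup fun w => (t w).length
  have hpre : ∀ w ∈ F, t w <+: pre y m := fun w hw =>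
    prefix_pre_iff.2 ⟨Finset.le_sup (f := fun w => (t w).length) hw, (h w hw).1⟩
  obtain ⟨s, hs, hsle⟩ := (h w₀ hw₀).2.2.2.2.1
  obtain ⟨u, hu, rfl⟩ := mem_cumul.1 (cumul_mono hΦ (hpre w₀ hw₀) hs)
  have hv : ∀ w ∈ F, v w = u (Encodable.encode w) := by
    intro w hw
    obtain ⟨h1, h2, h3, -, -⟩ := (h w hw).2
    have h4 := hu (Encodable.encode w) (Nat.lt_succ_of_le (hmax w hw))
    rw [piece_encode (h1.trans (hpre w hw).length_le)
      (by rwa [← isNew_of_prefix (cov n) (hpre w hw) h1])] at h4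
    exact Part.mem_unique (hΦ _ _ _ _ (hpre w hw) h3) h4
  have hnat : ∑ w ∈ F, v w * 2 ^ (j - Encodable.encode w) ≤ 2 ^ (j + 4) := by
    refine le_trans ?_ hsle
    calc ∑ w ∈ F, v w * 2 ^ (j - Encodable.encode w)
        = ∑ w ∈ F, u (Encodable.encode w) * 2 ^ (j - Encodable.encode w) :=
          Finset.sum_congr rfl fun w hw => by rw [hv w hw]
      _ = ∑ i ∈ F.image Encodable.encode, u i * 2 ^ (j - i) := by
          rw [Finset.sum_image Encodable.encode_injective.injOn]
      _ ≤ ∑ i ∈ Finset.range (j + 1), u i * 2 ^ (j - i) := by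
          refine Finset.sum_le_sum_of_subset fun i hi => ?_
          obtain ⟨w, hw, rfl⟩ := Finset.mem_image.1 hi
          exact Finset.mem_range.2 (Nat.lt_succ_of_le (hmax w hw))
      _ = _ := by simp only [Nat.add_sub_cancel, j]
  have hpow : ∀ a b : ℕ, (2 : ℝ≥0∞) ^ a * 2⁻¹ ^ (b + a) = 2⁻¹ ^ b := fun a b => by
    rw [pow_add, mul_left_comm, ← mul_pow, ENNReal.mul_inv_cancel (by simp) (by simp), one_pow,
      mul_one]
  calc ∑ w ∈ F, (v w : ℝ≥0∞) * 2⁻¹ ^ (n + Encodable.encode w + 3)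
      = ∑ w ∈ F, (v w * 2 ^ (j - Encodable.encode w) : ℝ≥0∞) * 2⁻¹ ^ (n + j + 3) := by
        refine Finset.sum_congr rfl fun w hw => ?_
        have := hmax w hw
        rw [mul_assoc, show n + j + 3 = n + Encodable.encode w + 3 + (j - Encodable.encode w) by
          omega, hpow]
    _ = ((∑ w ∈ F, v w * 2 ^ (j - Encodable.encode w) : ℕ) : ℝ≥0∞) * 2⁻¹ ^ (n + j + 3) := by
        rw [← Finset.sum_mul]
        push_cast
        rfl
    _ ≤ ((2 ^ (j + 4) : ℕ) : ℝ≥0∞) * 2⁻¹ ^ (n + j + 3) := by gcongr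
    _ = 2 * 2⁻¹ ^ n := by
        push_cast
        rw [show j + 4 = 1 + (j + 3) by omega, pow_add, pow_one, mul_assoc, add_assoc, hpow]

theorem sum_enterBound_le (hΦ : ∀ s t a v, s <+: t → v ∈ Φ s a → v ∈ Φ t a) (n : ℕ) (y : Cantor) :
    ∑' w, enterBound P cov Φ n w y ≤ 2 * 2⁻¹ ^ n := by
  classical
  rw [ENNReal.tsum_eq_iSup_sum]
  refine iSup_le fun F => ?_
  have hex : ∀ w, ∃ t v, (∃ t v, y ∈ cyl t ∧ Enters P cov Φ n w t v) →
      y ∈ cyl t ∧ Enters P cov Φ n w t v := fun w => by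
    by_cases h : ∃ t v, y ∈ cyl t ∧ Enters P cov Φ n w t v
    · obtain ⟨t, v, h'⟩ := h
      exact ⟨t, v, fun _ => h'⟩
    · exact ⟨[], 0, fun h' => absurd h' h⟩
  choose t v htv using hex
  refine le_trans ?_ (sum_enters_le hΦ
    (F := F.filter fun w => ∃ t v, y ∈ cyl t ∧ Enters P cov Φ n w t v) (t := t) (v := v)
    fun w hw => htv w (Finset.mem_filter.1 hw).2)
  rw [Finset.sum_filter]
  refine Finset.sum_le_sum fun w _ => ?_
  refine iSup_le fun t' => iSup_le fun v' => iSup_le fun h' => ?_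
  by_cases hy : y ∈ cyl t'
  · rw [indicator_of_mem hy, if_pos ⟨t', v', hy, h'⟩]
    obtain ⟨hy', h⟩ := htv w ⟨t', v', hy, h'⟩
    -- Two values of `Φ` along the same sequence agree on a common extension, so the supremum has
    -- only one nonzero value.
    have : v' = v w := Part.mem_unique
      (hΦ t' (pre y (max t'.length (t w).length)) _ _ (prefix_pre_iff.2 ⟨le_max_left _ _, hy⟩)
        h'.2.2.1)
      (hΦ (t w) (pre y (max t'.length (t w).length)) _ _
        (prefix_pre_iff.2 ⟨le_max_right _ _, hy'⟩) h.2.2.1)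
    rw [this]
  · rw [indicator_of_notMem hy]
    exact zero_le

/-- For fixed w, the last condition of `Enters` compares P(Δ(w) × ·) on each admitted Δ(t) with the
measure of density `enterBound`, and this extends to unions. Summing over w under the integral, the
pointwise bound 2 · 2^(-n) applies. -/
theorem measure_layer_enterSet_le [IsProbabilityMeasure P]
    (hΦ : ∀ s t a v, s <+: t → v ∈ Φ s a → v ∈ Φ t a) (n : ℕ) :
    P (layer cyl₂ (enterSet P cov Φ) n) ≤ 2 * 2⁻¹ ^ n := by
  let T : Str → Set Str := fun w => {t | ((w, t), n) ∈ enterSet P cov Φ}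
  have hsub : layer cyl₂ (enterSet P cov Φ) n ⊆ ⋃ w, cyl w ×ˢ ⋃ t ∈ T w, cyl t := by
    intro ω hω
    obtain ⟨⟨w, t⟩, hwt, h1, h2⟩ := mem_layer.1 hω
    exact mem_iUnion.2 ⟨w, h1, mem_biUnion (x := t) hwt h2⟩
  have hle : ∀ w, P (cyl w ×ˢ ⋃ t ∈ T w, cyl t) ≤ ∫⁻ y, enterBound P cov Φ n w y ∂P.snd := by
    intro w
    have hm : MeasurableSet (⋃ t ∈ T w, cyl t) :=
      MeasurableSet.biUnion (Set.to_countable _) fun t _ => measurableSet_cyl t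
    rw [← cut_apply P _ hm]
    refine (measure_biUnion_cyl_le (ν := P.snd.withDensity (enterBound P cov Φ n w))
      fun t ht => ?_).trans ?_
    · obtain ⟨v, hv⟩ := ht
      have hlt := hv.2.2.2.2
      dsimp only at hv hlt
      rw [natCast_mul_measureReal_lt_iff, ← snd_cyl] at hlt
      rw [cut_cyl, withDensity_apply _ (measurableSet_cyl t)]
      set k := n + Encodable.encode w + 3
      calc P (cyl₂ (w, t)) = 2⁻¹ ^ k * (((2 ^ k : ℕ) : ℝ≥0∞) * P (cyl₂ (w, t))) := by
            push_cast
            rw [← mul_assoc, ← mul_pow, ENNReal.inv_mul_cancel (by simp) (by simp), one_pow,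
              one_mul]
        _ ≤ 2⁻¹ ^ k * (v * P.snd (cyl t)) := mul_le_mul_right hlt.le _
        _ = ∫⁻ _ in cyl t, (v : ℝ≥0∞) * 2⁻¹ ^ k ∂P.snd := by
            rw [setLIntegral_const]
            ring
        _ ≤ ∫⁻ y in cyl t, enterBound P cov Φ n w y ∂P.snd := by
            refine setLIntegral_mono (measurable_enterBound n w) fun y hy => ?_
            refine le_iSup_of_le t (le_iSup_of_le v (le_iSup_of_le hv ?_))
            rw [indicator_of_mem hy]
    · rw [withDensity_apply _ hm]
      exact setLIntegral_le_lintegral _ _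
  calc P (layer cyl₂ (enterSet P cov Φ) n) ≤ ∑' w, P (cyl w ×ˢ ⋃ t ∈ T w, cyl t) :=
        (measure_mono hsub).trans (measure_iUnion_le _)
    _ ≤ ∑' w, ∫⁻ y, enterBound P cov Φ n w y ∂P.snd := ENNReal.tsum_le_tsum hle
    _ = ∫⁻ y, ∑' w, enterBound P cov Φ n w y ∂P.snd :=
        (lintegral_tsum fun w => (measurable_enterBound n w).aemeasurable).symm
    _ ≤ ∫⁻ _, 2 * 2⁻¹ ^ n ∂P.snd := lintegral_mono fun y => sum_enterBound_le hΦ n y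
    _ = 2 * 2⁻¹ ^ n := by
        rw [lintegral_const, measure_univ, mul_one]

end Bound

/-! ### The new test captures the given point. -/

section Completeness

theorem isNew_pre {cov : Str → Str → Bool} {w : Str} {y : Cantor} {m : ℕ} (h : w.length ≤ m) :
    isNew cov w (pre y m) = true ↔
      cov w (pre y w.length) = true ∧ cov w.dropLast (pre y (w.length - 1)) = false := by
  rw [isNew, take_pre y h, take_pre y ((Nat.sub_le _ _).trans h)]
  simp

theorem disjoint_cyl_of_isNew {cov : Str → Str → Bool}
    (hmono : ∀ w t w' t', w <+: w' → t <+: t' → cov w t = true → cov w' t' = true) {y : Cantor}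
    {w w' : Str} {m : ℕ} (hw : w.length ≤ m) (hw' : w'.length ≤ m)
    (h : isNew cov w (pre y m) = true) (h' : isNew cov w' (pre y m) = true) (hne : w ≠ w') :
    Disjoint (cyl w) (cyl w') := by
  rw [isNew_pre hw] at h
  rw [isNew_pre hw'] at h'
  have key : ∀ {w w' : Str}, cov w (pre y w.length) = true →
      cov w'.dropLast (pre y (w'.length - 1)) = false → w <+: w' → w = w' := by
    intro w w' h h' hp
    by_contra hne
    have hl : w.length < w'.length :=
      lt_of_le_of_ne hp.length_le fun e => hne (hp.eq_of_length e)
    have hd : w <+: w'.dropLast := by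
      rw [List.dropLast_eq_take, List.prefix_take_iff]
      exact ⟨hp, by omega⟩
    rw [hmono _ _ _ _ hd (pre_prefix_pre y (by omega)) h] at h'
    exact Bool.noConfusion h'
  rw [Set.disjoint_left]
  intro x hx hx'
  rcases le_total w.length w'.length with hl | hl
  · exact hne (key h.1 h'.2 (prefix_of_mem_cyl hx hx' hl))
  · exact hne (key h'.1 h.2 (prefix_of_mem_cyl hx' hx hl)).symm

/-- The first covering level is new. It is positive because the empty string is not covered, so
dropping the last symbol really moves to the previous level. -/
theorem exists_isNew {cov : Str → Str → Bool} (h0 : ∀ t, cov [] t = false) {x y : Cantor}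
    (h : ∃ l, cov (pre x l) (pre y l) = true) :
    ∃ l, ∀ m, l ≤ m → isNew cov (pre x l) (pre y m) = true := by
  classical
  refine ⟨Nat.find h, fun m hm => ?_⟩
  have h1 := Nat.find_spec h
  rw [isNew_pre (by simpa using hm), length_pre, dropLast_pre]
  refine ⟨h1, ?_⟩
  have hne : Nat.find h ≠ 0 := by
    intro e
    rw [e] at h1
    exact absurd h1 (by rw [show pre x 0 = [] from rfl, h0]; simp)
  exact Bool.eq_false_of_not_eq_true (Nat.find_min h (by omega))

variable {P : Measure (Cantor × Cantor)} {Q : Measure Cantor}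
  {cov : ℕ → Str → Str → Bool} {Φ : Str → Str × ℕ →. ℕ} {b : Str × ℕ → ℕ} {y : Cantor}

/-- Along the true parameter the new strings have disjoint cylinders inside `G`, so their measures
add up to at most 2^(-n). The rounding errors are geometric in the code, which is why the precision
grows with it. -/
theorem eventually_mem_cumul [IsProbabilityMeasure Q]
    (hmono : ∀ n w t w' t', w <+: w' → t <+: t' → cov n w t = true → cov n w' t' = true)
    (hΦ : ∀ s t a v, s <+: t → v ∈ Φ s a → v ∈ Φ t a) (hb : ∀ a, ∃ k, b a ∈ Φ (pre y k) a)
    (hQ : ∀ w k, (b (w, k) : ℝ) ≤ Q.real (cyl w) * 2 ^ k + 3) {n : ℕ} {G : Set Cantor}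
    (hG : Q.real G ≤ 2⁻¹ ^ n)
    (hcov : ∀ w, cov n w (pre y w.length) = true → cyl w ⊆ G) (j : ℕ) :
    ∃ s ≤ 2 ^ (j + 4), ∀ᶠ m in atTop, s ∈ cumul (piece cov Φ n (pre y m)) (j + 1) := by
  classical
  let w : ℕ → Str := fun i => (Encodable.decode (α := Str) i).getD []
  let new : ℕ → Prop := fun i =>
    isNew (cov n) (w i) (pre y (w i).length) = true ∧ Encodable.encode (w i) = i
  have hnew : ∀ {i m}, (w i).length ≤ m →
      (isNew (cov n) (w i) (pre y m) = isNew (cov n) (w i) (pre y (w i).length)) := fun h =>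
    (isNew_of_prefix (cov n) (pre_prefix_pre y h) (by simp)).symm
  let u : ℕ → ℕ := fun i => if new i then b (w i, n + i + 3) else 0
  have hu : ∀ i, ∀ᶠ m in atTop, u i ∈ piece cov Φ n (pre y m) i := by
    intro i
    obtain ⟨k, hk⟩ := hb (w i, n + i + 3)
    filter_upwards [eventually_ge_atTop (w i).length, eventually_ge_atTop k] with m hm hkm
    have hdef : piece cov Φ n (pre y m) i =
        bif isNew (cov n) (w i) (pre y m) && decide (Encodable.encode (w i) = i) then
          Φ (pre y m) (w i, n + i + 3) else Part.some 0 := by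
      change cond (decide ((w i).length ≤ (pre y m).length)) _ _ = _
      simp only [length_pre, hm, decide_true, cond_true]
      rfl
    rw [hdef, hnew hm]
    by_cases h : new i
    · simp only [u, if_pos h, h.1, h.2, decide_true, Bool.and_self, cond_true]
      exact hΦ _ _ _ _ (pre_prefix_pre y hkm) hk
    · have h' : (isNew (cov n) (w i) (pre y (w i).length) &&
          decide (Encodable.encode (w i) = i)) = false := by
        simpa [new] using h
      simp only [u, if_neg h, h', cond_false]
      exact Part.mem_some 0
  refine ⟨∑ i ∈ Finset.range (j + 1), u i * 2 ^ (j + 1 - 1 - i), ?_, ?_⟩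
  · have hsum : ∑ i ∈ (Finset.range (j + 1)).filter new, Q.real (cyl (w i)) ≤ 2⁻¹ ^ n := by
      rw [← measureReal_biUnion_finset]
      · refine (measureReal_mono (iUnion₂_subset fun i hi => hcov _ ?_)).trans hG
        exact ((isNew_pre le_rfl).1 (Finset.mem_filter.1 hi).2.1).1
      · intro i hi i' hi' hne
        have h := (Finset.mem_filter.1 hi).2
        have h' := (Finset.mem_filter.1 hi').2
        refine disjoint_cyl_of_isNew (y := y) (m := max (w i).length (w i').length) (hmono n)
          (le_max_left _ _) (le_max_right _ _) ?_ ?_ fun e => hne (by rw [← h.2, e, h'.2])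
        · rw [hnew (le_max_left _ _)]
          exact h.1
        · rw [hnew (le_max_right _ _)]
          exact h'.1
      · exact fun i _ => measurableSet_cyl _
    have hreal : ((∑ i ∈ Finset.range (j + 1), u i * 2 ^ (j + 1 - 1 - i) : ℕ) : ℝ) ≤
        2 ^ (j + 4) := by
      push_cast
      calc ∑ i ∈ Finset.range (j + 1), (u i : ℝ) * 2 ^ (j + 1 - 1 - i)
          ≤ ∑ i ∈ Finset.range (j + 1), ((if new i then Q.real (cyl (w i)) else 0) *
              2 ^ (n + j + 3) + 3 * 2 ^ (j + 1 - 1 - i)) := by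
            refine Finset.sum_le_sum fun i hi => ?_
            rw [Finset.mem_range] at hi
            rw [show n + j + 3 = n + i + 3 + (j + 1 - 1 - i) by omega, pow_add, ← mul_assoc,
              ← add_mul]
            gcongr
            by_cases h : new i
            · simp only [u, if_pos h]
              exact hQ _ _
            · simp [u, if_neg h]
        _ = (∑ i ∈ (Finset.range (j + 1)).filter new, Q.real (cyl (w i))) * 2 ^ (n + j + 3) +
              3 * (2 ^ (j + 1) - 1) := by
            rw [Finset.sum_add_distrib, ← Finset.sum_mul, ← Finset.mul_sum, Finset.sum_filter,
              Finset.sum_range_reflect (fun i => (2 : ℝ) ^ i), geom_sum_eq (by norm_num),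
              show (2 : ℝ) - 1 = 1 by norm_num, div_one]
        _ ≤ 2⁻¹ ^ n * 2 ^ (n + j + 3) + 3 * 2 ^ (j + 1) := by
            gcongr
            linarith
        -- The measures contribute 8 · 2^j and the rounding errors 6 · 2^j, below the threshold 16 ·
        -- 2^j.
        _ = 14 * 2 ^ j := by
            rw [add_assoc, pow_add, ← mul_assoc, ← mul_pow]
            norm_num
            ring
        _ ≤ 2 ^ (j + 4) := by
            rw [pow_add]
            nlinarith [pow_pos (two_pos (α := ℝ)) j]
    exact_mod_cast hreal
  · have := (Filter.eventually_all_finset (Finset.range (j + 1))).2 fun i _ => hu i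
    filter_upwards [this] with m hm
    exact mem_cumul.2 ⟨u, fun i hi => hm i (Finset.mem_range.2 hi), rfl⟩

/-- A strict bound for Q(Δ(w)) holds for the conditional probabilities that converge to it, from
some prefix on. -/
theorem eventually_mul_measureReal_lt [IsFiniteMeasure P] (hQ : IsCondAt P y Q)
    (hy : y ∈ MLR P.snd) {w : Str} {k v : ℕ} (h : Q.real (cyl w) * 2 ^ k < v) :
    ∀ᶠ m in atTop, ((2 ^ k : ℕ) : ℝ) * P.real (cyl₂ (w, pre y m)) <
      (v : ℝ) * P.real (cyl₂ ([], pre y m)) := by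
  have := hQ.1
  have h1 : ((2 ^ k : ℕ) : ℝ≥0∞) * Q (cyl w) < v := by
    have := (natCast_mul_measureReal_lt_iff (μ := Q) (ν := Q) (a := 2 ^ k) (b := v) (A := cyl w)
      (B := univ)).1 (by simpa [mul_comm] using h)
    simpa using this
  have h2 : Tendsto (fun m => ((2 ^ k : ℕ) : ℝ≥0∞) * condStr P (pre y m) (cyl w)) atTop
      (𝓝 (((2 ^ k : ℕ) : ℝ≥0∞) * Q (cyl w))) :=
    ENNReal.Tendsto.const_mul (hQ.2 w) (Or.inr (by simp))
  filter_upwards [h2.eventually_lt_const h1] with m hm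
  rw [natCast_mul_measureReal_lt_iff, ← slice_cyl, ← mul_condStr_apply, ← snd_cyl,
    mul_left_comm, mul_comm]
  exact ENNReal.mul_lt_mul_left (snd_cyl_ne_zero hy m) (measure_ne_top _ _) hm

theorem mlrSection_subset_mlrOracle [IsProbabilityMeasure P]
    (hP : ComputableReal fun s => P.real (cyl₂ s)) (hy : y ∈ MLR P.snd) (hQ : IsCondAt P y Q)
    (hc : ComputableMeasureIn (oracle y) cyl Q) : mlrSection P y ⊆ MLROracle Q y := by
  have := hQ.1
  intro x hx
  refine mem_mlRandomIn.2 fun U hU => ?_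
  by_contra! hxU
  obtain ⟨q, hq, hqU⟩ := hU.re.exists_use
  -- The prefix used of y becomes the second coordinate. The section of layer n at y is then layer n
  -- of `U`, while other sections may be arbitrarily large; `enterSet` trims them.
  have hV : REPred fun z : (Str × Str) × ℕ => q (z.1.2, (z.1.1, z.2)) :=
    hq.comp (f := fun z : (Str × Str) × ℕ => (z.1.2, (z.1.1, z.2)))
      (Computable.pair (Computable.snd.comp Computable.fst)
        (Computable.pair (Computable.fst.comp Computable.fst) Computable.snd))
  obtain ⟨cov, hcov, hmono, hsound, hcomplete, hnil⟩ := exists_computable_cover hV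
  obtain ⟨Φ, b, hΦ, mΦ, iΦ, hb⟩ := exists_approximates_dyadicUpper hc
  refine notMem_mlRandomIn (B := cyl₂) (μ := P) (U := enterSet P cov Φ) (C := 2)
    (enters_re hP hcov hΦ) (by simp) (measure_layer_enterSet_le mΦ)
    (Frequently.of_forall fun n => ?_) hx
  have hsub : ∀ w, cov n w (pre y w.length) = true → cyl w ⊆ layer cyl U n := by
    intro w hw z hz
    obtain ⟨a, a', ha, ha', haU⟩ := hsound n _ _ hw
    refine mem_layer.2 ⟨a, (hqU _).2 ⟨a'.length, ?_⟩, cyl_subset_cyl ha hz⟩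
    rwa [mem_cyl_iff.1 (prefix_pre_iff.1 ha').2]
  obtain ⟨l, hl⟩ : ∃ l, ∀ m, l ≤ m → isNew (cov n) (pre x l) (pre y m) = true := by
    refine exists_isNew (hnil n) ?_
    obtain ⟨a, ha, hxa⟩ := mem_layer.1 (hxU n)
    obtain ⟨k, hk⟩ := (hqU _).1 ha
    obtain ⟨N, hN⟩ := hcomplete n a (pre y k) hk
    refine ⟨max N (max a.length k), hN _ _ (prefix_pre_iff.2 ⟨?_, hxa⟩) (pre_prefix_pre y ?_) ?_⟩
    · exact (le_max_left _ _).trans (le_max_right _ _)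
    · exact (le_max_right _ _).trans (le_max_right _ _)
    · simp
  set w := pre x l
  have hG : Q.real (layer cyl U n) ≤ 2⁻¹ ^ n := by
    have h1 := ENNReal.toReal_mono (ENNReal.pow_ne_top (by simp)) (hU.small n).le
    simpa [measureReal_def] using h1
  obtain ⟨s, hs, hsm⟩ := eventually_mem_cumul hmono mΦ iΦ (fun w k => (hb w k).2) hG hsub
    (Encodable.encode w)
  obtain ⟨k, hk⟩ := iΦ (w, n + Encodable.encode w + 3)
  obtain ⟨m, hm1, hm2, hm3, hm4⟩ := (hsm.and ((eventually_mul_measureReal_lt hQ hy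
    (hb w (n + Encodable.encode w + 3)).1).and ((eventually_ge_atTop k).and
      (eventually_ge_atTop l)))).exists
  refine mem_layer.2 ⟨(w, pre y m), ⟨b (w, n + Encodable.encode w + 3), ?_, hl m hm4,
    mΦ _ _ _ _ (pre_prefix_pre y hm3) hk, ⟨s, hm1, hs⟩, hm2⟩, mem_cyl_pre x l, mem_cyl_pre y m⟩
  simpa [w] using hm4

end Completeness

end BayesML

theorem theorem5 (P : MeasureTheory.Measure (BayesML.Cantor × BayesML.Cantor))
    [MeasureTheory.IsProbabilityMeasure P]
    (hP : BayesML.ComputableMeasureIn ∅ BayesML.cyl₂ P) :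
    (∀ y ∈ BayesML.MLR P.snd,
      BayesML.IsCondAt P y (BayesML.condAt P y) ∧
      BayesML.MLR (BayesML.condAt P y) ⊆ BayesML.prefixInter P y ∧
      BayesML.mlrSection P y ⊆ BayesML.prefixInter P y) ∧
    (BayesML.PosteriorConsistent P →
      ∀ y ∈ BayesML.MLR P.snd,
        (BayesML.prefixInter P y = BayesML.mlrSection P y ∧
          BayesML.MLR (BayesML.condAt P y) ⊆ BayesML.mlrSection P y ∧
          BayesML.MLROracle (BayesML.condAt P y) y ⊆ BayesML.MLR (BayesML.condAt P y)) ∧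
        (BayesML.ComputableMeasureIn (BayesML.oracle y) BayesML.cyl (BayesML.condAt P y) →
          BayesML.prefixInter P y = BayesML.mlrSection P y ∧
          BayesML.mlrSection P y = BayesML.MLR (BayesML.condAt P y) ∧
          BayesML.MLR (BayesML.condAt P y) = BayesML.MLROracle (BayesML.condAt P y) y)) := by
  have hc := hP.computableReal
  refine ⟨fun y hy => ⟨BayesML.isCondAt_condAt hc hy, BayesML.mlr_condAt_subset hc hy,
    BayesML.mlrSection_subset y⟩, fun h y hy => ?_⟩
  have hsub := BayesML.prefixInter_subset hc (h.disjointSection hc) hy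
  have heq := hsub.antisymm (BayesML.mlrSection_subset y)
  have hle := (BayesML.mlr_condAt_subset hc hy).trans hsub
  have hor := BayesML.mlrOracle_subset (BayesML.condAt P y) y
  refine ⟨⟨heq, hle, hor⟩, fun hcomp => ?_⟩
  have hse := BayesML.mlrSection_subset_mlrOracle hc hy (BayesML.isCondAt_condAt hc hy) hcomp
  exact ⟨heq, (hse.trans hor).antisymm hle, (hle.trans hse).antisymm hor⟩
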